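/- For $R>0$ let $U(R)=\{z\in\mathbb C: |z|<R\}$. Fix $R_0>0$. For $R>2R_0$ consider a Higgs bundle $(E,\overline\partial_E,\theta)$ of rank $2$ on $U(R)$, write $\theta=f\,dz$ with $f$ a holomorphic endomorphism of $E$, and suppose that there is a decomposition $(E,f)=(E_1,1)\oplus(E_{-1},-1)$ into line bundles (i.e. $f=\pm1$ on $E_{\pm1}$). Fix an isomorphism $\kappa:\det(E)\simeq\mathcal O_{U(R)}$. Let $\mathcal H(E,\theta;\kappa)$ be the set of harmonic metrics $h$ of $(E,\theta)$ (smooth Hermitian metrics whose Chern connection has curvature $R(h)$ satisfying $R(h)+[\theta,\theta^\dagger_h]=0$) such that $\det(h)=1$ under $\kappa$. For a Hermitian metric $h$ let $\pi_1$ be the projection of $E$ onto $E_1$ along $E_{-1}$, let $\pi_1^h$ be the $h$-orthogonal projection onto $E_1$, and set $\rho=\pi_1-\pi_1^h$, with norm $|\rho|_h=\mathrm{Tr}(\rho\rho^\dagger_h)^{1/2}$. In all statements below the constants do not depend on $R$, on $(E,\overline\partial_E,\theta)$, on $\kappa$ (or $C$), on the frames, or on $h$, except through the quantities displayed. 1.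 For any $0<\gamma<2\sqrt2$ there exists $C(R_0,\gamma)>0$ such that for all such data and any $h\in\mathcal H(E,\theta;\kappa)$, $$|\rho|_h\le C(R_0,\gamma)\,e^{-\gamma(R-|z|)}\quad\text{on } U(R-R_0).$$ 2. For any $0<\gamma<4$, $\gamma_0>2$ and $B>0$ there exists $C(R_0,\gamma,\gamma_0,B)>0$ such that the following holds. Let $v_1,v_2$ be holomorphic frames of $E_1,E_{-1}$ with $\kappa(v_1\wedge v_2)=1$, and let $h\in\mathcal H(E,\theta;\kappa)$ satisfy, on $U(R)$, $$h(v_1,v_1)+h(v_2,v_2)\le B,$$ $$|\partial_z h(v_1,v_1)|+|\partial_z h(v_2,v_2)|+|\partial_z h(v_1,v_2)|+|\partial_{\bar z} h(v_1,v_2)|\le B\,e^{-\gamma_0(R-|z|)}.$$ Then $|\rho|_h\le C(R_0,\gamma,\gamma_0,B)\,e^{-\gamma(R-|z|)}$ on $U(R-R_0)$. Now let $C$ be a non-degenerate symmetric pairing of $(E,\theta)$ (a holomorphic non-degenerate symmetric bilinear form on $E$ for which $f$ is self-adjoint) such that $\det(C)=1$ under $\kappa$, and let $\mathcal H(E,\theta;C)$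 be the set of harmonic metrics of $(E,\theta)$ compatible with $C$ (i.e. the isomorphism $E\simeq E^\vee$ given by $C$ is isometric for $h$ and the dual metric $h^\vee$). 3. For any $0<\gamma<4$ there exists $C(R_0,\gamma)>0$ such that for all such data and any $h\in\mathcal H(E,\theta;C)$, $|\rho|_h\le C(R_0,\gamma)\,e^{-\gamma(R-|z|)}$ on $U(R-R_0)$. 4. For any $0<\gamma<4$ and any integers $j,k\ge0$ there exists $C_{j,k}(R_0,\gamma)>0$ such that for all such data, any holomorphic frames $v_1,v_2$ of $E_1,E_{-1}$ with $C(v_i,v_i)=1$, and any $h\in\mathcal H(E,\theta;C)$, one has on $U(R-R_0)$ $$|\partial_z^j\partial_{\bar z}^k(h(v_i,v_i)-1)|\le C_{j,k}(R_0,\gamma)\,e^{-2\gamma(R-|z|)}\quad(i=1,2),$$ $$|\partial_z^j\partial_{\bar z}^k h(v_1,v_2)|\le C_{j,k}(R_0,\gamma)\,e^{-\gamma(R-|z|)}.$$ -/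

import Mathlib

open Bundle Set
open scoped Manifold ContDiff

universe u

noncomputable section

namespace HiggsDisc

/-! ### Hermitian linear algebra on a finite-dimensional complex vector space

A Hermitian product on `V` is an `InnerProductSpace.Core ℂ V`. Mathlib's inner product is conjugate
linear in its first variable, so the Hermitian form `h(u, v)`, linear in `u`, is `inner v u`. -/

section LinearAlgebra

variable {V : Type*} [AddCommGroup V] [Module ℂ V]

/-- The Hermitian form `h(u, v)`, linear in `u` and conjugate linear in `v`. -/
def form (c : InnerProductSpace.Core ℂ V) (u v : V) : ℂ := c.inner v u

/-- The norm `|u|_h` of a vector. -/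
def vecNorm (c : InnerProductSpace.Core ℂ V) (u : V) : ℝ := √(form c u u).re

/-- The adjoint `g†_h` of an endomorphism with respect to `h`. -/
def adjoint [FiniteDimensional ℂ V] (c : InnerProductSpace.Core ℂ V) (g : V →ₗ[ℂ] V) :
    V →ₗ[ℂ] V :=
  letI : NormedAddCommGroup V := c.toNormedAddCommGroup
  letI : InnerProductSpace ℂ V := InnerProductSpace.ofCore c.toCore
  LinearMap.adjoint g

/-- The norm `|g|_h = Tr(g g†_h)^{1/2}` on endomorphisms induced by `h`. -/
def endNorm [FiniteDimensional ℂ V] (c : InnerProductSpace.Core ℂ V) (g : V →ₗ[ℂ] V) : ℝ :=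
  √(LinearMap.trace ℂ V (g ∘ₗ adjoint c g)).re

/-- The norm on the dual space induced by `h` (the operator norm of a functional). -/
def dualNorm [FiniteDimensional ℂ V] (c : InnerProductSpace.Core ℂ V) (φ : V →ₗ[ℂ] ℂ) : ℝ :=
  letI : NormedAddCommGroup V := c.toNormedAddCommGroup
  letI : InnerProductSpace ℂ V := InnerProductSpace.ofCore c.toCore
  ‖LinearMap.toContinuousLinearMap φ‖

/-- The `h`-orthogonal projection of `V` onto the subspace `W`, as an endomorphism of `V`. -/
def orthProj [FiniteDimensional ℂ V] (c : InnerProductSpace.Core ℂ V) (W : Submodule ℂ V) :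
    V →ₗ[ℂ] V :=
  letI : NormedAddCommGroup V := c.toNormedAddCommGroup
  letI : InnerProductSpace ℂ V := InnerProductSpace.ofCore c.toCore
  (W.starProjection : V →L[ℂ] V).toLinearMap

end LinearAlgebra

/-! ### The disc, functions on it and their Wirtinger derivatives -/

/-- The disc `U(R) = {z ∈ ℂ : |z| < R}`, an open submanifold of `ℂ`. -/
def disc (R : ℝ) : TopologicalSpace.Opens ℂ := ⟨Metric.ball 0 R, Metric.isOpen_ball⟩

/-- Extension by zero to `ℂ` of a function on the disc; on the (open) disc its derivatives are
those of the given function. -/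
def ext {R : ℝ} (g : disc R → ℂ) : ℂ → ℂ := Function.extend Subtype.val g 0

/-- `∂_z = (∂_x - i ∂_y) / 2`. -/
def dz (g : ℂ → ℂ) (z : ℂ) : ℂ :=
  (fderiv ℝ g z 1 - Complex.I * fderiv ℝ g z Complex.I) / 2

/-- `∂_{z̄} = (∂_x + i ∂_y) / 2`. -/
def dzbar (g : ℂ → ℂ) (z : ℂ) : ℂ :=
  (fderiv ℝ g z 1 + Complex.I * fderiv ℝ g z Complex.I) / 2

/-- `g` is a holomorphic function on the open subset `V` of the disc. -/
def HolFunOn {R : ℝ} (g : disc R → ℂ) (V : Set (disc R)) : Prop :=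
  DifferentiableOn ℂ (ext g) (Subtype.val '' V)

/-- `g` is a `C^∞`-function (in the real sense) on the open subset `V` of the disc. -/
def SmoothFunOn {R : ℝ} (g : disc R → ℂ) (V : Set (disc R)) : Prop :=
  ContDiffOn ℝ ∞ (ext g) (Subtype.val '' V)

/-! ### Rank two Higgs bundles on the disc -/

/-- The model fibre of rank two bundles. -/
abbrev Fib : Type := EuclideanSpace ℂ (Fin 2)

/-- A holomorphic vector bundle of rank `2` on the disc `U(R)`. -/
structure HolBundle (R : ℝ) where
  fiber : disc R → Type u
  [addCommGroup : ∀ x, AddCommGroup (fiber x)]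
  [module : ∀ x, Module ℂ (fiber x)]
  [topTotal : TopologicalSpace (TotalSpace Fib fiber)]
  [topFiber : ∀ x, TopologicalSpace (fiber x)]
  [fiberBundle : FiberBundle Fib fiber]
  [vectorBundle : VectorBundle ℂ Fib fiber]
  [holomorphic : ContMDiffVectorBundle ω Fib fiber 𝓘(ℂ, ℂ)]

attribute [instance] HolBundle.addCommGroup HolBundle.module HolBundle.topTotal
  HolBundle.topFiber HolBundle.fiberBundle HolBundle.vectorBundle HolBundle.holomorphic

instance {R : ℝ} (E : HolBundle R) (x : disc R) : FiniteDimensional ℂ (E.fiber x) :=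
  VectorBundle.finiteDimensional ℂ Fib E.fiber x

/-- `s` is a holomorphic section of `E` on the open set `V` (its values off `V` are irrelevant). -/
def HolBundle.HolOn {R : ℝ} (E : HolBundle R) (s : ∀ x, E.fiber x) (V : Set (disc R)) : Prop :=
  ContMDiffOn 𝓘(ℂ, ℂ) (𝓘(ℂ, ℂ).prod 𝓘(ℂ, Fib)) ω
    (fun x => TotalSpace.mk' Fib x (s x)) V

/-- A rank two Higgs bundle `(E, ∂̄_E, θ)` on the disc. The Higgs field is written `θ = f dz` with
a holomorphic endomorphism `f` of `E` (the condition `θ ∧ θ = 0` is void on a curve). -/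
structure HiggsBundle (R : ℝ) extends HolBundle R where
  f : ∀ x, fiber x →ₗ[ℂ] fiber x
  f_hol : ∀ (V : Set (disc R)) (s : ∀ x, fiber x), IsOpen V →
    toHolBundle.HolOn s V → toHolBundle.HolOn (fun x => f x (s x)) V

/-- A decomposition `(E, f) = (E_1, 1) ⊕ (E_{-1}, -1)` into line bundles. Since `E_{±1}` is the
kernel of `f ∓ 1`, the two summands are automatically holomorphic subbundles. -/
structure Splitting {R : ℝ} (E : HiggsBundle R) where
  E₁ : ∀ x, Submodule ℂ (E.fiber x)
  Eneg : ∀ x, Submodule ℂ (E.fiber x)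
  isCompl : ∀ x, IsCompl (E₁ x) (Eneg x)
  rank_one : ∀ x, Module.finrank ℂ (E₁ x) = 1
  rank_neg : ∀ x, Module.finrank ℂ (Eneg x) = 1
  f_one : ∀ x, ∀ u ∈ E₁ x, E.f x u = u
  f_neg : ∀ x, ∀ u ∈ Eneg x, E.f x u = -u

/-- The projection `π_1` onto `E_1` along `E_{-1}`, as an endomorphism of `E`. -/
def Splitting.proj {R : ℝ} {E : HiggsBundle R} (D : Splitting E) (x : disc R) :
    E.fiber x →ₗ[ℂ] E.fiber x :=
  Submodule.projection _ _ (D.isCompl x)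

/-- A holomorphic isomorphism `κ : det(E) ≃ 𝒪`, given as a nowhere vanishing holomorphic family of
alternating forms: `κ(u ∧ v)` is `κ x ![u, v]`. -/
structure DetTriv {R : ℝ} (E : HolBundle R) where
  κ : ∀ x, E.fiber x [⋀^Fin 2]→ₗ[ℂ] ℂ
  ne_zero : ∀ x, κ x ≠ 0
  hol : ∀ (V : Set (disc R)) (s t : ∀ x, E.fiber x), IsOpen V → E.HolOn s V → E.HolOn t V →
    HolFunOn (fun x => κ x ![s x, t x]) V

/-! ### Hermitian metrics, Chern connection and harmonic metrics -/

/-- A `C^∞` Hermitian metric on a holomorphic vector bundle. As `E` has local holomorphic frames,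
`h` is `C^∞` if and only if `h(s, t)` is `C^∞` for all local holomorphic sections `s`, `t`. -/
structure HermMetric {R : ℝ} (E : HolBundle R) where
  core : ∀ x, InnerProductSpace.Core ℂ (E.fiber x)
  smooth : ∀ (V : Set (disc R)) (s t : ∀ x, E.fiber x), IsOpen V → E.HolOn s V → E.HolOn t V →
    SmoothFunOn (fun x => form (core x) (s x) (t x)) V

namespace HermMetric

variable {R : ℝ} {E : HolBundle R} (h : HermMetric E)

/-- The function `h(s, t)` for sections `s`, `t` (extended by zero to `ℂ`). -/
def pair (s t : ∀ x, E.fiber x) : ℂ → ℂ := ext fun x => form (h.core x) (s x) (t x)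

/-- The transpose (= complex conjugate) of the Gram matrix `H_{ij} = h(v_i, v_j)` of a frame. -/
def gramT (v : Fin 2 → ∀ x, E.fiber x) (z : ℂ) : Matrix (Fin 2) (Fin 2) ℂ :=
  Matrix.of fun i j => h.pair (v j) (v i) z

/-- The coefficient `A = H̄⁻¹ ∂_z H̄` of the connection form `A dz` of the Chern connection in the
holomorphic frame `v`, i.e. `∂_{E,h,z} v_j = ∑ i, A i j • v_i`. -/
def chernForm (v : Fin 2 → ∀ x, E.fiber x) (z : ℂ) : Matrix (Fin 2) (Fin 2) ℂ :=
  (h.gramT v z)⁻¹ * Matrix.of fun i j => dz (fun w => h.gramT v w i j) z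

/-- The coefficient `∂_{z̄} A` of the curvature `R(h) = ∂_{z̄} A dz̄ ∧ dz` of the Chern connection in
the holomorphic frame `v`. -/
def chernCurv (v : Fin 2 → ∀ x, E.fiber x) (z : ℂ) : Matrix (Fin 2) (Fin 2) ℂ :=
  Matrix.of fun i j => dzbar (fun w => h.chernForm v w i j) z

/-- `det(h) = 1` under `κ`: the metric on `det(E)` induced by `h` satisfies
`|u ∧ v|_h^2 = |κ(u ∧ v)|^2`. -/
def DetOne (K : DetTriv E) : Prop :=
  ∀ x (u v : E.fiber x),
    form (h.core x) u u * form (h.core x) v v - form (h.core x) u v * form (h.core x) v u =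
      ((‖K.κ x ![u, v]‖ ^ 2 : ℝ) : ℂ)

end HermMetric

/-- `h` is a harmonic metric of the Higgs bundle: the Hitchin equation `R(h) + [θ, θ†_h] = 0`, i.e.
`∂_{z̄} A = [f, f†_h]` in every local holomorphic frame. -/
def IsHarmonic {R : ℝ} (E : HiggsBundle R) (h : HermMetric E.toHolBundle) : Prop :=
  ∀ (V : Set (disc R)) (v : Fin 2 → ∀ x, E.fiber x), IsOpen V →
    IsLocalFrameOn 𝓘(ℂ, ℂ) Fib ω v V →
      ∀ x ∈ V, ∀ j,
        ∑ i, h.chernCurv v x i j • v i x =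
          (E.f x ∘ₗ adjoint (h.core x) (E.f x) - adjoint (h.core x) (E.f x) ∘ₗ E.f x) (v j x)

/-- The set `ℋ(E, θ; κ)` of harmonic metrics `h` with `det(h) = 1`. -/
def harmonicDetOne {R : ℝ} (E : HiggsBundle R) (K : DetTriv E.toHolBundle) :
    Set (HermMetric E.toHolBundle) :=
  {h | IsHarmonic E h ∧ h.DetOne K}

/-- `|ρ|_h` for `ρ = π_1 - π_1^h`, where `π_1^h` is the `h`-orthogonal projection onto `E_1`. -/
def rhoNorm {R : ℝ} {E : HiggsBundle R} (D : Splitting E) (h : HermMetric E.toHolBundle)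
    (x : disc R) : ℝ :=
  endNorm (h.core x) (D.proj x - orthProj (h.core x) (D.E₁ x))

/-! ### Symmetric pairings -/

/-- A (holomorphic) non-degenerate symmetric pairing of `(E, θ)`; the Higgs field is self-adjoint
with respect to it. -/
structure SymPairing {R : ℝ} (E : HiggsBundle R) where
  C : ∀ x, LinearMap.BilinForm ℂ (E.fiber x)
  symm : ∀ x u v, C x u v = C x v u
  nondegenerate : ∀ x, (C x).Nondegenerate
  self_adjoint : ∀ x u v, C x (E.f x u) v = C x u (E.f x v)
  hol : ∀ (V : Set (disc R)) (s t : ∀ x, E.fiber x), IsOpen V →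
    E.HolOn s V → E.HolOn t V → HolFunOn (fun x => C x (s x) (t x)) V

/-- `det(C) = 1` under `κ`. -/
def SymPairing.DetOne {R : ℝ} {E : HiggsBundle R} (S : SymPairing E)
    (K : DetTriv E.toHolBundle) : Prop :=
  ∀ x (u v : E.fiber x),
    S.C x u u * S.C x v v - S.C x u v * S.C x v u = K.κ x ![u, v] ^ 2

/-- `h` is compatible with `C`: the isomorphism `E ≃ E^∨`, `u ↦ C(u, ·)`, is isometric with respect
to `h` and the metric on the dual bundle `E^∨` induced by `h`. -/
def Compatible {R : ℝ} {E : HiggsBundle R} (S : SymPairing E)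
    (h : HermMetric E.toHolBundle) : Prop :=
  ∀ x (u : E.fiber x), dualNorm (h.core x) (S.C x u) = vecNorm (h.core x) u

/-- The set `ℋ(E, θ; C)` of harmonic metrics compatible with `C`. -/
def harmonicSym {R : ℝ} (E : HiggsBundle R) (S : SymPairing E) :
    Set (HermMetric E.toHolBundle) :=
  {h | IsHarmonic E h ∧ Compatible S h}

/-- `v 0`, `v 1` are (global holomorphic) sections of `E_1`, `E_{-1}`. -/
def IsAdapted {R : ℝ} {E : HiggsBundle R} (D : Splitting E)
    (v : Fin 2 → ∀ x, E.fiber x) : Prop :=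
  (∀ i, E.HolOn (v i) univ) ∧ (∀ x, v 0 x ∈ D.E₁ x) ∧ ∀ x, v 1 x ∈ D.Eneg x

end HiggsDisc

end

noncomputable section

namespace HiggsDisc

open scoped ComplexConjugate Topology
open Filter

/-! ### Wirtinger calculus -/

/-- The real linear map `v ↦ p v + q v̄`. -/
def wirtMap (p q : ℂ) : ℂ →L[ℝ] ℂ :=
  p • ContinuousLinearMap.id ℝ ℂ + q • (Complex.conjCLE : ℂ →L[ℝ] ℂ)

@[simp] lemma wirtMap_apply (p q v : ℂ) : wirtMap p q v = p * v + q * conj v := by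
  simp [wirtMap]

lemma wirtMap_eq (L : ℂ →L[ℝ] ℂ) :
    wirtMap ((L 1 - Complex.I * L Complex.I) / 2) ((L 1 + Complex.I * L Complex.I) / 2) = L := by
  ext v
  have hv : L v = v.re * L 1 + v.im * L Complex.I := by
    have : v = v.re • (1 : ℂ) + v.im • Complex.I := by
      simp [Complex.re_add_im]
    conv_lhs => rw [this, map_add, map_smul, map_smul]
    simp
  rw [hv, wirtMap_apply]
  apply Complex.ext <;> simp <;> ring

/-- `f` is real differentiable at `z` with `∂_z f = p` and `∂_{z̄} f = q`. -/
def HasWirtAt (f : ℂ → ℂ) (p q z : ℂ) : Prop := HasFDerivAt f (wirtMap p q) z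

namespace HasWirtAt
variable {f g : ℂ → ℂ} {p q p' q' z : ℂ}

lemma dz_eq (h : HasWirtAt f p q z) : dz f z = p := by
  rw [dz, HasFDerivAt.fderiv h]
  simp only [wirtMap_apply, map_one, Complex.conj_I]
  linear_combination (-p / 2 + q / 2) * Complex.I_mul_I

lemma dzbar_eq (h : HasWirtAt f p q z) : dzbar f z = q := by
  rw [dzbar, HasFDerivAt.fderiv h]
  simp only [wirtMap_apply, map_one, Complex.conj_I]
  linear_combination (p / 2 - q / 2) * Complex.I_mul_I

lemma congr_deriv (h : HasWirtAt f p q z) (hp : p = p') (hq : q = q') : HasWirtAt f p' q' z := by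
  subst hp hq; exact h

lemma congr_of_eventuallyEq (h : HasWirtAt f p q z) (hg : g =ᶠ[𝓝 z] f) : HasWirtAt g p q z :=
  HasFDerivAt.congr_of_eventuallyEq h hg

lemma const (c z : ℂ) : HasWirtAt (fun _ => c) 0 0 z := by
  have : wirtMap 0 0 = 0 := by ext v; simp
  rw [HasWirtAt, this]; exact hasFDerivAt_const c z

lemma id (z : ℂ) : HasWirtAt (fun w => w) 1 0 z := by
  have : wirtMap 1 0 = ContinuousLinearMap.id ℝ ℂ := by ext v; simp
  rw [HasWirtAt, this]; exact hasFDerivAt_id z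

lemma add (hf : HasWirtAt f p q z) (hg : HasWirtAt g p' q' z) :
    HasWirtAt (fun w => f w + g w) (p + p') (q + q') z := by
  have : wirtMap (p + p') (q + q') = wirtMap p q + wirtMap p' q' := by ext v; simp; ring
  rw [HasWirtAt, this]; exact HasFDerivAt.add hf hg

lemma sub (hf : HasWirtAt f p q z) (hg : HasWirtAt g p' q' z) :
    HasWirtAt (fun w => f w - g w) (p - p') (q - q') z := by
  have : wirtMap (p - p') (q - q') = wirtMap p q - wirtMap p' q' := by ext v; simp; ring
  rw [HasWirtAt, this]; exact HasFDerivAt.sub hf hg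

lemma mul (hf : HasWirtAt f p q z) (hg : HasWirtAt g p' q' z) :
    HasWirtAt (fun w => f w * g w) (p * g z + f z * p') (q * g z + f z * q') z := by
  have : wirtMap (p * g z + f z * p') (q * g z + f z * q') =
    f z • wirtMap p' q' + g z • wirtMap p q := by ext v; simp; ring
  rw [HasWirtAt, this]; exact HasFDerivAt.mul hf hg

lemma const_mul (c : ℂ) (hf : HasWirtAt f p q z) :
    HasWirtAt (fun w => c * f w) (c * p) (c * q) z :=
  ((const c z).mul hf).congr_deriv (by simp) (by simp)

lemma star (hf : HasWirtAt f p q z) :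
    HasWirtAt (fun w => conj (f w)) (conj q) (conj p) z := by
  have : wirtMap ((starRingEnd ℂ) q) ((starRingEnd ℂ) p) =
      (Complex.conjCLE : ℂ →L[ℝ] ℂ).comp (wirtMap p q) := by
    ext v; simp; ring
  rw [HasWirtAt, this]
  exact (Complex.conjCLE : ℂ →L[ℝ] ℂ).hasFDerivAt.comp z hf

lemma comp (hf : HasWirtAt f p q z) (hg : HasWirtAt g p' q' (f z)) :
    HasWirtAt (fun w => g (f w)) (p' * p + q' * (starRingEnd ℂ) q)
      (p' * q + q' * (starRingEnd ℂ) p) z := by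
  have : wirtMap (p' * p + q' * (starRingEnd ℂ) q) (p' * q + q' * (starRingEnd ℂ) p) =
      (wirtMap p' q').comp (wirtMap p q) := by
    ext v; simp; ring
  rw [HasWirtAt, this]
  exact HasFDerivAt.comp z hg hf

lemma of_hasDerivAt {g' : ℂ} (hg : HasDerivAt g g' z) : HasWirtAt g g' 0 z := by
  have h := hg.hasFDerivAt.restrictScalars ℝ
  have e : wirtMap g' 0 = (ContinuousLinearMap.toSpanSingleton ℂ g').restrictScalars ℝ := by
    ext v; simp [mul_comm]
  rw [HasWirtAt, e]; exact h

lemma comp_hasDerivAt {g' : ℂ} (hf : HasWirtAt f p q z) (hg : HasDerivAt g g' (f z)) :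
    HasWirtAt (fun w => g (f w)) (g' * p) (g' * q) z :=
  (hf.comp (of_hasDerivAt hg)).congr_deriv (by simp) (by simp)

end HasWirtAt

lemma hasWirtAt_of_differentiableAt {f : ℂ → ℂ} {z : ℂ} (h : DifferentiableAt ℝ f z) :
    HasWirtAt f (dz f z) (dzbar f z) z := by
  rw [HasWirtAt, dz, dzbar, wirtMap_eq]; exact h.hasFDerivAt

lemma hasWirtAt_of_contDiffAt {f : ℂ → ℂ} {z : ℂ} {n : ℕ∞ω} (h : ContDiffAt ℝ n f z)
    (hn : n ≠ 0) : HasWirtAt f (dz f z) (dzbar f z) z :=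
  hasWirtAt_of_differentiableAt (h.differentiableAt hn)

lemma HasWirtAt.ofReal_comp {f : ℂ → ℝ} {φ : ℝ → ℝ} {φ' : ℝ} {p q z : ℂ}
    (hf : HasWirtAt (fun w => (f w : ℂ)) p q z) (hφ : HasDerivAt φ φ' (f z)) :
    HasWirtAt (fun w => ((φ (f w) : ℝ) : ℂ)) (φ' * p) (φ' * q) z := by
  have h1 : HasFDerivAt f (Complex.reCLM.comp (wirtMap p q)) z := by
    have := Complex.reCLM.hasFDerivAt.comp z hf
    simpa [Function.comp_def] using this
  have h2 := Complex.ofRealCLM.hasFDerivAt.comp z (hφ.hasFDerivAt.comp z h1)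
  have h3 : ∀ v, (wirtMap p q v).im = 0 := by
    intro v
    have h4 := Complex.imCLM.hasFDerivAt.comp z hf
    have h5 : HasFDerivAt (fun _ : ℂ => (0 : ℝ)) (Complex.imCLM.comp (wirtMap p q)) z := by
      simpa [Function.comp_def] using h4
    have := h5.unique (hasFDerivAt_const (0 : ℝ) z)
    exact DFunLike.congr_fun this v
  have e : wirtMap (φ' * p) (φ' * q) = Complex.ofRealCLM.comp
      ((ContinuousLinearMap.toSpanSingleton ℝ φ').comp (Complex.reCLM.comp (wirtMap p q))) := by
    ext v
    have : wirtMap p q v = ((wirtMap p q v).re : ℂ) := by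
      apply Complex.ext <;> simp [-wirtMap_apply, h3]
    have h6 : wirtMap (φ' * p) (φ' * q) v = φ' * wirtMap p q v := by simp; ring
    rw [h6, this]
    simp [-wirtMap_apply, mul_comm]
  rw [HasWirtAt, e]
  exact h2

section ContDiff
variable {f g : ℂ → ℂ} {z : ℂ}

lemma contDiffAt_dz {m n : ℕ∞ω} (h : ContDiffAt ℝ n f z) (hm : m + 1 ≤ n) :
    ContDiffAt ℝ m (dz f) z := by
  have h1 := h.fderiv_right hm
  unfold HiggsDisc.dz
  exact ((h1.clm_apply contDiffAt_const).sub
    (contDiffAt_const.mul (h1.clm_apply contDiffAt_const))).div_const _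

lemma contDiffAt_dzbar {m n : ℕ∞ω} (h : ContDiffAt ℝ n f z) (hm : m + 1 ≤ n) :
    ContDiffAt ℝ m (dzbar f) z := by
  have h1 := h.fderiv_right hm
  unfold HiggsDisc.dzbar
  exact ((h1.clm_apply contDiffAt_const).add
    (contDiffAt_const.mul (h1.clm_apply contDiffAt_const))).div_const _

lemma contDiffAt_dz_infty (h : ContDiffAt ℝ ∞ f z) : ContDiffAt ℝ ∞ (HiggsDisc.dz f) z :=
  contDiffAt_dz h (by simp)

lemma contDiffAt_dzbar_infty (h : ContDiffAt ℝ ∞ f z) : ContDiffAt ℝ ∞ (HiggsDisc.dzbar f) z :=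
  contDiffAt_dzbar h (by simp)

lemma dz_congr (h : f =ᶠ[𝓝 z] g) : dz f z = dz g z := by
  simp only [dz, h.fderiv_eq]

lemma dzbar_congr (h : f =ᶠ[𝓝 z] g) : dzbar f z = dzbar g z := by
  simp only [dzbar, h.fderiv_eq]

lemma dz_eventuallyEq (h : f =ᶠ[𝓝 z] g) : dz f =ᶠ[𝓝 z] dz g :=
  h.eventuallyEq_nhds.mono fun _ hw => dz_congr hw

lemma dzbar_eventuallyEq (h : f =ᶠ[𝓝 z] g) : dzbar f =ᶠ[𝓝 z] dzbar g :=
  h.eventuallyEq_nhds.mono fun _ hw => dzbar_congr hw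

lemma fderiv_fderiv_apply (h : ContDiffAt ℝ 2 f z) (v : ℂ) :
    HasFDerivAt (fun y => fderiv ℝ f y v) ((fderiv ℝ (fderiv ℝ f) z).flip v) z := by
  have h1 : DifferentiableAt ℝ (fderiv ℝ f) z :=
    (h.fderiv_right (m := 1) (by norm_num)).differentiableAt (by simp)
  have := h1.hasFDerivAt.clm_apply (hasFDerivAt_const v z)
  simpa using this

lemma dz_dzbar_eq (h : ContDiffAt ℝ 2 f z) :
    dz (dzbar f) z = (fderiv ℝ (fderiv ℝ f) z 1 1 +
      fderiv ℝ (fderiv ℝ f) z Complex.I Complex.I) / 4 := by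
  have hs : IsSymmSndFDerivAt ℝ f z := h.isSymmSndFDerivAt (by simp)
  have h1 := ((fderiv_fderiv_apply h 1).add
    ((fderiv_fderiv_apply h Complex.I).const_mul Complex.I)).mul_const (2⁻¹ : ℂ)
  have h2 : HasFDerivAt (dzbar f) _ z := h1.congr_of_eventuallyEq
    (Eventually.of_forall fun y => by simp [dzbar, div_eq_mul_inv])
  rw [dz, h2.fderiv]
  have := hs 1 Complex.I
  simp [this]
  linear_combination (-fderiv ℝ (fderiv ℝ f) z Complex.I Complex.I / 4) * Complex.I_mul_I

lemma dzbar_dz_eq (h : ContDiffAt ℝ 2 f z) : dzbar (dz f) z = dz (dzbar f) z := by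
  rw [dz_dzbar_eq h]
  have hs : IsSymmSndFDerivAt ℝ f z := h.isSymmSndFDerivAt (by simp)
  have h1 := ((fderiv_fderiv_apply h 1).sub
    ((fderiv_fderiv_apply h Complex.I).const_mul Complex.I)).mul_const (2⁻¹ : ℂ)
  have h2 : HasFDerivAt (dz f) _ z := h1.congr_of_eventuallyEq
    (Eventually.of_forall fun y => by simp [dz, div_eq_mul_inv])
  rw [dzbar, h2.fderiv]
  have := hs 1 Complex.I
  simp [this]
  linear_combination (-fderiv ℝ (fderiv ℝ f) z Complex.I Complex.I / 4) * Complex.I_mul_I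

/-! ### Maximum principle -/

lemma fderiv_fderiv_re_nonpos (h : ContDiffAt ℝ 2 f z)
    (hm : IsLocalMax (fun w => (f w).re) z) (v : ℂ) :
    (fderiv ℝ (fderiv ℝ f) z v v).re ≤ 0 := by
  by_contra! hpos
  set g : ℝ → ℝ := fun t => (f (z + t * v)).re with hg
  have hline : ∀ t : ℝ, HasDerivAt (fun t : ℝ => z + t * v) v t := fun t => by
    simpa using ((Complex.ofRealCLM.hasDerivAt (x := t)).mul_const v).const_add z
  have hcont : Tendsto (fun t : ℝ => z + t * v) (𝓝 0) (𝓝 z) := by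
    have := (hline 0).continuousAt.tendsto; simpa using this
  have hd : ∀ᶠ t : ℝ in 𝓝 0, HasDerivAt g (fderiv ℝ f (z + t * v) v).re t := by
    have h1 : ∀ᶠ w in 𝓝 z, DifferentiableAt ℝ f w := by
      filter_upwards [h.eventually (by simp)] with w hw using hw.differentiableAt (by simp)
    filter_upwards [hcont.eventually h1] with t ht
    have h2 := ht.hasFDerivAt.comp_hasDerivAt t (hline t)
    exact Complex.reCLM.hasFDerivAt.comp_hasDerivAt t h2
  have hderiv : deriv g =ᶠ[𝓝 0] fun t : ℝ => (fderiv ℝ f (z + t * v) v).re :=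
    hd.mono fun t ht => ht.deriv
  have hdd : HasDerivAt (deriv g) (fderiv ℝ (fderiv ℝ f) z v v).re 0 := by
    have h1 := fderiv_fderiv_apply h v
    have h1' : HasFDerivAt (fun y => fderiv ℝ f y v) ((fderiv ℝ (fderiv ℝ f) z).flip v)
      (z + ((0 : ℝ) : ℂ) * v) := by simpa using h1
    have h2 := h1'.comp_hasDerivAt (0 : ℝ) (hline 0)
    have h3 := Complex.reCLM.hasFDerivAt.comp_hasDerivAt (0 : ℝ) h2
    exact h3.congr_of_eventuallyEq hderiv
  have hmax : IsLocalMax g 0 := by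
    have := hcont.eventually hm
    filter_upwards [this] with t ht
    simpa [hg] using ht
  have hmin : IsLocalMin g 0 := by
    apply isLocalMin_of_deriv_deriv_pos
    · rw [hdd.deriv]; exact hpos
    · exact hmax.deriv_eq_zero
    · exact hd.self_of_nhds.continuousAt
  have hconst : g =ᶠ[𝓝 0] fun _ => g 0 := by
    filter_upwards [hmax, hmin] with t h1 h2 using le_antisymm h1 h2
  have h1 : deriv g =ᶠ[𝓝 0] fun _ => 0 := by
    simpa using hconst.deriv
  have := hdd.deriv
  rw [h1.deriv_eq] at this
  simp at this
  linarith

lemma dz_dzbar_re_nonpos (h : ContDiffAt ℝ 2 f z)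
    (hm : IsLocalMax (fun w => (f w).re) z) : (dz (dzbar f) z).re ≤ 0 := by
  rw [dz_dzbar_eq h]
  have h1 := fderiv_fderiv_re_nonpos h hm 1
  have h2 := fderiv_fderiv_re_nonpos h hm Complex.I
  have : ((fderiv ℝ (fderiv ℝ f) z 1 1 + fderiv ℝ (fderiv ℝ f) z Complex.I Complex.I) / 4).re =
    ((fderiv ℝ (fderiv ℝ f) z 1 1).re + (fderiv ℝ (fderiv ℝ f) z Complex.I Complex.I).re) / 4 := by
    rw [show (4 : ℂ) = ((4 : ℝ) : ℂ) by norm_num, Complex.div_ofReal_re, Complex.add_re]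
  rw [this]; linarith

end ContDiff

/-- Comparison of a continuous function `m`, a strict subsolution in the viscosity sense wherever
it exceeds `ψ`, with `ψ`. -/
theorem le_of_viscosity {K U : Set ℂ} (hK : IsCompact K) (hUK : U ⊆ K) (hU : IsOpen U)
    {m : ℂ → ℝ} {ψ : ℂ → ℂ} (hm : ContinuousOn m K) (hψ : ContinuousOn ψ K)
    (hψ2 : ∀ z ∈ U, ContDiffAt ℝ 2 ψ z)
    (hbd : ∀ z ∈ K, z ∉ U → m z ≤ (ψ z).re)
    (hsub : ∀ z ∈ U, (ψ z).re < m z → ∃ F : ℂ → ℂ, ContDiffAt ℝ 2 F z ∧ (F z).re = m z ∧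
      (∀ᶠ w in 𝓝 z, (F w).re ≤ m w) ∧ (dz (dzbar ψ) z).re < (dz (dzbar F) z).re) :
    ∀ z ∈ K, m z ≤ (ψ z).re := by
  intro z₀ hz₀
  by_contra! hlt
  obtain ⟨z, hzK, hz⟩ := hK.exists_isMaxOn ⟨z₀, hz₀⟩
    (f := fun w => m w - (ψ w).re) (hm.sub (Complex.continuous_re.comp_continuousOn hψ))
  have hgt : (ψ z).re < m z := by
    have : m z₀ - (ψ z₀).re ≤ m z - (ψ z).re := hz hz₀
    linarith
  have hzU : z ∈ U := by
    by_contra hzU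
    exact absurd (hbd z hzK hzU) (not_le.2 hgt)
  obtain ⟨F, hF, hFz, hFm, hlap⟩ := hsub z hzU hgt
  have hmax : IsLocalMax (fun w => (F w - ψ w).re) z := by
    filter_upwards [hFm, hU.mem_nhds hzU] with w hw hwU
    have : m w - (ψ w).re ≤ m z - (ψ z).re := hz (hUK hwU)
    simp only [Complex.sub_re]; linarith
  have h1 := dz_dzbar_re_nonpos (hF.sub (hψ2 z hzU)) hmax
  have h2 : dz (dzbar fun w => F w - ψ w) z = dz (dzbar F) z - dz (dzbar ψ) z := by
    have e : (dzbar fun w => F w - ψ w) =ᶠ[𝓝 z] fun w => dzbar F w - dzbar ψ w := by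
      filter_upwards [hF.eventually (by simp), (hψ2 z hzU).eventually (by simp)] with w h1 h2
      exact ((hasWirtAt_of_contDiffAt h1 (by simp)).sub
        (hasWirtAt_of_contDiffAt h2 (by simp))).dzbar_eq
    rw [dz_congr e]
    have hF1 : ContDiffAt ℝ 1 (dzbar F) z := contDiffAt_dzbar hF (by norm_num)
    have hψ1 : ContDiffAt ℝ 1 (dzbar ψ) z := contDiffAt_dzbar (hψ2 z hzU) (by norm_num)
    exact ((hasWirtAt_of_contDiffAt hF1 (by simp)).sub
        (hasWirtAt_of_contDiffAt hψ1 (by simp))).dz_eq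
  change (dz (dzbar fun w => F w - ψ w) z).re ≤ 0 at h1
  rw [h2, Complex.sub_re] at h1
  linarith

/-! ### Radial barriers -/

lemma hasWirtAt_normSq_sub (c z : ℂ) :
    HasWirtAt (fun w => ((Complex.normSq (w - c) : ℝ) : ℂ)) (conj (z - c)) (z - c) z := by
  have h := ((HasWirtAt.id z).sub (HasWirtAt.const c z))
  have := (h.mul h.star).congr_deriv (p' := conj (z - c)) (q' := z - c) (by simp) (by simp)
  refine this.congr_of_eventuallyEq (Eventually.of_forall fun w => ?_)
  exact (Complex.mul_conj _).symm

lemma dz_dzbar_radial {φ φ' : ℝ → ℝ} {φ'' : ℝ} {c z : ℂ}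
    (h1 : ∀ᶠ t in 𝓝 (Complex.normSq (z - c)), HasDerivAt φ (φ' t) t)
    (h2 : HasDerivAt φ' φ'' (Complex.normSq (z - c))) :
    dz (dzbar fun w => ((φ (Complex.normSq (w - c)) : ℝ) : ℂ)) z =
      ((φ' (Complex.normSq (z - c)) + Complex.normSq (z - c) * φ'' : ℝ) : ℂ) := by
  have hc : Tendsto (fun w => Complex.normSq (w - c)) (𝓝 z) (𝓝 (Complex.normSq (z - c))) :=
    (Complex.continuous_normSq.comp (continuous_id.sub continuous_const)).continuousAt
  have e : (dzbar fun w => ((φ (Complex.normSq (w - c)) : ℝ) : ℂ)) =ᶠ[𝓝 z]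
      fun w => ((φ' (Complex.normSq (w - c)) : ℝ) : ℂ) * (w - c) := by
    filter_upwards [hc.eventually h1] with w hw
    exact ((hasWirtAt_normSq_sub c w).ofReal_comp hw).dzbar_eq
  rw [dz_congr e]
  have := (((hasWirtAt_normSq_sub c z).ofReal_comp h2).mul
    ((HasWirtAt.id z).sub (HasWirtAt.const c z))).dz_eq
  rw [this, mul_assoc, mul_comm (conj (z - c)), Complex.mul_conj]
  push_cast; ring

/-- The function `exp(γ (√(L² + |z|²) - R))`. -/
def expBarrier (γ L R : ℝ) (z : ℂ) : ℝ := Real.exp (γ * (√(L ^ 2 + Complex.normSq (z - 0)) - R))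

section expBarrier
variable {γ L R : ℝ}

lemma expBarrier_pos (z : ℂ) : 0 < expBarrier γ L R z := Real.exp_pos _

lemma le_expBarrier (hγ : 0 < γ) (z : ℂ) :
    Real.exp (-γ * (R - ‖z‖)) ≤ expBarrier γ L R z := by
  apply Real.exp_le_exp.2
  have : ‖z‖ ≤ √(L ^ 2 + Complex.normSq (z - 0)) := by
    apply Real.le_sqrt_of_sq_le
    rw [sub_zero, ← Complex.sq_norm]; nlinarith [sq_nonneg L]
  nlinarith

lemma expBarrier_le (hγ : 0 < γ) (hL : 0 < L) (z : ℂ) :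
    expBarrier γ L R z ≤ Real.exp (γ * L) * Real.exp (-γ * (R - ‖z‖)) := by
  rw [← Real.exp_add]
  apply Real.exp_le_exp.2
  have : √(L ^ 2 + Complex.normSq (z - 0)) ≤ L + ‖z‖ := by
    apply Real.sqrt_le_iff.2 ⟨by positivity, ?_⟩
    rw [sub_zero, ← Complex.sq_norm]; nlinarith [norm_nonneg z]
  nlinarith

lemma contDiff_expBarrier (hL : 0 < L) : ContDiff ℝ ∞ fun z => ((expBarrier γ L R z : ℝ) : ℂ) := by
  unfold expBarrier
  refine Complex.ofRealCLM.contDiff.comp (Real.contDiff_exp.comp (contDiff_const.mul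
    (ContDiff.sub (ContDiff.sqrt ?_ fun z => ?_) contDiff_const)))
  · refine contDiff_const.add ?_
    simp only [Complex.normSq_apply, sub_zero]
    exact (Complex.reCLM.contDiff.mul Complex.reCLM.contDiff).add
      (Complex.imCLM.contDiff.mul Complex.imCLM.contDiff)
  · have := Complex.normSq_nonneg (z - 0); positivity

lemma dz_dzbar_expBarrier_le (hγ : 0 < γ) (hL : 0 < L) (z : ℂ) :
    (dz (dzbar fun w => ((expBarrier γ L R w : ℝ) : ℂ)) z).re ≤
      (γ ^ 2 / 4 + γ / (2 * L)) * expBarrier γ L R z := by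
  set φ : ℝ → ℝ := fun t => Real.exp (γ * (√(L ^ 2 + t) - R)) with hφ
  set φ' : ℝ → ℝ := fun t => φ t * (γ * (1 / (2 * √(L ^ 2 + t)))) with hφ'
  have hs : ∀ t, 0 < L ^ 2 + t → HasDerivAt (fun t => √(L ^ 2 + t)) (1 / (2 * √(L ^ 2 + t))) t :=
    fun t ht => ((hasDerivAt_id t).const_add (L ^ 2)).sqrt ht.ne'
  have h1 : ∀ t, 0 < L ^ 2 + t → HasDerivAt φ (φ' t) t := fun t ht => by
    have := (((hs t ht).sub_const R).const_mul γ).exp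
    exact this
  set w := Complex.normSq (z - 0) with hw
  have hw0 : 0 ≤ w := Complex.normSq_nonneg _
  set S := √(L ^ 2 + w) with hS
  have hpos : 0 < L ^ 2 + w := by positivity
  have hS2 : S ^ 2 = L ^ 2 + w := Real.sq_sqrt hpos.le
  have hSpos : 0 < S := Real.sqrt_pos.2 hpos
  have hSL : L ≤ S := Real.le_sqrt_of_sq_le (by linarith)
  have h2 : HasDerivAt φ' (φ w * (γ ^ 2 / (4 * S ^ 2) - γ / (4 * S ^ 3))) w := by
    have h3 := (((hs w hpos).const_mul 2).inv (by positivity)).const_mul γ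
    have h4 := (h1 w hpos).mul h3
    have h5 : HasDerivAt φ' _ w := h4.congr_of_eventuallyEq
      (Eventually.of_forall fun t => by simp [hφ'])
    refine h5.congr_deriv ?_
    simp only [hφ', ← hS]
    simp
    field_simp
    ring
  have key := dz_dzbar_radial (c := 0) (z := z) (φ := φ) (φ' := φ')
    (by
      filter_upwards [lt_mem_nhds (show -L ^ 2 < w by linarith)] with t ht
      exact h1 t (by linarith)) h2
  have e : (dz (dzbar fun w => ((expBarrier γ L R w : ℝ) : ℂ)) z) = _ := key
  rw [e, Complex.ofReal_re]
  have hE : expBarrier γ L R z = φ w := rfl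
  rw [hE]
  have hφw : 0 < φ w := Real.exp_pos _
  simp only [hφ', ← hw, ← hS]
  have i1 : γ * (1 / (2 * S)) ≤ γ / (2 * L) := by
    rw [mul_one_div]; gcongr
  have i2 : w * (γ ^ 2 / (4 * S ^ 2) - γ / (4 * S ^ 3)) ≤ γ ^ 2 / 4 := by
    have : w * (γ ^ 2 / (4 * S ^ 2)) ≤ γ ^ 2 / 4 := by
      rw [mul_div_assoc', div_le_div_iff₀ (by positivity) (by positivity)]
      have : w ≤ S ^ 2 := by nlinarith [sq_nonneg L]
      nlinarith [mul_le_mul_of_nonneg_right this (sq_nonneg γ)]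
    have : 0 ≤ w * (γ / (4 * S ^ 3)) := by positivity
    nlinarith
  nlinarith [mul_le_mul_of_nonneg_left (add_le_add i1 i2) hφw.le]

end expBarrier

/-- `m` is bounded below near `z`, with equality at `z`, by the real part of a smooth function `F`
with `∂_z ∂_{z̄} F` of real part at least `k` at `z`. -/
def ViscositySub (m : ℂ → ℝ) (k : ℝ) (z : ℂ) : Prop :=
  ∃ F : ℂ → ℂ, ContDiffAt ℝ 2 F z ∧ (F z).re = m z ∧ (∀ᶠ w in 𝓝 z, (F w).re ≤ m w) ∧
    k ≤ (dz (dzbar F) z).re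

/-- Exponential decay away from the boundary for subsolutions of `∂_z ∂_{z̄} m = k m - N e^{…}`. -/
theorem exists_decay_const {γ k : ℝ} (hγ : 0 < γ) (hk : γ ^ 2 / 4 < k) {N M : ℝ} (R₀ : ℝ) (hN : 0 ≤ N)
    (hM : 0 ≤ M) :
    ∃ C : ℝ, 0 < C ∧ ∀ R : ℝ, R₀ < R → ∀ m : ℂ → ℝ,
      ContinuousOn m (Metric.closedBall 0 (R - R₀)) →
      (∀ z ∈ Metric.closedBall (0 : ℂ) (R - R₀), m z ≤ M) →
      (∀ z ∈ Metric.ball (0 : ℂ) (R - R₀), 0 < m z →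
        ViscositySub m (k * m z - N * Real.exp (-γ * (R - ‖z‖))) z) →
      ∀ z ∈ Metric.closedBall (0 : ℂ) (R - R₀), m z ≤ C * Real.exp (-γ * (R - ‖z‖)) := by
  set ε := (k - γ ^ 2 / 4) / 2 with hε
  have hε0 : 0 < ε := by rw [hε]; linarith
  set L := γ / (2 * ε) with hL
  have hL0 : 0 < L := by positivity
  have hγL : γ / (2 * L) = ε := by rw [hL]; field_simp
  set A := M * Real.exp (γ * R₀) + N / ε + 1 with hA
  have hA0 : 0 < A := by positivity
  refine ⟨A * Real.exp (γ * L), by positivity, fun R hR m hmc hmM hsub z hz => ?_⟩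
  have hψc : ContDiff ℝ ∞ fun z => (A : ℂ) * ((expBarrier γ L R z : ℝ) : ℂ) :=
    contDiff_const.mul (contDiff_expBarrier hL0)
  have key := le_of_viscosity (isCompact_closedBall (0 : ℂ) (R - R₀)) Metric.ball_subset_closedBall
    Metric.isOpen_ball hmc (ψ := fun z => (A : ℂ) * ((expBarrier γ L R z : ℝ) : ℂ))
    hψc.continuous.continuousOn (fun z _ => hψc.contDiffAt.of_le (by norm_cast))
    (fun z hz hz' => ?_) (fun z hz hlt => ?_) z hz
  · simp only [← Complex.ofReal_mul, Complex.ofReal_re] at key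
    refine key.trans ?_
    rw [mul_assoc]
    exact mul_le_mul_of_nonneg_left (expBarrier_le hγ hL0 z) hA0.le
  · simp only [← Complex.ofReal_mul, Complex.ofReal_re]
    refine (hmM z hz).trans ?_
    have hz'' : ‖z‖ = R - R₀ := by
      simp at hz hz'; linarith
    have h1 := le_expBarrier (L := L) (R := R) hγ z
    rw [hz''] at h1
    have h2 : Real.exp (γ * R₀) * Real.exp (-γ * (R - (R - R₀))) = 1 := by
      rw [← Real.exp_add, ← Real.exp_zero]; congr 1; ring
    calc M = M * Real.exp (γ * R₀) * Real.exp (-γ * (R - (R - R₀))) := by rw [mul_assoc, h2, mul_one]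
      _ ≤ A * Real.exp (-γ * (R - (R - R₀))) := by
        gcongr
        have : 0 ≤ N / ε := by positivity
        rw [hA]; linarith
      _ ≤ _ := by gcongr
  · simp only [← Complex.ofReal_mul, Complex.ofReal_re] at hlt
    have hE := expBarrier_pos (γ := γ) (L := L) (R := R) z
    have hm0 : 0 < m z := lt_trans (by positivity) hlt
    obtain ⟨F, hF, hFz, hFm, hlap⟩ := hsub z hz hm0
    refine ⟨F, hF, hFz, hFm, lt_of_lt_of_le ?_ hlap⟩
    have hd : dz (dzbar fun w => (A : ℂ) * ((expBarrier γ L R w : ℝ) : ℂ)) z =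
        A * dz (dzbar fun w => ((expBarrier γ L R w : ℝ) : ℂ)) z := by
      have hc := contDiff_expBarrier (γ := γ) (R := R) hL0
      have e : (dzbar fun w => (A : ℂ) * ((expBarrier γ L R w : ℝ) : ℂ)) =
          fun w => (A : ℂ) * dzbar (fun w => ((expBarrier γ L R w : ℝ) : ℂ)) w := by
        ext w
        exact ((hasWirtAt_of_contDiffAt hc.contDiffAt (by simp)).const_mul _).dzbar_eq
      rw [e]
      exact ((hasWirtAt_of_contDiffAt (contDiffAt_dzbar_infty hc.contDiffAt)
        (by simp)).const_mul _).dz_eq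
    rw [hd, Complex.re_ofReal_mul]
    have h1 := dz_dzbar_expBarrier_le (R := R) hγ hL0 z
    rw [hγL] at h1
    have h2 := le_expBarrier (L := L) (R := R) hγ z
    have h3 := mul_le_mul_of_nonneg_left h1 hA0.le
    have h4 : N * Real.exp (-γ * (R - ‖z‖)) ≤ N * expBarrier γ L R z := by gcongr
    have h5 : N ≤ ε * A := by
      have : N / ε ≤ A := by
        have : 0 ≤ M * Real.exp (γ * R₀) := by positivity
        rw [hA]; linarith
      rwa [div_le_iff₀ hε0, mul_comm] at this
    have h6 : N * expBarrier γ L R z ≤ ε * A * expBarrier γ L R z := by gcongr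
    have hk' : k = γ ^ 2 / 4 + 2 * ε := by rw [hε]; ring
    have h7 : k * (A * expBarrier γ L R z) < k * m z := by
      have : 0 < k := by rw [hk']; positivity
      gcongr
    rw [hk'] at h7 ⊢
    nlinarith

/-- The Keller–Osserman bound for subsolutions of `∂_z ∂_{z̄} m = 8 m²`. -/
theorem keller_osserman {z₀ : ℂ} {r : ℝ} (hr : 0 < r) {m : ℂ → ℝ}
    (hm : ContinuousOn m (Metric.closedBall z₀ r))
    (hsub : ∀ z ∈ Metric.ball z₀ r, 0 < m z → ViscositySub m (8 * m z ^ 2) z) :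
    m z₀ ≤ 1 / r ^ 2 := by
  obtain ⟨M, hM⟩ := (isCompact_closedBall z₀ r).bddAbove_image hm
  have hM' : ∀ z ∈ Metric.closedBall z₀ r, m z ≤ |M| := fun z hz =>
    (hM ⟨z, hz, rfl⟩).trans (le_abs_self M)
  set δ := min (r ^ 2 / 2) (r / (|M| + 1)) with hδ
  have hδ0 : 0 < δ := by positivity
  have hδ1 : δ ≤ r ^ 2 / 2 := min_le_left _ _
  have hδ2 : δ ≤ r / (|M| + 1) := min_le_right _ _
  set r' := √(r ^ 2 - δ) with hr'
  have hr'2 : r' ^ 2 = r ^ 2 - δ := Real.sq_sqrt (by nlinarith)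
  have hr'0 : 0 ≤ r' := Real.sqrt_nonneg _
  have hr'r : r' < r := by nlinarith
  set φ : ℝ → ℝ := fun t => r ^ 2 * ((r ^ 2 - t) ^ 2)⁻¹ with hφ
  set φ' : ℝ → ℝ := fun t => 2 * r ^ 2 * ((r ^ 2 - t) ^ 3)⁻¹ with hφ'
  have h1 : ∀ t, t < r ^ 2 → HasDerivAt φ (φ' t) t := fun t ht => by
    have h0 : r ^ 2 - t ≠ 0 := by linarith
    have := ((((hasDerivAt_id t).const_sub (r ^ 2)).pow 2).inv (pow_ne_zero 2 h0)).const_mul (r ^ 2)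
    refine this.congr_deriv ?_
    simp [hφ']; field_simp
  have h2 : ∀ t, t < r ^ 2 → HasDerivAt φ' (6 * r ^ 2 * ((r ^ 2 - t) ^ 4)⁻¹) t := fun t ht => by
    have h0 : r ^ 2 - t ≠ 0 := by linarith
    have := ((((hasDerivAt_id t).const_sub (r ^ 2)).pow 3).inv
      (pow_ne_zero 3 h0)).const_mul (2 * r ^ 2)
    refine this.congr_deriv ?_
    simp; field_simp; ring
  have hin : ∀ z ∈ Metric.closedBall z₀ r', Complex.normSq (z - z₀) ≤ r' ^ 2 := fun z hz => by
    rw [← Complex.sq_norm]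
    exact pow_le_pow_left₀ (norm_nonneg _) (by simpa [dist_eq_norm] using hz) 2
  have hin' : ∀ z ∈ Metric.closedBall z₀ r', Complex.normSq (z - z₀) < r ^ 2 := fun z hz =>
    (hin z hz).trans_lt (by linarith)
  have hψ2 : ∀ z ∈ Metric.closedBall z₀ r',
      ContDiffAt ℝ 2 (fun w => ((φ (Complex.normSq (w - z₀)) : ℝ) : ℂ)) z := fun z hz => by
    refine Complex.ofRealCLM.contDiff.contDiffAt.comp z (contDiffAt_const.mul (ContDiffAt.inv
      ((contDiffAt_const.sub ?_).pow 2) ?_))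
    · simp only [Complex.normSq_apply]
      have h1 : ContDiff ℝ 2 fun w : ℂ => (w - z₀).re :=
        Complex.reCLM.contDiff.comp (contDiff_id.sub contDiff_const)
      have h2 : ContDiff ℝ 2 fun w : ℂ => (w - z₀).im :=
        Complex.imCLM.contDiff.comp (contDiff_id.sub contDiff_const)
      exact ((h1.mul h1).add (h2.mul h2)).contDiffAt
    · have := hin' z hz
      exact pow_ne_zero 2 (by linarith)
  have hsubset : Metric.closedBall z₀ r' ⊆ Metric.closedBall z₀ r :=
    Metric.closedBall_subset_closedBall hr'r.le
  have key := le_of_viscosity (isCompact_closedBall z₀ r') Metric.ball_subset_closedBall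
    Metric.isOpen_ball (hm.mono hsubset) (ψ := fun w => ((φ (Complex.normSq (w - z₀)) : ℝ) : ℂ))
    (fun z hz => (hψ2 z hz).continuousAt.continuousWithinAt)
    (fun z hz => hψ2 z (Metric.ball_subset_closedBall hz))
    (fun z hz hz' => ?_) (fun z hz hlt => ?_) z₀ (by simpa using hr'0)
  · simp only [sub_self, map_zero, Complex.ofReal_re, hφ] at key
    refine key.trans (le_of_eq ?_)
    field_simp; ring
  · refine (hM' z (hsubset hz)).trans ?_
    have hz'' : Complex.normSq (z - z₀) = r' ^ 2 := by
      rw [← Complex.sq_norm]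
      simp [dist_eq_norm] at hz hz'
      rw [le_antisymm hz hz']
    simp only [Complex.ofReal_re, hφ, hz'', hr'2, sub_sub_cancel]
    rw [← div_eq_mul_inv, le_div_iff₀ (by positivity)]
    have h3 : δ ^ 2 ≤ (r / (|M| + 1)) ^ 2 := pow_le_pow_left₀ hδ0.le hδ2 2
    have h4 : (|M| + 1) ^ 2 * (r / (|M| + 1)) ^ 2 = r ^ 2 := by field_simp
    have h5 : |M| ≤ (|M| + 1) ^ 2 := by nlinarith [abs_nonneg M]
    calc |M| * δ ^ 2 ≤ (|M| + 1) ^ 2 * (r / (|M| + 1)) ^ 2 := by gcongr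
      _ = r ^ 2 := h4
  · have hz' := Metric.ball_subset_closedBall hz
    simp only [Complex.ofReal_re] at hlt
    set t := Complex.normSq (z - z₀) with ht
    have ht0 : 0 ≤ t := Complex.normSq_nonneg _
    have htr : t < r ^ 2 := hin' z hz'
    have hd : 0 < r ^ 2 - t := by linarith
    have hφ0 : 0 < φ t := by simp only [hφ]; positivity
    obtain ⟨F, hF, hFz, hFm, hlap⟩ := hsub z (Metric.ball_subset_ball hr'r.le hz) (hφ0.trans hlt)
    refine ⟨F, hF, hFz, hFm, lt_of_lt_of_le ?_ hlap⟩
    rw [dz_dzbar_radial (z := z) (c := z₀) (φ' := φ') (by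
      filter_upwards [gt_mem_nhds htr] with s hs using h1 s hs) (h2 t htr), Complex.ofReal_re]
    have e1 : φ' t + t * (6 * r ^ 2 * ((r ^ 2 - t) ^ 4)⁻¹) =
        r ^ 2 * (2 * (r ^ 2 - t) + 6 * t) * ((r ^ 2 - t) ^ 4)⁻¹ := by
      simp only [hφ']; field_simp
    have e2 : 8 * φ t ^ 2 = r ^ 2 * (8 * r ^ 2) * ((r ^ 2 - t) ^ 4)⁻¹ := by
      simp only [hφ]; field_simp
    calc _ = r ^ 2 * (2 * (r ^ 2 - t) + 6 * t) * ((r ^ 2 - t) ^ 4)⁻¹ := e1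
      _ ≤ 8 * φ t ^ 2 := by
        rw [e2]; gcongr; nlinarith
      _ < 8 * m z ^ 2 := by gcongr

/-! ### Interior gradient estimate -/

lemma dz_dzbar_comp_rotation {F : ℂ → ℂ} {c τ z : ℂ} (h : ContDiffAt ℝ 2 F (c + τ * z)) :
    dz (dzbar fun w => F (c + τ * w)) z = Complex.normSq τ * dz (dzbar F) (c + τ * z) := by
  have hA : ∀ w, HasWirtAt (fun w => c + τ * w) τ 0 w := fun w =>
    ((HasWirtAt.const c w).add ((HasWirtAt.id w).const_mul τ)).congr_deriv (by simp) (by simp)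
  have hc : Tendsto (fun w => c + τ * w) (𝓝 z) (𝓝 (c + τ * z)) :=
    (continuous_const.add (continuous_const.mul continuous_id)).continuousAt
  have e : (dzbar fun w => F (c + τ * w)) =ᶠ[𝓝 z] fun w => dzbar F (c + τ * w) * conj τ := by
    filter_upwards [hc.eventually (h.eventually (by simp))] with w hw
    rw [((hA w).comp (hasWirtAt_of_contDiffAt hw (by simp))).dzbar_eq]; simp
  have h1 : ContDiffAt ℝ 1 (dzbar F) (c + τ * z) := contDiffAt_dzbar h (by norm_num)
  rw [dz_congr e, (((hA z).comp (hasWirtAt_of_contDiffAt h1 (by simp))).mul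
    (HasWirtAt.const (conj τ) z)).dz_eq, ← Complex.mul_conj]
  simp; ring

lemma dz_dzbar_comp_reflection {F : ℂ → ℂ} {c τ z : ℂ} (h : ContDiffAt ℝ 2 F (c + τ * conj z)) :
    dz (dzbar fun w => F (c + τ * conj w)) z = Complex.normSq τ * dz (dzbar F) (c + τ * conj z) := by
  have hA : ∀ w, HasWirtAt (fun w => c + τ * conj w) 0 τ w := fun w =>
    ((HasWirtAt.const c w).add ((HasWirtAt.id w).star.const_mul τ)).congr_deriv (by simp) (by simp)
  have hc : Tendsto (fun w => c + τ * conj w) (𝓝 z) (𝓝 (c + τ * conj z)) :=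
    (continuous_const.add (continuous_const.mul Complex.continuous_conj)).continuousAt
  have e : (dzbar fun w => F (c + τ * conj w)) =ᶠ[𝓝 z] fun w => dz F (c + τ * conj w) * τ := by
    filter_upwards [hc.eventually (h.eventually (by simp))] with w hw
    rw [((hA w).comp (hasWirtAt_of_contDiffAt hw (by simp))).dzbar_eq]; simp
  have h1 : ContDiffAt ℝ 1 (dz F) (c + τ * conj z) := contDiffAt_dz h (by norm_num)
  rw [dz_congr e, (((hA z).comp (hasWirtAt_of_contDiffAt h1 (by simp))).mul
    (HasWirtAt.const τ z)).dz_eq, ← Complex.mul_conj, ← dzbar_dz_eq h]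
  simp; ring

lemma exists_unit_mul_eq_norm (w : ℂ) : ∃ c : ℂ, ‖c‖ = 1 ∧ c * w = ‖w‖ := by
  rcases eq_or_ne w 0 with rfl | hw
  · exact ⟨1, by simp⟩
  · refine ⟨conj w / ‖w‖, by simp [hw], ?_⟩
    have : (‖w‖ : ℂ) ≠ 0 := by simpa using hw
    field_simp
    rw [mul_comm, Complex.mul_conj, Complex.normSq_eq_norm_sq]; push_cast; rfl

/-- The barrier of the gradient estimate on a half disc. -/
def halfBarrier (A B C : ℝ) (z : ℂ) : ℂ :=
  A * (z * conj z) + B / 2 * (z + conj z) - C / 4 * ((z + conj z) * (z + conj z))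

section halfBarrier
variable (A B C : ℝ)

lemma contDiff_halfBarrier : ContDiff ℝ ∞ (halfBarrier A B C) := by
  have h : ContDiff ℝ ∞ fun z : ℂ => conj z := Complex.conjCLE.contDiff
  have h1 : ContDiff ℝ ∞ fun z : ℂ => z := contDiff_id
  exact ((contDiff_const.mul (h1.mul h)).add (contDiff_const.mul (h1.add h))).sub
    (contDiff_const.mul ((h1.add h).mul (h1.add h)))

lemma halfBarrier_re (z : ℂ) :
    (halfBarrier A B C z).re = A * ‖z‖ ^ 2 + B * z.re - C * z.re ^ 2 := by
  have h : z + conj z = ((2 * z.re : ℝ) : ℂ) := Complex.add_conj z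
  rw [halfBarrier, h, Complex.mul_conj, Complex.normSq_eq_norm_sq]
  rw [show (A : ℂ) * ((‖z‖ ^ 2 : ℝ) : ℂ) + B / 2 * ((2 * z.re : ℝ) : ℂ) -
    C / 4 * (((2 * z.re : ℝ) : ℂ) * ((2 * z.re : ℝ) : ℂ)) =
    ((A * ‖z‖ ^ 2 + B * z.re - C * z.re ^ 2 : ℝ) : ℂ) by push_cast; ring, Complex.ofReal_re]

lemma dz_dzbar_halfBarrier (z : ℂ) : dz (dzbar (halfBarrier A B C)) z = ((A - C / 2 : ℝ) : ℂ) := by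
  have e : dzbar (halfBarrier A B C) = fun w : ℂ => ((A : ℂ) - C / 2) * w + ((B : ℂ) / 2 - C / 2 * conj w) := by
    ext w
    have h1 := HasWirtAt.id w
    have h2 := h1.star
    have := (((h1.mul h2).const_mul (A : ℂ)).add ((h1.add h2).const_mul (B / 2 : ℂ))).sub
      (((h1.add h2).mul (h1.add h2)).const_mul (C / 4 : ℂ))
    exact this.dzbar_eq.trans (by simp; ring)
  rw [e]
  have h1 := HasWirtAt.id z
  have := (h1.const_mul (A - C / 2 : ℂ)).add
    ((HasWirtAt.const (B / 2 : ℂ) z).sub (h1.star.const_mul (C / 2 : ℂ)))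
  exact this.dz_eq.trans (by simp)

end halfBarrier

/-- Interior gradient estimate for the Laplacian. -/
theorem norm_fderiv_le_of_laplacian_le {z₀ : ℂ} {r m g : ℝ} (hr : 0 < r) (hm : 0 < m) (hg : 0 ≤ g)
    {F : ℂ → ℂ} (hF : ∀ z ∈ Metric.ball z₀ r, ContDiffAt ℝ 2 F z)
    (hFm : ∀ z ∈ Metric.ball z₀ r, ‖F z‖ ≤ m)
    (hFg : ∀ z ∈ Metric.ball z₀ r, ‖dz (dzbar F) z‖ ≤ g) {τ : ℂ} (hτ : ‖τ‖ = 1) :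
    ‖fderiv ℝ F z₀ τ‖ ≤ 6 * m / r + g * r := by
  obtain ⟨c, hc, hcF⟩ := exists_unit_mul_eq_norm (fderiv ℝ F z₀ τ)
  set ρ := r / 2 with hρ
  have hρ0 : 0 < ρ := by positivity
  set P : ℂ → ℂ := fun ζ => c / 2 * (F (z₀ + τ * ζ) - F (z₀ + -τ * conj ζ)) with hP
  set A := m / ρ ^ 2 with hA
  have hA0 : 0 < A := by positivity
  set C := 3 * A + 2 * g with hC
  have hC0 : 0 < C := by positivity
  set K : Set ℂ := Metric.closedBall 0 ρ ∩ {ζ | 0 ≤ ζ.re} with hK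
  set U : Set ℂ := Metric.ball 0 ρ ∩ {ζ | 0 < ζ.re} with hU
  have hin1 : ∀ ζ ∈ Metric.closedBall (0 : ℂ) ρ, z₀ + τ * ζ ∈ Metric.ball z₀ r := fun ζ hζ => by
    have : ‖ζ‖ ≤ ρ := by simpa using hζ
    simp [hτ]; linarith
  have hin2 : ∀ ζ ∈ Metric.closedBall (0 : ℂ) ρ, z₀ + -τ * conj ζ ∈ Metric.ball z₀ r :=
    fun ζ hζ => by
      have : ‖ζ‖ ≤ ρ := by simpa using hζ
      simp [hτ]; linarith
  have hconj : ContDiff ℝ 2 fun z : ℂ => conj z := Complex.conjCLE.contDiff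
  have hc1 : ∀ ζ ∈ Metric.closedBall (0 : ℂ) ρ, ContDiffAt ℝ 2 (fun ζ => F (z₀ + τ * ζ)) ζ :=
    fun ζ hζ => (hF _ (hin1 ζ hζ)).comp ζ
      (contDiffAt_const.add (contDiffAt_const.mul contDiffAt_id))
  have hc2 : ∀ ζ ∈ Metric.closedBall (0 : ℂ) ρ, ContDiffAt ℝ 2 (fun ζ => F (z₀ + -τ * conj ζ)) ζ :=
    fun ζ hζ => (hF _ (hin2 ζ hζ)).comp ζ
      (contDiffAt_const.add (contDiffAt_const.mul hconj.contDiffAt))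
  have hPc : ∀ ζ ∈ Metric.closedBall (0 : ℂ) ρ, ContDiffAt ℝ 2 P ζ := fun ζ hζ =>
    contDiffAt_const.mul ((hc1 ζ hζ).sub (hc2 ζ hζ))
  have hPm : ∀ ζ ∈ Metric.closedBall (0 : ℂ) ρ, (P ζ).re ≤ m := fun ζ hζ => by
    refine (Complex.re_le_norm _).trans ?_
    simp only [hP, norm_mul, norm_div, hc, Complex.norm_ofNat]
    have := norm_sub_le (F (z₀ + τ * ζ)) (F (z₀ + -τ * conj ζ))
    have h1 := hFm _ (hin1 ζ hζ)
    have h2 := hFm _ (hin2 ζ hζ)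
    linarith
  have hlapP : ∀ ζ ∈ Metric.closedBall (0 : ℂ) ρ, -g ≤ (dz (dzbar P) ζ).re := fun ζ hζ => by
    have hτ2 : Complex.normSq τ = 1 := by rw [Complex.normSq_eq_norm_sq, hτ]; norm_num
    have e : dz (dzbar P) ζ =
        c / 2 * (dz (dzbar F) (z₀ + τ * ζ) - dz (dzbar F) (z₀ + -τ * conj ζ)) := by
      have e1 : dzbar P =ᶠ[𝓝 ζ] fun w => c / 2 * (dzbar (fun ζ => F (z₀ + τ * ζ)) w -
          dzbar (fun ζ => F (z₀ + -τ * conj ζ)) w) := by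
        filter_upwards [(hc1 ζ hζ).eventually (by simp), (hc2 ζ hζ).eventually (by simp)]
          with w h1 h2
        exact (((hasWirtAt_of_contDiffAt h1 (by simp)).sub
          (hasWirtAt_of_contDiffAt h2 (by simp))).const_mul (c / 2)).dzbar_eq
      have h1 : ContDiffAt ℝ 1 (dzbar fun ζ => F (z₀ + τ * ζ)) ζ :=
        contDiffAt_dzbar (hc1 ζ hζ) (by norm_num)
      have h2 : ContDiffAt ℝ 1 (dzbar fun ζ => F (z₀ + -τ * conj ζ)) ζ :=
        contDiffAt_dzbar (hc2 ζ hζ) (by norm_num)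
      rw [dz_congr e1, (((hasWirtAt_of_contDiffAt h1 (by simp)).sub
          (hasWirtAt_of_contDiffAt h2 (by simp))).const_mul (c / 2)).dz_eq,
        dz_dzbar_comp_rotation (hF _ (hin1 ζ hζ)), dz_dzbar_comp_reflection (hF _ (hin2 ζ hζ)),
        Complex.normSq_neg, hτ2]
      simp
    have h3 : ‖dz (dzbar P) ζ‖ ≤ g := by
      rw [e]
      simp only [norm_mul, norm_div, hc, Complex.norm_ofNat]
      have := norm_sub_le (dz (dzbar F) (z₀ + τ * ζ)) (dz (dzbar F) (z₀ + -τ * conj ζ))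
      have h1 := hFg _ (hin1 ζ hζ)
      have h2 := hFg _ (hin2 ζ hζ)
      linarith
    linarith [neg_abs_le (dz (dzbar P) ζ).re, Complex.abs_re_le_norm (dz (dzbar P) ζ)]
  have hUK : U ⊆ K := fun ζ hζ => ⟨Metric.ball_subset_closedBall hζ.1, (show 0 < ζ.re from hζ.2).le⟩
  have key := le_of_viscosity (K := K) (U := U) (m := fun ζ => (P ζ).re)
    (ψ := halfBarrier A (C * ρ) C)
    ((isCompact_closedBall 0 ρ).inter_right (isClosed_le continuous_const Complex.continuous_re))
    hUK (Metric.isOpen_ball.inter (isOpen_lt continuous_const Complex.continuous_re))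
    (fun ζ hζ => (Complex.continuous_re.continuousAt.comp
      (hPc ζ hζ.1).continuousAt).continuousWithinAt)
    (contDiff_halfBarrier _ _ _).continuous.continuousOn
    (fun ζ _ => (contDiff_halfBarrier _ _ _).contDiffAt.of_le (by norm_cast))
    (fun ζ hζ hζU => ?_)
    (fun ζ hζ _ => ⟨P, hPc ζ (hUK hζ).1, rfl, Eventually.of_forall fun _ => le_rfl,
      lt_of_lt_of_le ?_ (hlapP ζ (hUK hζ).1)⟩)
  · have hderiv : HasDerivAt (fun t : ℝ => (P t).re) ‖fderiv ℝ F z₀ τ‖ 0 := by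
      have hz₀ : HasFDerivAt F (fderiv ℝ F z₀) z₀ :=
        ((hF z₀ (Metric.mem_ball_self hr)).differentiableAt (by simp)).hasFDerivAt
      have h0 := Complex.ofRealCLM.hasDerivAt (x := (0 : ℝ))
      have l1 : HasDerivAt (fun t : ℝ => z₀ + τ * (t : ℂ)) τ 0 := by
        simpa using (h0.const_mul τ).const_add z₀
      have l2 : HasDerivAt (fun t : ℝ => z₀ + -τ * (t : ℂ)) (-τ) 0 := by
        simpa using (h0.const_mul (-τ)).const_add z₀
      have d1 := HasFDerivAt.comp_hasDerivAt (l := F) (l' := fderiv ℝ F z₀) (0 : ℝ)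
        (by simpa using hz₀) l1
      have d2 := HasFDerivAt.comp_hasDerivAt (l := F) (l' := fderiv ℝ F z₀) (0 : ℝ)
        (by simpa using hz₀) l2
      have d3 := (d1.sub d2).const_mul (c / 2)
      have d4 := Complex.reCLM.hasFDerivAt.comp_hasDerivAt (0 : ℝ) d3
      have e : c / 2 * (fderiv ℝ F z₀ τ - fderiv ℝ F z₀ (-τ)) = ((‖fderiv ℝ F z₀ τ‖ : ℝ) : ℂ) := by
        rw [← hcF, map_neg]; ring
      rw [e] at d4
      refine (d4.congr_deriv (by simp)).congr_of_eventuallyEq (Eventually.of_forall fun t => ?_)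
      simp [hP]
    have hB : 6 * m / r + g * r = C * ρ := by
      rw [hC, hA, hρ]; field_simp; ring
    rw [hB]
    refine le_of_tendsto hderiv.tendsto_slope_zero_right ?_
    filter_upwards [Ioo_mem_nhdsGT hρ0] with t ht
    have h1 := key t ⟨by simpa [abs_of_pos ht.1] using ht.2.le, by simpa using ht.1.le⟩
    have hP0 : P 0 = 0 := by simp [hP]
    rw [halfBarrier_re] at h1
    simp only [Complex.norm_real, Real.norm_eq_abs, sq_abs, Complex.ofReal_re] at h1
    simp only [zero_add, Complex.ofReal_zero, hP0, Complex.zero_re, sub_zero, smul_eq_mul]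
    rw [inv_mul_le_iff₀ ht.1]
    nlinarith [sq_nonneg t, mul_nonneg hA0.le (sq_nonneg t), mul_nonneg hg (sq_nonneg t)]
  · rw [halfBarrier_re]
    by_cases hre : ζ.re = 0
    · have : conj ζ = -ζ := by apply Complex.ext <;> simp [hre]
      have hP0 : P ζ = 0 := by simp [hP, this]
      rw [hP0, hre, Complex.zero_re]
      have : 0 ≤ A * ‖ζ‖ ^ 2 := by positivity
      linarith
    · have hpos : 0 < ζ.re := lt_of_le_of_ne hζ.2 (Ne.symm hre)
      have h1 : ‖ζ‖ ≤ ρ := by simpa using hζ.1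
      have h2 : ρ ≤ ‖ζ‖ := by
        by_contra! h
        exact hζU ⟨by simpa using h, hpos⟩
      have h3 : ‖ζ‖ = ρ := le_antisymm h1 h2
      have h4 : A * ‖ζ‖ ^ 2 = m := by rw [h3, hA]; field_simp
      have h5 : ζ.re ≤ ρ := (Complex.re_le_norm ζ).trans h1
      have h6 := hPm ζ hζ.1
      have : 0 ≤ C * ζ.re * (ρ - ζ.re) := by
        have : 0 ≤ ρ - ζ.re := by linarith
        positivity
      nlinarith
  · rw [dz_dzbar_halfBarrier, Complex.ofReal_re, hC]
    linarith

lemma norm_dz_le_of_fderiv {F : ℂ → ℂ} {z : ℂ} {B : ℝ}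
    (h : ∀ τ : ℂ, ‖τ‖ = 1 → ‖fderiv ℝ F z τ‖ ≤ B) : ‖dz F z‖ ≤ B ∧ ‖dzbar F z‖ ≤ B := by
  have h1 := h 1 (by simp)
  have h2 := h Complex.I (by simp)
  have h3 : ‖Complex.I * fderiv ℝ F z Complex.I‖ ≤ B := by simpa using h2
  constructor
  · rw [dz, norm_div, Complex.norm_ofNat]
    linarith [norm_sub_le (fderiv ℝ F z 1) (Complex.I * fderiv ℝ F z Complex.I)]
  · rw [dzbar, norm_div, Complex.norm_ofNat]
    linarith [norm_add_le (fderiv ℝ F z 1) (Complex.I * fderiv ℝ F z Complex.I)]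

/-! ### Bounds on all Wirtinger derivatives up to a given order -/

/-- All iterated Wirtinger derivatives of `f` of order at most `n` are bounded by `A` on `Ω`. -/
def DerivBound : ℕ → Set ℂ → (ℂ → ℂ) → ℝ → Prop
  | 0, Ω, f, A => ∀ z ∈ Ω, ‖f z‖ ≤ A
  | n + 1, Ω, f, A => (∀ z ∈ Ω, ‖f z‖ ≤ A) ∧ DerivBound n Ω (dz f) A ∧ DerivBound n Ω (dzbar f) A

/-- `f` is smooth at every point of `Ω`. -/
def SmoothAtOn (f : ℂ → ℂ) (Ω : Set ℂ) : Prop := ∀ z ∈ Ω, ContDiffAt ℝ ∞ f z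

namespace SmoothAtOn
variable {f g : ℂ → ℂ} {Ω Ω' : Set ℂ}

lemma dz (h : SmoothAtOn f Ω) : SmoothAtOn (dz f) Ω := fun z hz => contDiffAt_dz_infty (h z hz)

lemma dzbar (h : SmoothAtOn f Ω) : SmoothAtOn (dzbar f) Ω :=
  fun z hz => contDiffAt_dzbar_infty (h z hz)

lemma mul (hf : SmoothAtOn f Ω) (hg : SmoothAtOn g Ω) : SmoothAtOn (fun z => f z * g z) Ω :=
  fun z hz => (hf z hz).mul (hg z hz)

lemma mono (hf : SmoothAtOn f Ω) (h : Ω' ⊆ Ω) : SmoothAtOn f Ω' := fun z hz => hf z (h hz)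

lemma hasWirtAt (hf : SmoothAtOn f Ω) {z : ℂ} (hz : z ∈ Ω) :
    HasWirtAt f (HiggsDisc.dz f z) (HiggsDisc.dzbar f z) z :=
  hasWirtAt_of_contDiffAt (hf z hz) (by simp)

end SmoothAtOn

namespace DerivBound
variable {f g : ℂ → ℂ} {Ω Ω' : Set ℂ} {A B : ℝ} {n : ℕ}

lemma sup (h : DerivBound n Ω f A) : ∀ z ∈ Ω, ‖f z‖ ≤ A := by
  cases n with
  | zero => exact h
  | succ n => exact h.1

lemma mono_const (h : DerivBound n Ω f A) (hAB : A ≤ B) : DerivBound n Ω f B := by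
  induction n generalizing f with
  | zero => exact fun z hz => (h z hz).trans hAB
  | succ n ih => exact ⟨fun z hz => (h.1 z hz).trans hAB, ih h.2.1, ih h.2.2⟩

lemma mono_set (h : DerivBound n Ω f A) (hΩ : Ω' ⊆ Ω) : DerivBound n Ω' f A := by
  induction n generalizing f with
  | zero => exact fun z hz => h z (hΩ hz)
  | succ n ih => exact ⟨fun z hz => h.1 z (hΩ hz), ih h.2.1, ih h.2.2⟩

lemma of_succ (h : DerivBound (n + 1) Ω f A) : DerivBound n Ω f A := by
  induction n generalizing f with
  | zero => exact h.1
  | succ n ih => exact ⟨h.1, ih h.2.1, ih h.2.2⟩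

lemma congr (h : DerivBound n Ω f A) (hΩ : IsOpen Ω) (hfg : EqOn g f Ω) : DerivBound n Ω g A := by
  have hev : ∀ z ∈ Ω, g =ᶠ[𝓝 z] f := fun z hz => hfg.eventuallyEq_of_mem (hΩ.mem_nhds hz)
  induction n generalizing f g with
  | zero => exact fun z hz => by rw [hfg hz]; exact h z hz
  | succ n ih =>
    exact ⟨fun z hz => by rw [hfg hz]; exact h.1 z hz,
      ih h.2.1 (fun z hz => dz_congr (hev z hz)) (fun z hz => dz_eventuallyEq (hev z hz)),
      ih h.2.2 (fun z hz => dzbar_congr (hev z hz)) (fun z hz => dzbar_eventuallyEq (hev z hz))⟩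

lemma add (hΩ : IsOpen Ω) (hf : DerivBound n Ω f A) (hg : DerivBound n Ω g B)
    (hfs : SmoothAtOn f Ω) (hgs : SmoothAtOn g Ω) :
    DerivBound n Ω (fun z => f z + g z) (A + B) := by
  induction n generalizing f g with
  | zero => exact fun z hz => (norm_add_le _ _).trans (add_le_add (hf z hz) (hg z hz))
  | succ n ih =>
    refine ⟨fun z hz => (norm_add_le _ _).trans (add_le_add (hf.1 z hz) (hg.1 z hz)), ?_, ?_⟩
    · exact (ih hf.2.1 hg.2.1 hfs.dz hgs.dz).congr hΩ fun z hz =>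
        ((hfs.hasWirtAt hz).add (hgs.hasWirtAt hz)).dz_eq
    · exact (ih hf.2.2 hg.2.2 hfs.dzbar hgs.dzbar).congr hΩ fun z hz =>
        ((hfs.hasWirtAt hz).add (hgs.hasWirtAt hz)).dzbar_eq

lemma mul (hΩ : IsOpen Ω) (hA : 0 ≤ A) (hB : 0 ≤ B) (hf : DerivBound n Ω f A)
    (hg : DerivBound n Ω g B) (hfs : SmoothAtOn f Ω) (hgs : SmoothAtOn g Ω) :
    DerivBound n Ω (fun z => f z * g z) (2 ^ n * (A * B)) := by
  have h0 : ∀ z ∈ Ω, ‖f z * g z‖ ≤ A * B := fun z hz => by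
    rw [norm_mul]; exact mul_le_mul (hf.sup z hz) (hg.sup z hz) (norm_nonneg _) hA
  induction n generalizing f g with
  | zero => simpa [DerivBound] using h0
  | succ n ih =>
    have hm : ∀ {f g : ℂ → ℂ}, DerivBound n Ω f A → DerivBound n Ω g B → SmoothAtOn f Ω →
        SmoothAtOn g Ω → DerivBound n Ω (fun z => f z * g z) (2 ^ n * (A * B)) :=
      fun {f g} hf hg hfs hgs => ih hf hg hfs hgs fun z hz => by
        rw [norm_mul]; exact mul_le_mul (hf.sup z hz) (hg.sup z hz) (norm_nonneg _) hA
    have e : (2 : ℝ) ^ (n + 1) * (A * B) = 2 ^ n * (A * B) + 2 ^ n * (A * B) := by ring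
    refine ⟨fun z hz => (h0 z hz).trans ?_, ?_, ?_⟩
    · exact le_mul_of_one_le_left (by positivity) (one_le_pow₀ (by norm_num))
    · rw [e]
      exact (add hΩ (hm hf.2.1 hg.of_succ hfs.dz hgs) (hm hf.of_succ hg.2.1 hfs hgs.dz)
        (hfs.dz.mul hgs) (hfs.mul hgs.dz)).congr hΩ fun z hz =>
          ((hfs.hasWirtAt hz).mul (hgs.hasWirtAt hz)).dz_eq
    · rw [e]
      exact (add hΩ (hm hf.2.2 hg.of_succ hfs.dzbar hgs) (hm hf.of_succ hg.2.2 hfs hgs.dzbar)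
        (hfs.dzbar.mul hgs) (hfs.mul hgs.dzbar)).congr hΩ fun z hz =>
          ((hfs.hasWirtAt hz).mul (hgs.hasWirtAt hz)).dzbar_eq

lemma const_mul (hΩ : IsOpen Ω) (c : ℂ) (hf : DerivBound n Ω f A) (hfs : SmoothAtOn f Ω) :
    DerivBound n Ω (fun z => c * f z) (‖c‖ * A) := by
  have h0 : ∀ z ∈ Ω, ‖c * f z‖ ≤ ‖c‖ * A := fun z hz => by
    rw [norm_mul]; exact mul_le_mul_of_nonneg_left (hf.sup z hz) (norm_nonneg _)
  induction n generalizing f with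
  | zero => exact h0
  | succ n ih =>
    refine ⟨h0, ?_, ?_⟩
    · exact (ih hf.2.1 hfs.dz fun z hz => by
        rw [norm_mul]; exact mul_le_mul_of_nonneg_left (hf.2.1.sup z hz) (norm_nonneg _)).congr hΩ
          fun z hz => ((hfs.hasWirtAt hz).const_mul c).dz_eq
    · exact (ih hf.2.2 hfs.dzbar fun z hz => by
        rw [norm_mul]; exact mul_le_mul_of_nonneg_left (hf.2.2.sup z hz) (norm_nonneg _)).congr hΩ
          fun z hz => ((hfs.hasWirtAt hz).const_mul c).dzbar_eq

lemma iterate {j k : ℕ} (h : DerivBound (j + k) Ω f A) :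
    ∀ z ∈ Ω, ‖dz^[j] (dzbar^[k] f) z‖ ≤ A := by
  have h1 : DerivBound j Ω (dzbar^[k] f) A := by
    induction k generalizing f with
    | zero => exact h
    | succ k ih => exact ih (f := dzbar f) h.2.2
  clear h
  generalize dzbar^[k] f = g at h1
  induction j generalizing g with
  | zero => exact h1
  | succ j ih => exact ih (dz g) h1.2.1

/-- Interior elliptic regularity: a bound on `f` and `∂_z ∂_{z̄} f` to order `n` gives a bound on
`f` to order `n + 1` on a smaller disc. -/
lemma elliptic {z₀ : ℂ} {r : ℝ} (hr : 0 < r) (hA : 0 < A) (hfs : SmoothAtOn f (Metric.ball z₀ r))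
    (hf : DerivBound n (Metric.ball z₀ r) f A)
    (hlap : DerivBound n (Metric.ball z₀ r) (dz (dzbar f)) A) :
    DerivBound (n + 1) (Metric.ball z₀ (r / 2)) f ((1 + 12 / r + r) * A) := by
  have hsub : Metric.ball z₀ (r / 2) ⊆ Metric.ball z₀ r := Metric.ball_subset_ball (by linarith)
  have hA' : A ≤ (1 + 12 / r + r) * A := by
    have : 0 ≤ (12 / r + r) * A := by positivity
    nlinarith
  induction n generalizing f with
  | zero =>
    have hgrad : ∀ z ∈ Metric.ball z₀ (r / 2), ‖dz f z‖ ≤ (1 + 12 / r + r) * A ∧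
        ‖dzbar f z‖ ≤ (1 + 12 / r + r) * A := fun z hz => by
      have hz' : Metric.ball z (r / 2) ⊆ Metric.ball z₀ r :=
        Metric.ball_subset_ball' (by
          have : dist z z₀ < r / 2 := hz
          linarith)
      refine norm_dz_le_of_fderiv fun τ hτ => (norm_fderiv_le_of_laplacian_le (r := r / 2)
        (by positivity) hA hA.le (fun w hw => (hfs w (hz' hw)).of_le (by norm_cast))
        (fun w hw => hf w (hz' hw)) (fun w hw => hlap w (hz' hw)) hτ).trans ?_
      have : 6 * A / (r / 2) + A * (r / 2) = (12 / r + r / 2) * A := by field_simp; ring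
      rw [this]
      gcongr <;> linarith
    exact ⟨fun z hz => (hf z (hsub hz)).trans hA', fun z hz => (hgrad z hz).1,
      fun z hz => (hgrad z hz).2⟩
  | succ n ih =>
    have hcomm : ∀ z ∈ Metric.ball z₀ r, dzbar (dz f) z = dz (dzbar f) z := fun z hz =>
      dzbar_dz_eq ((hfs z hz).of_le (by norm_cast))
    refine ⟨fun z hz => (hf.1 z (hsub hz)).trans hA', ih hfs.dz hf.2.1 ?_, ih hfs.dzbar hf.2.2 ?_⟩
    · exact hlap.2.1.congr Metric.isOpen_ball fun z hz => dz_congr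
        ((show EqOn (dzbar (dz f)) (dz (dzbar f)) _ from hcomm).eventuallyEq_of_mem
          (Metric.isOpen_ball.mem_nhds hz))
    · exact hlap.2.2.congr Metric.isOpen_ball fun z hz =>
        (dzbar_dz_eq ((hfs.dzbar z hz).of_le (by norm_cast))).symm

end DerivBound

/-- The system satisfied by `a = cosh U`, `b = i sinh U` for a solution `U` of
`∂_z ∂_{z̄} U = 4 sinh U cosh U`. -/
structure SinhGordonOn (Ω : Set ℂ) (U a b : ℂ → ℂ) : Prop where
  smooth_U : SmoothAtOn U Ω
  smooth_a : SmoothAtOn a Ω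
  smooth_b : SmoothAtOn b Ω
  dz_a : ∀ z ∈ Ω, dz a z = -Complex.I * (b z * dz U z)
  dzbar_a : ∀ z ∈ Ω, dzbar a z = -Complex.I * (b z * dzbar U z)
  dz_b : ∀ z ∈ Ω, dz b z = Complex.I * (a z * dz U z)
  dzbar_b : ∀ z ∈ Ω, dzbar b z = Complex.I * (a z * dzbar U z)
  laplace_U : ∀ z ∈ Ω, dz (dzbar U) z = -4 * Complex.I * (b z * a z)

/-- Interior estimates for all derivatives of solutions of the sinh-Gordon equation. -/
theorem SinhGordonOn.exists_derivBound (n : ℕ) {r M : ℝ} (hr : 0 < r) (hM : 0 < M) :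
    ∃ C : ℝ, 1 ≤ C ∧ ∀ (z₀ : ℂ) (U a b : ℂ → ℂ) (ε : ℝ), 0 < ε → ε ≤ M →
      SinhGordonOn (Metric.ball z₀ r) U a b → (∀ z ∈ Metric.ball z₀ r, ‖U z‖ ≤ ε) →
      (∀ z ∈ Metric.ball z₀ r, ‖b z‖ ≤ ε) → (∀ z ∈ Metric.ball z₀ r, ‖a z‖ ≤ M) →
      DerivBound n (Metric.ball z₀ (r / 2 ^ n)) U (C * ε) ∧
      DerivBound n (Metric.ball z₀ (r / 2 ^ n)) b (C * ε) ∧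
      DerivBound n (Metric.ball z₀ (r / 2 ^ n)) a C := by
  induction n with
  | zero =>
    refine ⟨1 + M, by linarith, fun z₀ U a b ε hε _ _ hU hb ha => ?_⟩
    have : ε ≤ (1 + M) * ε := by nlinarith
    simp only [pow_zero, div_one, DerivBound]
    exact ⟨fun z hz => (hU z hz).trans this, fun z hz => (hb z hz).trans this,
      fun z hz => (ha z hz).trans (by linarith)⟩
  | succ n ih =>
    obtain ⟨C, hC1, hC⟩ := ih
    set s := r / 2 ^ n with hs
    have hs0 : 0 < s := by positivity
    set C₁ := C + 4 * (2 ^ n * (C * C)) with hC₁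
    set C₂ := (1 + 12 / s + s) * C₁ with hC₂
    have hC0 : 0 < C := by linarith
    have hC₁0 : 0 < C₁ := by positivity
    have hC₂0 : 0 < C₂ := by positivity
    refine ⟨C + C₂ + 2 ^ n * (C * C₂) + 2 ^ n * (C * M * (C₂ * M)), ?_,
      fun z₀ U a b ε hε hεM hS hU hb ha => ?_⟩
    · have : 0 ≤ C₂ + 2 ^ n * (C * C₂) + 2 ^ n * (C * M * (C₂ * M)) := by positivity
      linarith
    obtain ⟨bU, bb, ba⟩ := hC z₀ U a b ε hε hεM hS hU hb ha
    have hsr : s ≤ r := by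
      rw [hs]; exact div_le_self hr.le (one_le_pow₀ (by norm_num))
    have hs2 : r / 2 ^ (n + 1) = s / 2 := by rw [hs, pow_succ]; field_simp
    rw [hs2]
    have hsub : Metric.ball z₀ s ⊆ Metric.ball z₀ r := Metric.ball_subset_ball hsr
    have hsub2 : Metric.ball z₀ (s / 2) ⊆ Metric.ball z₀ s := Metric.ball_subset_ball (by linarith)
    have sU := hS.smooth_U.mono hsub
    have sa := hS.smooth_a.mono hsub
    have sb := hS.smooth_b.mono hsub
    have lap : DerivBound n (Metric.ball z₀ s) (dz (dzbar U)) (C₁ * ε) := by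
      have h1 := (DerivBound.mul Metric.isOpen_ball (by positivity) (by positivity) bb ba sb
        sa).const_mul Metric.isOpen_ball (-4 * Complex.I) (sb.mul sa)
      refine (h1.congr Metric.isOpen_ball fun z hz => hS.laplace_U z (hsub hz)).mono_const ?_
      simp only [norm_mul, norm_neg, Complex.norm_ofNat, Complex.norm_I, mul_one, hC₁]
      have : 0 ≤ C * ε := by positivity
      nlinarith
    have bU' : DerivBound n (Metric.ball z₀ s) U (C₁ * ε) := bU.mono_const (by
      have : 0 ≤ 4 * (2 ^ n * (C * C)) * ε := by positivity
      rw [hC₁]; nlinarith)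
    have eU := DerivBound.elliptic hs0 (by positivity) sU bU' lap
    rw [← mul_assoc, ← hC₂] at eU
    have bb2 := bb.mono_set hsub2
    have ba2 := ba.mono_set hsub2
    have sU2 := sU.mono hsub2
    have sa2 := sa.mono hsub2
    have sb2 := sb.mono hsub2
    have p1 : 0 ≤ C₂ := hC₂0.le
    have p2 : 0 ≤ 2 ^ n * (C * C₂) := by positivity
    have p3 : 0 ≤ 2 ^ n * (C * M * (C₂ * M)) := by positivity
    have stepb : ∀ {D : ℂ → ℂ}, DerivBound n (Metric.ball z₀ (s / 2)) D (C₂ * ε) →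
        SmoothAtOn D (Metric.ball z₀ (s / 2)) →
        DerivBound n (Metric.ball z₀ (s / 2)) (fun z => Complex.I * (a z * D z))
          ((C + C₂ + 2 ^ n * (C * C₂) + 2 ^ n * (C * M * (C₂ * M))) * ε) := fun hD sD => by
      refine ((DerivBound.mul Metric.isOpen_ball hC0.le (by positivity) ba2 hD sa2
        sD).const_mul Metric.isOpen_ball _ (sa2.mul sD)).mono_const ?_
      rw [Complex.norm_I, one_mul]
      have : 0 ≤ (C + C₂ + 2 ^ n * (C * M * (C₂ * M))) * ε := by positivity
      nlinarith
    have stepa : ∀ {D : ℂ → ℂ}, DerivBound n (Metric.ball z₀ (s / 2)) D (C₂ * ε) →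
        SmoothAtOn D (Metric.ball z₀ (s / 2)) →
        DerivBound n (Metric.ball z₀ (s / 2)) (fun z => -Complex.I * (b z * D z))
          (C + C₂ + 2 ^ n * (C * C₂) + 2 ^ n * (C * M * (C₂ * M))) := fun hD sD => by
      refine ((DerivBound.mul Metric.isOpen_ball (by positivity) (by positivity) bb2 hD sb2
        sD).const_mul Metric.isOpen_ball _ (sb2.mul sD)).mono_const ?_
      rw [norm_neg, Complex.norm_I, one_mul]
      have : 2 ^ n * (C * ε * (C₂ * ε)) ≤ 2 ^ n * (C * M * (C₂ * M)) := by gcongr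
      linarith
    refine ⟨eU.mono_const ?_, ⟨fun z hz => (bb2.sup z hz).trans ?_, ?_, ?_⟩,
      ⟨fun z hz => (ba2.sup z hz).trans ?_, ?_, ?_⟩⟩
    · gcongr; linarith
    · gcongr; linarith
    · exact (stepb eU.2.1 sU2.dz).congr Metric.isOpen_ball fun z hz =>
        hS.dz_b z (hsub (hsub2 hz))
    · exact (stepb eU.2.2 sU2.dzbar).congr Metric.isOpen_ball fun z hz =>
        hS.dzbar_b z (hsub (hsub2 hz))
    · linarith
    · exact (stepa eU.2.1 sU2.dz).congr Metric.isOpen_ball fun z hz =>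
        hS.dz_a z (hsub (hsub2 hz))
    · exact (stepa eU.2.2 sU2.dzbar).congr Metric.isOpen_ball fun z hz =>
        hS.dzbar_a z (hsub (hsub2 hz))

/-- Quadratic decay of `a - 1` and linear decay of `b`, with all derivatives. -/
theorem SinhGordonOn.exists_iterate_bound (j k : ℕ) {r M : ℝ} (hr : 0 < r) (hM : 0 < M) :
    ∃ C : ℝ, 0 < C ∧ ∀ (z₀ : ℂ) (U a b : ℂ → ℂ) (ε : ℝ), 0 < ε → ε ≤ M →
      SinhGordonOn (Metric.ball z₀ r) U a b → (∀ z ∈ Metric.ball z₀ r, ‖U z‖ ≤ ε) →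
      (∀ z ∈ Metric.ball z₀ r, ‖b z‖ ≤ ε) → (∀ z ∈ Metric.ball z₀ r, ‖a z‖ ≤ M) →
      (∀ z ∈ Metric.ball z₀ r, ‖a z - 1‖ ≤ ε ^ 2) →
      ‖dz^[j] (dzbar^[k] fun w => a w - 1) z₀‖ ≤ C * ε ^ 2 ∧
      ‖dz^[j] (dzbar^[k] b) z₀‖ ≤ C * ε := by
  obtain ⟨C, hC1, hC⟩ := SinhGordonOn.exists_derivBound (j + k) hr hM
  refine ⟨C + 2 ^ (j + k) * (C * C), by positivity, fun z₀ U a b ε hε hεM hS hU hb ha ha1 => ?_⟩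
  obtain ⟨bU, bb, -⟩ := hC z₀ U a b ε hε hεM hS hU hb ha
  set n := j + k with hn
  set Ω := Metric.ball z₀ (r / 2 ^ n) with hΩ
  have hsub : Ω ⊆ Metric.ball z₀ r :=
    Metric.ball_subset_ball (div_le_self hr.le (one_le_pow₀ (by norm_num)))
  have hz₀ : z₀ ∈ Ω := Metric.mem_ball_self (by positivity)
  have hΩo : IsOpen Ω := Metric.isOpen_ball
  have sU := hS.smooth_U.mono hsub
  have sa := hS.smooth_a.mono hsub
  have sb := hS.smooth_b.mono hsub
  have hsup : ∀ z ∈ Ω, ‖a z - 1‖ ≤ (C + 2 ^ n * (C * C)) * ε ^ 2 := fun z hz =>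
    (ha1 z (hsub hz)).trans (by
      have : 0 ≤ 2 ^ n * (C * C) * ε ^ 2 := by positivity
      nlinarith [sq_nonneg ε])
  have ba : DerivBound n Ω (fun w => a w - 1) ((C + 2 ^ n * (C * C)) * ε ^ 2) := by
    clear_value n
    cases n with
    | zero => exact hsup
    | succ n =>
      have step : ∀ {D : ℂ → ℂ}, DerivBound n Ω D (C * ε) → SmoothAtOn D Ω →
          DerivBound n Ω (fun z => -Complex.I * (b z * D z))
            ((C + 2 ^ (n + 1) * (C * C)) * ε ^ 2) := fun hD sD => by
        refine ((DerivBound.mul hΩo (by positivity) (by positivity) bb.of_succ hD sb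
          sD).const_mul hΩo _ (sb.mul sD)).mono_const ?_
        rw [norm_neg, Complex.norm_I, one_mul, pow_succ]
        have : 0 ≤ (C + 2 ^ n * (C * C)) * ε ^ 2 := by positivity
        nlinarith
      refine ⟨hsup, (step bU.2.1 sU.dz).congr hΩo fun z hz => ?_,
        (step bU.2.2 sU.dzbar).congr hΩo fun z hz => ?_⟩
      · rw [((sa.hasWirtAt hz).sub (HasWirtAt.const 1 z)).dz_eq, sub_zero, hS.dz_a z (hsub hz)]
      · rw [((sa.hasWirtAt hz).sub (HasWirtAt.const 1 z)).dzbar_eq, sub_zero,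
          hS.dzbar_a z (hsub hz)]
  refine ⟨ba.iterate z₀ hz₀, (bb.iterate z₀ hz₀).trans ?_⟩
  gcongr
  have : 0 ≤ 2 ^ n * (C * C) := by positivity
  linarith

/-! ### Linear algebra in a fibre -/

section Fibre

variable {V : Type*} [AddCommGroup V] [Module ℂ V] (c : InnerProductSpace.Core ℂ V)

lemma form_add_left (u v w : V) : form c (u + v) w = form c u w + form c v w := by
  let _ : NormedAddCommGroup V := c.toNormedAddCommGroup
  let _ : InnerProductSpace ℂ V := InnerProductSpace.ofCore c.toCore
  exact inner_add_right (𝕜 := ℂ) w u v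

lemma form_smul_left (r : ℂ) (u w : V) : form c (r • u) w = r * form c u w := by
  let _ : NormedAddCommGroup V := c.toNormedAddCommGroup
  let _ : InnerProductSpace ℂ V := InnerProductSpace.ofCore c.toCore
  exact inner_smul_right (𝕜 := ℂ) w u r

lemma form_conj (u w : V) : conj (form c u w) = form c w u := c.conj_inner_symm u w

lemma form_add_right (u v w : V) : form c u (v + w) = form c u v + form c u w := by
  rw [← form_conj, form_add_left, map_add, form_conj, form_conj]

lemma form_smul_right (r : ℂ) (u w : V) : form c u (r • w) = conj r * form c u w := by
  rw [← form_conj, form_smul_left, map_mul, form_conj]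

lemma form_zero_right (u : V) : form c u 0 = 0 := by
  rw [← zero_smul ℂ u, form_smul_right, map_zero, zero_mul]

lemma form_neg_left (u w : V) : form c (-u) w = -form c u w := by
  rw [← neg_one_smul ℂ u, form_smul_left]; ring

lemma form_neg_right (u w : V) : form c u (-w) = -form c u w := by
  rw [← neg_one_smul ℂ w, form_smul_right]; simp

lemma form_sub_left (u v w : V) : form c (u - v) w = form c u w - form c v w := by
  rw [sub_eq_add_neg, form_add_left, form_neg_left, ← sub_eq_add_neg]

lemma form_self_eq (u : V) : form c u u = ((form c u u).re : ℂ) :=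
  (Complex.conj_eq_iff_real.1 (form_conj c u u)).elim fun r hr => by rw [hr, Complex.ofReal_re]

lemma form_self_re_nonneg (u : V) : 0 ≤ (form c u u).re := c.re_inner_nonneg u

lemma form_self_re_pos {u : V} (hu : u ≠ 0) : 0 < (form c u u).re := by
  refine lt_of_le_of_ne (form_self_re_nonneg c u) fun h => hu (c.definite u ?_)
  change form c u u = 0
  rw [form_self_eq, ← h, Complex.ofReal_zero]

lemma form_left_ext {u v : V} (h : ∀ w, form c u w = form c v w) : u = v := by
  by_contra huv
  have := form_self_re_pos c (sub_ne_zero.2 huv)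
  rw [form_sub_left, h, sub_self] at this
  simp at this

/-- The Gram determinant of two independent vectors is positive. -/
lemma gram_det_pos {v₀ v₁ : V} (hli : LinearIndependent ℂ ![v₀, v₁]) :
    0 < (form c v₀ v₀).re * (form c v₁ v₁).re - Complex.normSq (form c v₀ v₁) := by
  have hv₁ : v₁ ≠ 0 := hli.ne_zero 1
  have hne : form c v₁ v₁ • v₀ - form c v₀ v₁ • v₁ ≠ 0 := by
    intro h0
    have := LinearIndependent.pair_iff.1 hli (form c v₁ v₁) (-form c v₀ v₁)
      (by rw [neg_smul, ← sub_eq_add_neg, h0])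
    have h1 := form_self_re_pos c hv₁
    rw [this.1] at h1; simp at h1
  have h := form_self_re_pos c hne
  have e : form c (form c v₁ v₁ • v₀ - form c v₀ v₁ • v₁)
      (form c v₁ v₁ • v₀ - form c v₀ v₁ • v₁) = (((form c v₁ v₁).re * ((form c v₀ v₀).re *
        (form c v₁ v₁).re - Complex.normSq (form c v₀ v₁)) : ℝ) : ℂ) := by
    push_cast
    rw [← form_self_eq, ← form_self_eq, ← Complex.mul_conj, sub_eq_add_neg, ← neg_smul]
    simp only [form_add_left, form_add_right, form_smul_left, form_smul_right, map_neg, form_conj]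
    ring
  rw [e, Complex.ofReal_re] at h
  exact pos_of_mul_pos_right h (form_self_re_nonneg c v₁)

variable [FiniteDimensional ℂ V]

lemma form_adjoint (g : V →ₗ[ℂ] V) (u w : V) : form c (adjoint c g u) w = form c u (g w) := by
  let _ : NormedAddCommGroup V := c.toNormedAddCommGroup
  let _ : InnerProductSpace ℂ V := InnerProductSpace.ofCore c.toCore
  exact LinearMap.adjoint_inner_right g w u

lemma orthProj_mem (W : Submodule ℂ V) (u : V) : orthProj c W u ∈ W := by
  let _ : NormedAddCommGroup V := c.toNormedAddCommGroup
  let _ : InnerProductSpace ℂ V := InnerProductSpace.ofCore c.toCore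
  exact Submodule.starProjection_apply_mem W u

lemma form_sub_orthProj (W : Submodule ℂ V) (u w : V) (hw : w ∈ W) :
    form c (u - orthProj c W u) w = 0 := by
  let _ : NormedAddCommGroup V := c.toNormedAddCommGroup
  let _ : InnerProductSpace ℂ V := InnerProductSpace.ofCore c.toCore
  exact Submodule.sub_starProjection_mem_orthogonal (K := W) u w hw

lemma dualNorm_eq_vecNorm (φ : V →ₗ[ℂ] ℂ) (w : V) (h : ∀ u, φ u = form c u w) :
    dualNorm c φ = vecNorm c w := by
  let _ : NormedAddCommGroup V := c.toNormedAddCommGroup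
  let _ : InnerProductSpace ℂ V := InnerProductSpace.ofCore c.toCore
  have e : LinearMap.toContinuousLinearMap φ = innerSL ℂ w := by
    ext u; exact h u
  have h1 : dualNorm c φ = ‖LinearMap.toContinuousLinearMap φ‖ := rfl
  rw [h1, e, innerSL_apply_norm, norm_eq_sqrt_re_inner (𝕜 := ℂ)]
  rfl

/-- The `(2, 1)`-entry of `[f, f†]` in an eigenframe of determinant one. -/
lemma form_commutator_adjoint {f : V →ₗ[ℂ] V} {v₀ v₁ : V} (hspan : ∀ u, ∃ x y : ℂ,
    u = x • v₀ + y • v₁) (h₀ : f v₀ = v₀) (h₁ : f v₁ = -v₁)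
    (hdet : form c v₀ v₀ * form c v₁ v₁ - form c v₀ v₁ * form c v₁ v₀ = 1) :
    form c ((f ∘ₗ adjoint c f - adjoint c f ∘ₗ f) v₀) v₁ =
      4 * form c v₀ v₁ * (1 + form c v₀ v₁ * form c v₁ v₀) := by
  set a := form c v₀ v₀
  set b := form c v₀ v₁ with hb
  set b' := form c v₁ v₀ with hb'
  set d := form c v₁ v₁ with hd
  have hadj : adjoint c f v₀ = (a * d + b * b') • v₀ + (-2 * (a * b)) • v₁ := by
    refine form_left_ext c fun w => ?_
    obtain ⟨x, y, rfl⟩ := hspan w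
    simp only [form_adjoint, h₀, h₁, form_add_right, form_smul_right,
      form_neg_right, form_add_left, form_smul_left, ← hb, ← hb', ← hd]
    linear_combination (-(conj x * a) + conj y * b) * hdet
  have h2 : form c (adjoint c f (f v₀)) v₁ = -b := by
    rw [form_adjoint, h₀, h₁, form_neg_right]
  rw [LinearMap.sub_apply, form_sub_left, LinearMap.comp_apply, LinearMap.comp_apply, h2, hadj]
  simp only [map_add, map_smul, h₀, h₁, form_add_left, form_smul_left, form_neg_left, smul_neg,
    ← hb, ← hd]
  linear_combination 3 * b * hdet

/-- The norm of the difference of the two projections onto the first vector of a frame of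
determinant one. -/
lemma endNorm_sub_orthProj {v₀ v₁ : V} (hli : LinearIndependent ℂ ![v₀, v₁])
    (hspan : ∀ u, ∃ x y : ℂ, u = x • v₀ + y • v₁)
    (hdet : form c v₀ v₀ * form c v₁ v₁ - form c v₀ v₁ * form c v₁ v₀ = 1)
    {p : V →ₗ[ℂ] V} {W : Submodule ℂ V} (hW : ∀ w ∈ W, ∃ x : ℂ, w = x • v₀) (hv₀ : v₀ ∈ W)
    (hp₀ : p v₀ = v₀) (hp₁ : p v₁ = 0) :
    endNorm c (p - orthProj c W) = ‖form c v₀ v₁‖ := by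
  have ha := form_self_re_pos c (hli.ne_zero 0 : v₀ ≠ 0)
  have ha' : form c v₀ v₀ ≠ 0 := by rw [form_self_eq]; exact_mod_cast ha.ne'
  have hproj : ∀ u, orthProj c W u = (form c u v₀ / form c v₀ v₀) • v₀ := fun u => by
    obtain ⟨x, hx⟩ := hW _ (orthProj_mem c W u)
    have h := form_sub_orthProj c W u v₀ hv₀
    rw [form_sub_left, hx, form_smul_left, sub_eq_zero] at h
    rw [hx, h, mul_div_cancel_right₀ _ ha']
  set ρ := p - orthProj c W with hρ
  have hρ₀ : ρ v₀ = 0 := by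
    rw [hρ, LinearMap.sub_apply, hp₀, hproj, div_self ha', one_smul, sub_self]
  have hρ₁ : ρ v₁ = (-(form c v₁ v₀ / form c v₀ v₀)) • v₀ := by
    rw [hρ, LinearMap.sub_apply, hp₁, hproj, zero_sub, neg_smul]
  set w := adjoint c ρ v₀ with hw
  have hw_eq : w = (form c v₀ v₁ * form c v₁ v₀) • v₀ + (-(form c v₀ v₀ * form c v₀ v₁)) • v₁ := by
    refine form_left_ext c fun u => ?_
    obtain ⟨x, y, rfl⟩ := hspan u
    have hb : conj (form c v₁ v₀ / form c v₀ v₀) = form c v₀ v₁ / form c v₀ v₀ := by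
      rw [map_div₀, form_conj, form_conj]
    simp only [hw, form_adjoint, hρ₀, hρ₁, form_zero_right, form_add_right, form_smul_right,
      form_add_left, form_smul_left, map_neg, hb]
    rw [neg_mul, div_mul_cancel₀ _ ha']
    linear_combination (conj y * form c v₀ v₁) * hdet
  obtain ⟨φ, hφ₀, hφ⟩ : ∃ φ : V →ₗ[ℂ] ℂ, (∀ u, ρ u = φ u • v₀) ∧
      ∀ u, φ u = form c (ρ u) v₀ / form c v₀ v₀ := by
    let φ : V →ₗ[ℂ] ℂ :=
      { toFun := fun u => form c (ρ u) v₀ / form c v₀ v₀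
        map_add' := fun u v => by rw [map_add, form_add_left, add_div]
        map_smul' := fun r u => by rw [map_smul, form_smul_left, mul_div_assoc]; rfl }
    refine ⟨φ, fun u => ?_, fun _ => rfl⟩
    change ρ u = (form c (ρ u) v₀ / form c v₀ v₀) • v₀
    obtain ⟨x, y, rfl⟩ := hspan u
    simp only [map_add, map_smul, hρ₀, hρ₁, smul_zero, zero_add, smul_smul, form_smul_left]
    rw [mul_div_assoc, div_self ha', mul_one]
  have htr : LinearMap.trace ℂ V (ρ ∘ₗ adjoint c ρ) = φ w := by
    have : ρ ∘ₗ adjoint c ρ = (φ ∘ₗ adjoint c ρ).smulRight v₀ := by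
      ext u; simp [hφ₀]
    rw [this, LinearMap.trace_smulRight]; rfl
  have hval : φ w = ((‖form c v₀ v₁‖ ^ 2 : ℝ) : ℂ) := by
    rw [hφ, hw_eq, map_add, map_smul, map_smul, hρ₀, hρ₁, smul_zero, zero_add, smul_smul,
      form_smul_left, mul_div_assoc, div_self ha', ← Complex.normSq_eq_norm_sq, ← Complex.mul_conj,
      form_conj]
    field_simp
  rw [endNorm, htr, hval, Complex.ofReal_re, Real.sqrt_sq (norm_nonneg _)]

/-- The Gram matrix of a `C`-orthonormal frame for a metric compatible with `C`. -/
lemma gram_of_compatible {C : LinearMap.BilinForm ℂ V} {v₀ v₁ : V}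
    (hli : LinearIndependent ℂ ![v₀, v₁]) (hspan : ∀ u, ∃ x y : ℂ, u = x • v₀ + y • v₁)
    (h00 : C v₀ v₀ = 1) (h11 : C v₁ v₁ = 1) (h01 : C v₀ v₁ = 0) (h10 : C v₁ v₀ = 0)
    (hC : ∀ u, dualNorm c (C u) = vecNorm c u) :
    form c v₁ v₁ = form c v₀ v₀ ∧ (form c v₀ v₁).re = 0 ∧
      form c v₀ v₀ * form c v₁ v₁ - form c v₀ v₁ * form c v₁ v₀ = 1 := by
  have hΔ := gram_det_pos c hli
  obtain ⟨Δ, hΔd⟩ : ∃ Δ : ℝ, Δ = (form c v₀ v₀).re * (form c v₁ v₁).re -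
    Complex.normSq (form c v₀ v₁) := ⟨_, rfl⟩
  rw [← hΔd] at hΔ
  have hΔ0 : (Δ : ℂ) ≠ 0 := by exact_mod_cast hΔ.ne'
  have hΔc : (Δ : ℂ) = form c v₀ v₀ * form c v₁ v₁ - form c v₀ v₁ * form c v₁ v₀ := by
    rw [hΔd]; push_cast
    rw [← form_self_eq, ← form_self_eq, ← Complex.mul_conj, form_conj]
  have key : ∀ s t : ℂ, ((s * conj ((form c v₁ v₁ * s - form c v₀ v₁ * t)) +
      t * conj (form c v₀ v₀ * t - form c v₁ v₀ * s)) / Δ).re =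
      (form c (s • v₀ + t • v₁) (s • v₀ + t • v₁)).re := fun s t => by
    have h := hC (s • v₀ + t • v₁)
    set w := (conj (form c v₁ v₁ * s - form c v₀ v₁ * t) / Δ) • v₀ +
      (conj (form c v₀ v₀ * t - form c v₁ v₀ * s) / Δ) • v₁ with hw
    have hrep : ∀ u, C (s • v₀ + t • v₁) u = form c u w := fun u => by
      obtain ⟨x, y, rfl⟩ := hspan u
      have e1 : form c v₀ w = s := by
        rw [hw, form_add_right, form_smul_right, form_smul_right, map_div₀, map_div₀,
          Complex.conj_conj, Complex.conj_conj, Complex.conj_ofReal]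
        field_simp
        linear_combination (-s) * hΔc
      have e2 : form c v₁ w = t := by
        rw [hw, form_add_right, form_smul_right, form_smul_right, map_div₀, map_div₀,
          Complex.conj_conj, Complex.conj_conj, Complex.conj_ofReal]
        field_simp
        linear_combination (-t) * hΔc
      rw [form_add_left, form_smul_left, form_smul_left, e1, e2]
      simp [h00, h11, h01, h10]
      ring
    rw [dualNorm_eq_vecNorm c _ w hrep, vecNorm, vecNorm,
      Real.sqrt_inj (form_self_re_nonneg c _) (form_self_re_nonneg c _), ← hrep] at h
    rw [← h, hw]
    congr 1
    simp [h00, h11, h01, h10]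
    ring
  have k1 := key 1 0
  have k2 := key 0 1
  have k3 := key 1 1
  simp only [zero_smul, one_smul, add_zero, zero_add, mul_one, mul_zero, one_mul, zero_mul,
    sub_zero, map_sub, form_conj, Complex.div_ofReal_re, form_add_left, form_add_right,
    Complex.add_re, Complex.sub_re] at k1 k2 k3
  have hb : (form c v₁ v₀).re = (form c v₀ v₁).re := by
    rw [← form_conj, Complex.conj_re]
  have hpos := form_self_re_pos c (hli.ne_zero 0 : v₀ ≠ 0)
  rw [div_eq_iff hΔ.ne'] at k1 k2 k3
  have hΔ1 : Δ = 1 := by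
    have : (form c v₀ v₀).re * (Δ ^ 2 - 1) = 0 := by rw [k1] at k2; linear_combination -k2
    have h2 : Δ ^ 2 - 1 = 0 := (mul_eq_zero.1 this).resolve_left hpos.ne'
    nlinarith
  rw [hΔ1] at k1 k2 k3
  refine ⟨?_, ?_, ?_⟩
  · rw [form_self_eq, form_self_eq c v₀, k1, mul_one]
  · rw [hb] at k3; linarith
  · rw [← hΔc, hΔ1, Complex.ofReal_one]

end Fibre

/-! ### The Hitchin equation in an eigenframe of determinant one -/

/-- The functions `a = h(v₁, v₁)`, `d = h(v₂, v₂)`, `b = h(v₁, v₂)` for a harmonic metric and an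
eigenframe of determinant one, with the off-diagonal part of the Hitchin equation. -/
structure HitchinOn (Ω : Set ℂ) (a d b : ℂ → ℂ) : Prop where
  isOpen : IsOpen Ω
  smooth_a : SmoothAtOn a Ω
  smooth_d : SmoothAtOn d Ω
  smooth_b : SmoothAtOn b Ω
  conj_a : ∀ z ∈ Ω, conj (a z) = a z
  conj_d : ∀ z ∈ Ω, conj (d z) = d z
  a_pos : ∀ z ∈ Ω, 0 < (a z).re
  d_pos : ∀ z ∈ Ω, 0 < (d z).re
  det : ∀ z ∈ Ω, a z * d z - b z * conj (b z) = 1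
  hitchin : ∀ z ∈ Ω, dzbar (dz b) z = dzbar b z * (d z * dz a z - conj (b z) * dz b z) +
    dzbar d z * (a z * dz b z - b z * dz a z) + 4 * b z * (1 + b z * conj (b z))

lemma dzbar_eq_conj_dz_of_real {f : ℂ → ℂ} {Ω : Set ℂ} (hΩ : IsOpen Ω) (hf : SmoothAtOn f Ω)
    (hr : ∀ z ∈ Ω, conj (f z) = f z) {z : ℂ} (hz : z ∈ Ω) : dzbar f z = conj (dz f z) := by
  have h := (hf.hasWirtAt hz).star
  have e : f =ᶠ[𝓝 z] fun w => conj (f w) :=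
    eventually_of_mem (hΩ.mem_nhds hz) fun w hw => (hr w hw).symm
  exact (h.congr_of_eventuallyEq e).dzbar_eq

namespace HitchinOn
variable {Ω : Set ℂ} {a d b : ℂ → ℂ} (H : HitchinOn Ω a d b)
include H

lemma a_eq {z : ℂ} (hz : z ∈ Ω) : a z = ((a z).re : ℂ) :=
  (Complex.conj_eq_iff_re.1 (H.conj_a z hz)).symm

lemma d_eq {z : ℂ} (hz : z ∈ Ω) : d z = ((d z).re : ℂ) :=
  (Complex.conj_eq_iff_re.1 (H.conj_d z hz)).symm

lemma det_re {z : ℂ} (hz : z ∈ Ω) : (a z).re * (d z).re = 1 + ‖b z‖ ^ 2 := by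
  have h := H.det z hz
  rw [H.a_eq hz, H.d_eq hz, Complex.mul_conj, Complex.normSq_eq_norm_sq] at h
  have h' : (a z).re * (d z).re - ‖b z‖ ^ 2 = 1 := by exact_mod_cast h
  linarith

/-- The derivatives of the Gram matrix in terms of the connection matrix `(T, p; q, -T)`. -/
lemma exists_connection {z : ℂ} (hz : z ∈ Ω) : ∃ T p q : ℂ,
    d z * dz a z - conj (b z) * dz b z = T ∧ a z * dz b z - b z * dz a z = q ∧
    dz b z = b z * T + d z * q ∧ dzbar b z = a z * conj p - b z * conj T ∧
    dzbar d z = conj (b z) * conj p - d z * conj T := by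
  have hb := (H.smooth_b.hasWirtAt hz)
  have htr : dz a z * d z + a z * dz d z - (dz b z * conj (b z) + b z * conj (dzbar b z)) = 0 := by
    have h1 := ((H.smooth_a.hasWirtAt hz).mul (H.smooth_d.hasWirtAt hz)).sub (hb.mul hb.star)
    have e : (fun _ => (1 : ℂ)) =ᶠ[𝓝 z] fun w => a w * d w - b w * conj (b w) :=
      eventually_of_mem (H.isOpen.mem_nhds hz) fun w hw => (H.det w hw).symm
    have h2 := (h1.congr_of_eventuallyEq e).dz_eq
    rw [(HasWirtAt.const 1 z).dz_eq] at h2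
    exact h2.symm
  have hdet := H.det z hz
  have hdb : dzbar d z = conj (dz d z) := dzbar_eq_conj_dz_of_real H.isOpen H.smooth_d H.conj_d hz
  have ca := H.conj_a z hz
  have cd := H.conj_d z hz
  refine ⟨d z * dz a z - conj (b z) * dz b z,
    d z * conj (dzbar b z) - conj (b z) * dz d z, a z * dz b z - b z * dz a z, rfl, rfl, ?_, ?_, ?_⟩
  · linear_combination -dz b z * hdet
  · have e : conj (dzbar b z) = a z * (d z * conj (dzbar b z) - conj (b z) * dz d z) -
        conj (b z) * (d z * dz a z - conj (b z) * dz b z) := by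
      linear_combination (-conj (dzbar b z)) * hdet + conj (b z) * htr
    have := congrArg conj e
    rw [map_sub, map_mul, map_mul, ca] at this
    simpa only [Complex.conj_conj] using this
  · have e : dz d z = b z * (d z * conj (dzbar b z) - conj (b z) * dz d z) -
        d z * (d z * dz a z - conj (b z) * dz b z) := by
      linear_combination (-dz d z) * hdet + d z * htr
    rw [hdb]
    have := congrArg conj e
    rw [map_sub, map_mul, map_mul, cd] at this
    exact this

lemma laplacian_normSq {z : ℂ} (hz : z ∈ Ω) :
    8 * ‖b z‖ ^ 2 * (1 + ‖b z‖ ^ 2) ≤ (dz (dzbar fun w => b w * conj (b w)) z).re := by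
  have hb := (H.smooth_b.hasWirtAt hz)
  have e : (dzbar fun w => b w * conj (b w)) =ᶠ[𝓝 z]
      fun w => dzbar b w * conj (b w) + b w * conj (dz b w) := by
    filter_upwards [H.isOpen.mem_nhds hz] with w hw
    have hb := (H.smooth_b.hasWirtAt hw)
    exact (hb.mul hb.star).dzbar_eq
  have h1 := (((H.smooth_b.dzbar.hasWirtAt hz).mul hb.star).add
    (hb.mul (H.smooth_b.dz.hasWirtAt hz).star)).dz_eq
  rw [dz_congr e, h1, ← dzbar_dz_eq ((H.smooth_b z hz).of_le (by norm_cast)), H.hitchin z hz]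
  obtain ⟨T, p, q, hT, hq, hbz, hbzb, hdzb⟩ := H.exists_connection hz
  rw [hT, hq, hbz, hbzb, hdzb]
  have ca := H.conj_a z hz
  have cd := H.conj_d z hz
  set A := (a z).re with hA
  set D := (d z).re with hD
  have hae : a z = (A : ℂ) := H.a_eq hz
  have hde : d z = (D : ℂ) := H.d_eq hz
  have hAD : A * D = 1 + ‖b z‖ ^ 2 := H.det_re hz
  have hApos : 0 < A := H.a_pos z hz
  have hDpos : 0 < D := H.d_pos z hz
  rw [hae, hde]
  generalize b z = β at *
  have e2 : (((A * conj p - β * conj T) * T + (conj β * conj p - D * conj T) * q +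
        4 * β * (1 + β * conj β)) * conj β +
      (A * conj p - β * conj T) * conj (A * conj p - β * conj T) +
      ((β * T + D * q) * conj (β * T + D * q) +
        β * conj ((A * conj p - β * conj T) * T + (conj β * conj p - D * conj T) * q +
        4 * β * (1 + β * conj β)))) =
      8 * (β * conj β) * (1 + β * conj β) + A ^ 2 * (p * conj p) + D ^ 2 * (q * conj q) +
      (conj β ^ 2 * conj p * q + conj (conj β ^ 2 * conj p * q)) := by
    simp only [map_add, map_sub, map_mul, map_pow, Complex.conj_conj, Complex.conj_ofReal, map_one,
      map_ofNat]
    ring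
  rw [e2, Complex.add_conj, Complex.mul_conj, Complex.mul_conj, Complex.mul_conj,
    Complex.normSq_eq_norm_sq, Complex.normSq_eq_norm_sq, Complex.normSq_eq_norm_sq]
  have e3 : (8 * ((‖β‖ ^ 2 : ℝ) : ℂ) * (1 + ((‖β‖ ^ 2 : ℝ) : ℂ)) + A ^ 2 * ((‖p‖ ^ 2 : ℝ) : ℂ) +
      D ^ 2 * ((‖q‖ ^ 2 : ℝ) : ℂ) + ((2 * (conj β ^ 2 * conj p * q).re : ℝ) : ℂ)) =
      ((8 * ‖β‖ ^ 2 * (1 + ‖β‖ ^ 2) + A ^ 2 * ‖p‖ ^ 2 + D ^ 2 * ‖q‖ ^ 2 +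
        2 * (conj β ^ 2 * conj p * q).re : ℝ) : ℂ) := by push_cast; ring
  rw [e3, Complex.ofReal_re]
  have h3 : |(conj β ^ 2 * conj p * q).re| ≤ ‖β‖ ^ 2 * ‖p‖ * ‖q‖ := by
    refine (Complex.abs_re_le_norm _).trans (le_of_eq ?_)
    simp only [norm_mul, norm_pow, Complex.norm_conj]
  have h4 := (abs_le.1 h3).1
  have h5 : ‖β‖ ^ 2 * ‖p‖ * ‖q‖ ≤ A * D * ‖p‖ * ‖q‖ := by
    rw [hAD]; gcongr; linarith
  nlinarith [sq_nonneg (A * ‖p‖ - D * ‖q‖)]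

lemma viscositySub_sq {m : ℂ → ℝ} (hm : ∀ w ∈ Ω, m w = ‖b w‖) {z : ℂ} (hz : z ∈ Ω) {k : ℝ}
    (hk : k ≤ 8 * m z ^ 2 * (1 + m z ^ 2)) : ViscositySub (fun w => m w ^ 2) k z := by
  have h0 : ∀ w ∈ Ω, (b w * conj (b w)).re = m w ^ 2 := fun w hw => by
    rw [Complex.mul_conj, Complex.ofReal_re, Complex.normSq_eq_norm_sq, hm w hw]
  refine ⟨fun w => b w * conj (b w), ?_, h0 z hz, ?_, hk.trans ?_⟩
  · have hb : ContDiffAt ℝ 2 b z := (H.smooth_b z hz).of_le (by norm_cast)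
    exact hb.mul (Complex.conjCLE.contDiff.contDiffAt.comp z hb)
  · exact eventually_of_mem (H.isOpen.mem_nhds hz) fun w hw => (h0 w hw).le
  · rw [hm z hz]; exact H.laplacian_normSq hz

lemma viscositySub_of_bound {m : ℂ → ℝ} (hm : ∀ w ∈ Ω, m w = ‖b w‖) {z : ℂ} (hz : z ∈ Ω) {k : ℝ}
    (hk : ∀ c : ℂ, ‖c‖ = 1 → c * b z = ‖b z‖ → k ≤ 4 * m z + (c *
      (dzbar b z * (d z * dz a z - conj (b z) * dz b z) +
        dzbar d z * (a z * dz b z - b z * dz a z))).re) : ViscositySub m k z := by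
  obtain ⟨c, hc, hcb⟩ := exists_unit_mul_eq_norm (b z)
  refine ⟨fun w => c * b w, ?_, ?_, ?_, (hk c hc hcb).trans ?_⟩
  · exact contDiffAt_const.mul ((H.smooth_b z hz).of_le (by norm_cast))
  · change (c * b z).re = m z
    rw [hcb, Complex.ofReal_re, hm z hz]
  · refine eventually_of_mem (H.isOpen.mem_nhds hz) fun w hw => ?_
    refine (Complex.re_le_norm _).trans (le_of_eq ?_)
    rw [norm_mul, hc, one_mul, hm w hw]
  · have e : (dzbar fun w => c * b w) =ᶠ[𝓝 z] fun w => c * dzbar b w := by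
      filter_upwards [H.isOpen.mem_nhds hz] with w hw
      exact ((H.smooth_b.hasWirtAt hw).const_mul c).dzbar_eq
    rw [dz_congr e, ((H.smooth_b.dzbar.hasWirtAt hz).const_mul c).dz_eq,
      ← dzbar_dz_eq ((H.smooth_b z hz).of_le (by norm_cast)), H.hitchin z hz]
    have h4 : 4 * m z ≤ (c * (4 * b z * (1 + b z * conj (b z)))).re := by
      rw [show c * (4 * b z * (1 + b z * conj (b z))) = 4 * (c * b z) * (1 + b z * conj (b z)) by
        ring, hcb, Complex.mul_conj, Complex.normSq_eq_norm_sq, hm z hz]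
      rw [show (4 * (‖b z‖ : ℂ) * (1 + ((‖b z‖ ^ 2 : ℝ) : ℂ))) =
        ((4 * ‖b z‖ * (1 + ‖b z‖ ^ 2) : ℝ) : ℂ) by push_cast; ring, Complex.ofReal_re]
      nlinarith [mul_nonneg (norm_nonneg (b z)) (sq_nonneg ‖b z‖)]
    rw [mul_add c (dzbar b z * _ + _), Complex.add_re]
    linarith

end HitchinOn

/-- A Hitchin solution invariant under a symmetric pairing. -/
structure SymHitchinOn (Ω : Set ℂ) (a d b : ℂ → ℂ) : Prop extends HitchinOn Ω a d b where
  d_eq_a : ∀ z ∈ Ω, d z = a z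
  b_re : ∀ z ∈ Ω, (b z).re = 0

namespace SymHitchinOn
variable {Ω : Set ℂ} {a d b : ℂ → ℂ} (H : SymHitchinOn Ω a d b)
include H

lemma conj_b {z : ℂ} (hz : z ∈ Ω) : conj (b z) = -b z := by
  apply Complex.ext <;> simp [H.b_re z hz]

lemma a_ne {z : ℂ} (hz : z ∈ Ω) : a z ≠ 0 := by
  intro h
  have := H.a_pos z hz
  rw [h] at this; simp at this

lemma a_sq {z : ℂ} (hz : z ∈ Ω) : a z * a z + b z * b z = 1 := by
  have h := H.det z hz
  rw [H.d_eq_a z hz, H.conj_b hz] at h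
  linear_combination h

lemma dz_rel {z : ℂ} (hz : z ∈ Ω) :
    a z * dz a z = -(b z * dz b z) ∧ a z * dzbar a z = -(b z * dzbar b z) := by
  have ha := H.smooth_a.hasWirtAt hz
  have hb := H.smooth_b.hasWirtAt hz
  have h1 := (ha.mul ha).add (hb.mul hb)
  have e : (fun _ => (1 : ℂ)) =ᶠ[𝓝 z] fun w => a w * a w + b w * b w :=
    eventually_of_mem (H.isOpen.mem_nhds hz) fun w hw => (H.a_sq hw).symm
  have h2 := h1.congr_of_eventuallyEq e
  have h3 := h2.dz_eq
  have h4 := h2.dzbar_eq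
  rw [(HasWirtAt.const 1 z).dz_eq] at h3
  rw [(HasWirtAt.const 1 z).dzbar_eq] at h4
  constructor
  · linear_combination (-1 / 2) * h3
  · linear_combination (-1 / 2) * h4

lemma dzbar_b {z : ℂ} (hz : z ∈ Ω) : dzbar b z = -conj (dz b z) := by
  have hb := H.smooth_b.hasWirtAt hz
  have e : b =ᶠ[𝓝 z] fun w => (-1 : ℂ) * conj (b w) :=
    eventually_of_mem (H.isOpen.mem_nhds hz) fun w hw => by
      change b w = -1 * conj (b w)
      rw [H.conj_b hw]; ring
  rw [((hb.star.const_mul (-1)).congr_of_eventuallyEq e).dzbar_eq]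
  ring

lemma dzbar_d {z : ℂ} (hz : z ∈ Ω) : dzbar d z = dzbar a z :=
  dzbar_congr (eventually_of_mem (H.isOpen.mem_nhds hz) fun w hw => H.d_eq_a w hw)

lemma quadratic_term {z : ℂ} (hz : z ∈ Ω) :
    dzbar b z * (d z * dz a z - conj (b z) * dz b z) + dzbar d z * (a z * dz b z - b z * dz a z) =
      dzbar a z * (dz b z / a z) := by
  have ha := H.a_ne hz
  obtain ⟨h1, h2⟩ := H.dz_rel hz
  have h3 : d z * dz a z - conj (b z) * dz b z = 0 := by
    rw [H.d_eq_a z hz, H.conj_b hz, h1]; ring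
  have h4 : a z * dz b z - b z * dz a z = dz b z / a z := by
    rw [eq_div_iff ha]
    linear_combination dz b z * H.a_sq hz - b z * h1
  rw [h3, h4, H.dzbar_d hz]; ring

lemma viscositySub {m : ℂ → ℝ} (hm : ∀ w ∈ Ω, m w = ‖b w‖) {z : ℂ} (hz : z ∈ Ω) :
    ViscositySub m (4 * m z) z := by
  refine H.viscositySub_of_bound hm hz fun c _ hcb => ?_
  have ha := H.a_ne hz
  obtain ⟨-, h2⟩ := H.dz_rel hz
  have h5 : c * (dzbar a z * (dz b z / a z)) =
      (((‖b z‖ * ‖dz b z‖ ^ 2 / (a z).re ^ 2 : ℝ)) : ℂ) := by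
    have h6 : dzbar a z = b z * conj (dz b z) / a z := by
      rw [eq_div_iff ha, mul_comm, h2, H.dzbar_b hz]; ring
    push_cast
    rw [← H.a_eq hz, h6, ← hcb, ← Complex.ofReal_pow, ← Complex.normSq_eq_norm_sq,
      ← Complex.mul_conj]
    field_simp
  rw [H.quadratic_term hz, h5, Complex.ofReal_re]
  have : 0 ≤ ‖b z‖ * ‖dz b z‖ ^ 2 / (a z).re ^ 2 := by positivity
  linarith

lemma a_re_sq {z : ℂ} (hz : z ∈ Ω) : (a z).re ^ 2 = 1 + (b z).im ^ 2 := by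
  have h := H.det_re hz
  rw [H.d_eq_a z hz, ← Complex.normSq_eq_norm_sq, Complex.normSq_apply, H.b_re z hz] at h
  nlinarith

lemma norm_b {z : ℂ} (hz : z ∈ Ω) : ‖b z‖ = |(b z).im| := by
  have : b z = (b z).im * Complex.I := by apply Complex.ext <;> simp [H.b_re z hz]
  rw [this]; simp

/-- Writing `b = i sinh U` turns the Hitchin equation into the sinh-Gordon equation. -/
lemma sinhGordonOn :
    SinhGordonOn Ω (fun z => ((Real.arsinh (b z).im : ℝ) : ℂ)) a b := by
  set U : ℂ → ℂ := fun z => ((Real.arsinh (b z).im : ℝ) : ℂ) with hU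
  have sU : SmoothAtOn U Ω := fun z hz =>
    Complex.ofRealCLM.contDiff.contDiffAt.comp z (Real.contDiff_arsinh.contDiffAt.comp z
      (Complex.imCLM.contDiff.contDiffAt.comp z (H.smooth_b z hz)))
  have hUw : ∀ z ∈ Ω, HasWirtAt U ((a z)⁻¹ * (-Complex.I * dz b z))
      ((a z)⁻¹ * (-Complex.I * dzbar b z)) z := fun z hz => by
    have h1 : HasWirtAt (fun w => (((b w).im : ℝ) : ℂ)) (-Complex.I * dz b z)
        (-Complex.I * dzbar b z) z := by
      refine ((H.smooth_b.hasWirtAt hz).const_mul (-Complex.I)).congr_of_eventuallyEq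
        (eventually_of_mem (H.isOpen.mem_nhds hz) fun w hw => ?_)
      apply Complex.ext <;> simp [H.b_re w hw]
    have h2 := h1.ofReal_comp (Real.hasDerivAt_arsinh (b z).im)
    have h3 : √(1 + (b z).im ^ 2) = (a z).re := by
      rw [← H.a_re_sq hz, Real.sqrt_sq (H.a_pos z hz).le]
    rw [h3, Complex.ofReal_inv, ← H.a_eq hz] at h2
    exact h2
  have hb1 : ∀ z ∈ Ω, dz b z = Complex.I * (a z * dz U z) := fun z hz => by
    have ha := H.a_ne hz
    rw [(hUw z hz).dz_eq, mul_inv_cancel_left₀ ha]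
    linear_combination dz b z * Complex.I_mul_I
  have hb2 : ∀ z ∈ Ω, dzbar b z = Complex.I * (a z * dzbar U z) := fun z hz => by
    have ha := H.a_ne hz
    rw [(hUw z hz).dzbar_eq, mul_inv_cancel_left₀ ha]
    linear_combination dzbar b z * Complex.I_mul_I
  have ha1 : ∀ z ∈ Ω, dz a z = -Complex.I * (b z * dz U z) := fun z hz => by
    have ha := H.a_ne hz
    have h := (H.dz_rel hz).1
    rw [hb1 z hz] at h
    apply mul_left_cancel₀ ha
    rw [h]; ring
  have ha2 : ∀ z ∈ Ω, dzbar a z = -Complex.I * (b z * dzbar U z) := fun z hz => by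
    have ha := H.a_ne hz
    have h := (H.dz_rel hz).2
    rw [hb2 z hz] at h
    apply mul_left_cancel₀ ha
    rw [h]; ring
  refine ⟨sU, H.smooth_a, H.smooth_b, ha1, ha2, hb1, hb2, fun z hz => ?_⟩
  have ha := H.a_ne hz
  have h1 : dzbar (dz b) z = Complex.I * (dzbar a z * dz U z + a z * dzbar (dz U) z) := by
    have e : dz b =ᶠ[𝓝 z] fun w => Complex.I * (a w * dz U w) :=
      eventually_of_mem (H.isOpen.mem_nhds hz) hb1
    rw [dzbar_congr e]
    exact (((H.smooth_a.hasWirtAt hz).mul (sU.dz.hasWirtAt hz)).const_mul Complex.I).dzbar_eq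
  rw [H.hitchin z hz, H.quadratic_term hz, hb1 z hz] at h1
  have h2 : Complex.I * (a z * dz U z) / a z = Complex.I * dz U z := by field_simp
  rw [h2, H.conj_b hz] at h1
  rw [← dzbar_dz_eq ((sU z hz).of_le (by norm_cast))]
  apply mul_left_cancel₀ ha
  have h3 := H.a_sq hz
  linear_combination Complex.I * h1 + a z * dzbar (dz U) z * Complex.I_mul_I +
    4 * Complex.I * b z * h3

lemma norm_arsinh_le {z : ℂ} (hz : z ∈ Ω) : ‖((Real.arsinh (b z).im : ℝ) : ℂ)‖ ≤ ‖b z‖ := by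
  rw [H.norm_b hz, Complex.norm_real, Real.norm_eq_abs]
  conv_rhs => rw [← Real.sinh_arsinh (b z).im, Real.abs_sinh]
  exact Real.self_le_sinh_iff.2 (abs_nonneg _)

lemma norm_a_sub_one_le {z : ℂ} (hz : z ∈ Ω) : ‖a z - 1‖ ≤ ‖b z‖ ^ 2 := by
  rw [H.norm_b hz, sq_abs]
  have h1 := H.a_re_sq hz
  have h2 := H.a_pos z hz
  rw [H.a_eq hz, ← Complex.ofReal_one, ← Complex.ofReal_sub, Complex.norm_real, Real.norm_eq_abs,
    abs_le]
  constructor <;> nlinarith [sq_nonneg (b z).im]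

end SymHitchinOn

/-! ### Decay of functions that are locally given by solutions of the Hitchin equation -/

/-- Near each point of the disc of radius `R`, `m` is `‖b‖` for a solution of the Hitchin
equation. -/
def LocallyHitchin (m : ℂ → ℝ) (R : ℝ) : Prop :=
  ∀ z ∈ Metric.ball (0 : ℂ) R, ∃ (Ω : Set ℂ) (a d b : ℂ → ℂ), z ∈ Ω ∧ HitchinOn Ω a d b ∧
    ∀ w ∈ Ω, m w = ‖b w‖

namespace LocallyHitchin
variable {m : ℂ → ℝ} {R R₀ : ℝ} (hm : LocallyHitchin m R)
include hm

lemma continuousOn : ContinuousOn m (Metric.ball 0 R) := fun z hz => by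
  obtain ⟨Ω, a, d, b, hzΩ, H, hmb⟩ := hm z hz
  have h1 : ContinuousAt (fun w => ‖b w‖) z := (H.smooth_b z hzΩ).continuousAt.norm
  exact (h1.congr (eventually_of_mem (H.isOpen.mem_nhds hzΩ)
    fun w hw => (hmb w hw).symm)).continuousWithinAt

lemma sq_le (hR₀ : 0 < R₀) {z : ℂ} (hz : z ∈ Metric.closedBall (0 : ℂ) (R - R₀)) :
    m z ^ 2 ≤ 1 / (R₀ / 2) ^ 2 := by
  have hsub : Metric.closedBall z (R₀ / 2) ⊆ Metric.ball (0 : ℂ) R := fun w hw => by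
    have h1 : dist w z ≤ R₀ / 2 := hw
    have h2 : dist z 0 ≤ R - R₀ := hz
    have := dist_triangle w z 0
    rw [Metric.mem_ball]; linarith
  refine keller_osserman (m := fun w => m w ^ 2) (by positivity)
    ((hm.continuousOn.mono hsub).pow 2) fun w hw _ => ?_
  obtain ⟨Ω, a, d, b, hzΩ, H, hmb⟩ := hm w (hsub (Metric.ball_subset_closedBall hw))
  exact H.viscositySub_sq hmb hzΩ (by nlinarith [sq_nonneg (m w)])

lemma le (hR₀ : 0 < R₀) {z : ℂ} (hz : z ∈ Metric.closedBall (0 : ℂ) (R - R₀)) :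
    m z ≤ 2 / R₀ := by
  have h := hm.sq_le hR₀ hz
  have e : 1 / (R₀ / 2) ^ 2 = (2 / R₀) ^ 2 := by field_simp
  rw [e] at h
  exact le_of_sq_le_sq h (by positivity)

end LocallyHitchin

lemma closedBall_subset_ball_zero {R R₀ : ℝ} (hR₀ : 0 < R₀) :
    Metric.closedBall (0 : ℂ) (R - R₀) ⊆ Metric.ball 0 R :=
  Metric.closedBall_subset_ball (by linarith)

theorem exists_decay_general {R₀ γ : ℝ} (hR₀ : 0 < R₀) (hγ : 0 < γ) (hγ' : γ < 2 * √2) :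
    ∃ C : ℝ, 0 < C ∧ ∀ R : ℝ, R₀ < R → ∀ m : ℂ → ℝ, LocallyHitchin m R →
      ∀ z ∈ Metric.closedBall (0 : ℂ) (R - R₀), m z ≤ C * Real.exp (-γ * (R - ‖z‖)) := by
  have hk : (2 * γ) ^ 2 / 4 < 8 := by
    have : γ ^ 2 < (2 * √2) ^ 2 := by gcongr
    rw [mul_pow, Real.sq_sqrt (by norm_num)] at this
    linarith
  obtain ⟨C, hC, h⟩ := exists_decay_const (by positivity : 0 < 2 * γ) hk R₀ le_rfl
    (by positivity : 0 ≤ 1 / (R₀ / 2) ^ 2)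
  refine ⟨√C, by positivity, fun R hR m hm z hz => ?_⟩
  have hsub := closedBall_subset_ball_zero (R := R) hR₀
  have := h R hR (fun w => m w ^ 2) ((hm.continuousOn.mono hsub).pow 2)
    (fun w hw => hm.sq_le hR₀ hw) (fun w hw _ => by
      obtain ⟨Ω, a, d, b, hzΩ, H, hmb⟩ := hm w (hsub (Metric.ball_subset_closedBall hw))
      exact H.viscositySub_sq hmb hzΩ (by nlinarith [sq_nonneg (m w), sq_nonneg (m w ^ 2)])) z hz
  refine le_of_sq_le_sq (this.trans (le_of_eq ?_)) (by positivity)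
  rw [mul_pow, Real.sq_sqrt hC.le, ← Real.exp_nat_mul]
  congr 2; push_cast; ring

theorem exists_decay_symmetric {R₀ γ : ℝ} (hR₀ : 0 < R₀) (hγ : 0 < γ) (hγ' : γ < 4) :
    ∃ C : ℝ, 0 < C ∧ ∀ R : ℝ, R₀ < R → ∀ m : ℂ → ℝ,
      (∀ z ∈ Metric.ball (0 : ℂ) R, ∃ (Ω : Set ℂ) (a d b : ℂ → ℂ), z ∈ Ω ∧ SymHitchinOn Ω a d b ∧
        ∀ w ∈ Ω, m w = ‖b w‖) →
      ∀ z ∈ Metric.closedBall (0 : ℂ) (R - R₀), m z ≤ C * Real.exp (-γ * (R - ‖z‖)) := by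
  obtain ⟨C, hC, h⟩ := exists_decay_const (k := 4) hγ (by nlinarith) R₀ le_rfl
    (by positivity : 0 ≤ 2 / R₀)
  refine ⟨C, hC, fun R hR m hm => ?_⟩
  have hm' : LocallyHitchin m R := fun z hz => by
    obtain ⟨Ω, a, d, b, hzΩ, H, hmb⟩ := hm z hz
    exact ⟨Ω, a, d, b, hzΩ, H.toHitchinOn, hmb⟩
  have hsub := closedBall_subset_ball_zero (R := R) hR₀
  refine h R hR m (hm'.continuousOn.mono hsub) (fun w hw => hm'.le hR₀ hw) fun w hw _ => ?_
  obtain ⟨Ω, a, d, b, hzΩ, H, hmb⟩ := hm w (hsub (Metric.ball_subset_closedBall hw))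
  rw [zero_mul, sub_zero]
  exact H.viscositySub hmb hzΩ

theorem exists_decay_refined {R₀ γ γ₀ B : ℝ} (hR₀ : 0 < R₀) (hγ : 0 < γ) (hγ' : γ < 4)
    (hγ₀ : 2 < γ₀) (hB : 0 < B) :
    ∃ C : ℝ, 0 < C ∧ ∀ R : ℝ, R₀ < R → ∀ a d b : ℂ → ℂ, HitchinOn (Metric.ball 0 R) a d b →
      (∀ z ∈ Metric.ball (0 : ℂ) R, ‖a z‖ + ‖d z‖ ≤ B ∧
        ‖dz a z‖ + ‖dz d z‖ + ‖dz b z‖ + ‖dzbar b z‖ ≤ B * Real.exp (-γ₀ * (R - ‖z‖))) →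
      ∀ z ∈ Metric.closedBall (0 : ℂ) (R - R₀), ‖b z‖ ≤ C * Real.exp (-γ * (R - ‖z‖)) := by
  obtain ⟨C, hC, h⟩ := exists_decay_const (k := 4) hγ (by nlinarith) R₀
    (by positivity : 0 ≤ 4 * B ^ 3) (by positivity : 0 ≤ 2 / R₀)
  refine ⟨C, hC, fun R hR a d b H hbd => ?_⟩
  have hm : LocallyHitchin (fun z => ‖b z‖) R := fun z hz =>
    ⟨_, a, d, b, hz, H, fun _ _ => rfl⟩
  have hsub := closedBall_subset_ball_zero (R := R) hR₀
  refine h R hR _ (hm.continuousOn.mono hsub) (fun w hw => hm.le hR₀ hw) fun z hz _ => ?_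
  have hzR := hsub (Metric.ball_subset_closedBall hz)
  refine H.viscositySub_of_bound (fun _ _ => rfl) hzR fun c hc _ => ?_
  obtain ⟨h1, h2⟩ := hbd z hzR
  set e := B * Real.exp (-γ₀ * (R - ‖z‖)) with he
  have he0 : 0 < e := by positivity
  have n1 := norm_nonneg (a z)
  have n2 := norm_nonneg (d z)
  have n3 := norm_nonneg (dz a z)
  have n4 := norm_nonneg (dz d z)
  have n5 := norm_nonneg (dz b z)
  have n6 := norm_nonneg (dzbar b z)
  have hbB : ‖b z‖ ≤ B := by
    have h3 := H.det_re hzR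
    have h4 := Complex.re_le_norm (a z)
    have h5 := Complex.re_le_norm (d z)
    have h6 : (a z).re * (d z).re ≤ ‖a z‖ * ‖d z‖ := by
      gcongr; exact (H.d_pos z hzR).le
    refine le_of_sq_le_sq ?_ hB.le
    nlinarith
  have hdd : ‖dzbar d z‖ = ‖dz d z‖ := by
    rw [dzbar_eq_conj_dz_of_real H.isOpen H.smooth_d H.conj_d hzR, Complex.norm_conj]
  have t1 : ‖d z * dz a z - conj (b z) * dz b z‖ ≤ B * e + B * e := by
    refine (norm_sub_le _ _).trans ?_
    rw [norm_mul, norm_mul, Complex.norm_conj]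
    gcongr <;> linarith
  have t2 : ‖a z * dz b z - b z * dz a z‖ ≤ B * e + B * e := by
    refine (norm_sub_le _ _).trans ?_
    rw [norm_mul, norm_mul]
    gcongr <;> linarith
  have t3 : ‖dzbar b z * (d z * dz a z - conj (b z) * dz b z) +
      dzbar d z * (a z * dz b z - b z * dz a z)‖ ≤ e * (B * e + B * e) + e * (B * e + B * e) := by
    refine (norm_add_le _ _).trans ?_
    rw [norm_mul, norm_mul, hdd]
    gcongr <;> linarith
  have t4 : e * (B * e + B * e) + e * (B * e + B * e) ≤
      4 * B ^ 3 * Real.exp (-γ * (R - ‖z‖)) := by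
    have : e * (B * e + B * e) + e * (B * e + B * e) =
        4 * B ^ 3 * (Real.exp (-γ₀ * (R - ‖z‖)) * Real.exp (-γ₀ * (R - ‖z‖))) := by
      rw [he]; ring
    rw [this, ← Real.exp_add]
    gcongr
    have : ‖z‖ < R := by simpa using hzR
    nlinarith
  have t5 := Complex.abs_re_le_norm (c * (dzbar b z * (d z * dz a z - conj (b z) * dz b z) +
      dzbar d z * (a z * dz b z - b z * dz a z)))
  rw [norm_mul, hc, one_mul] at t5
  have t6 := (abs_le.1 (t5.trans (t3.trans t4))).1
  linarith

theorem exists_decay_derivatives {R₀ γ : ℝ} (hR₀ : 0 < R₀) (hγ : 0 < γ) (hγ' : γ < 4) (j k : ℕ) :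
    ∃ C : ℝ, 0 < C ∧ ∀ R : ℝ, R₀ < R → ∀ a d b : ℂ → ℂ, SymHitchinOn (Metric.ball 0 R) a d b →
      ∀ z ∈ Metric.closedBall (0 : ℂ) (R - R₀),
        ‖dz^[j] (dzbar^[k] fun w => a w - 1) z‖ ≤ C * Real.exp (-(2 * γ) * (R - ‖z‖)) ∧
        ‖dz^[j] (dzbar^[k] b) z‖ ≤ C * Real.exp (-γ * (R - ‖z‖)) := by
  have hr : 0 < R₀ / 2 := by positivity
  obtain ⟨C₁, hC₁, h₁⟩ := exists_decay_symmetric hr hγ hγ'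
  set E := C₁ * Real.exp (γ * (R₀ / 2)) with hE
  have hE0 : 0 < E := by positivity
  have hM : 0 < 1 + E ^ 2 + E := by positivity
  obtain ⟨C₂, hC₂, h₂⟩ := SinhGordonOn.exists_iterate_bound j k hr hM
  refine ⟨C₂ * E ^ 2 + C₂ * E, by positivity, fun R hR a d b H z hz => ?_⟩
  have hzR : ‖z‖ ≤ R - R₀ := by simpa using hz
  set ε := E * Real.exp (-γ * (R - ‖z‖)) with hε
  have hε0 : 0 < ε := by positivity
  have hexp1 : Real.exp (-γ * (R - ‖z‖)) ≤ 1 := Real.exp_le_one_iff.2 (by nlinarith)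
  have hεE : ε ≤ E := by
    rw [hε]; exact mul_le_of_le_one_right hE0.le hexp1
  have hin : ∀ w ∈ Metric.ball z (R₀ / 2), w ∈ Metric.closedBall (0 : ℂ) (R - R₀ / 2) ∧
      ‖w‖ ≤ ‖z‖ + R₀ / 2 := fun w hw => by
    have h1 : ‖w - z‖ < R₀ / 2 := by simpa [dist_eq_norm] using hw
    have h2 : ‖w‖ ≤ ‖z‖ + ‖w - z‖ := by
      simpa using norm_add_le z (w - z)
    constructor
    · simp; linarith
    · linarith
  have hsub : Metric.ball z (R₀ / 2) ⊆ Metric.ball (0 : ℂ) R := fun w hw =>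
    closedBall_subset_ball_zero hr (hin w hw).1
  have hb : ∀ w ∈ Metric.ball z (R₀ / 2), ‖b w‖ ≤ ε := fun w hw => by
    refine (h₁ R (by linarith) (fun w => ‖b w‖) (fun w hw =>
      ⟨_, a, d, b, hw, H, fun _ _ => rfl⟩) w (hin w hw).1).trans ?_
    rw [hε, hE, mul_assoc, ← Real.exp_add]
    gcongr
    nlinarith [(hin w hw).2]
  have hS := H.sinhGordonOn
  have hS' : SinhGordonOn (Metric.ball z (R₀ / 2)) (fun z => ((Real.arsinh (b z).im : ℝ) : ℂ)) a b :=
    ⟨hS.smooth_U.mono hsub, hS.smooth_a.mono hsub, hS.smooth_b.mono hsub,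
      fun w hw => hS.dz_a w (hsub hw), fun w hw => hS.dzbar_a w (hsub hw),
      fun w hw => hS.dz_b w (hsub hw), fun w hw => hS.dzbar_b w (hsub hw),
      fun w hw => hS.laplace_U w (hsub hw)⟩
  have ha1 : ∀ w ∈ Metric.ball z (R₀ / 2), ‖a w - 1‖ ≤ ε ^ 2 := fun w hw =>
    (H.norm_a_sub_one_le (hsub hw)).trans (pow_le_pow_left₀ (norm_nonneg _) (hb w hw) 2)
  have ha : ∀ w ∈ Metric.ball z (R₀ / 2), ‖a w‖ ≤ 1 + E ^ 2 + E := fun w hw => by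
    have h1 := norm_add_le (a w - 1) 1
    rw [sub_add_cancel, norm_one] at h1
    have h2 := ha1 w hw
    have h3 : ε ^ 2 ≤ E ^ 2 := pow_le_pow_left₀ hε0.le hεE 2
    linarith
  obtain ⟨k1, k2⟩ := h₂ z _ a b ε hε0 (by nlinarith) hS'
    (fun w hw => (H.norm_arsinh_le (hsub hw)).trans (hb w hw)) hb ha ha1
  constructor
  · refine k1.trans ?_
    have : C₂ * ε ^ 2 = C₂ * E ^ 2 * Real.exp (-(2 * γ) * (R - ‖z‖)) := by
      rw [hε, mul_pow, ← Real.exp_nat_mul, ← mul_assoc]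
      congr 2; push_cast; ring
    rw [this]
    gcongr
    have : 0 ≤ C₂ * E := by positivity
    linarith
  · refine k2.trans ?_
    have : C₂ * ε = C₂ * E * Real.exp (-γ * (R - ‖z‖)) := by rw [hε]; ring
    rw [this]
    gcongr
    have : 0 ≤ C₂ * E ^ 2 := by positivity
    linarith

/-! ### Functions on the disc -/

section Functions
variable {R : ℝ}

lemma ext_coe (g : disc R → ℂ) (x : disc R) : ext g x = g x :=
  Subtype.val_injective.extend_apply g 0 x

lemma isOpen_image_val {V : Set (disc R)} (hV : IsOpen V) : IsOpen (Subtype.val '' V : Set ℂ) :=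
  (disc R).isOpen.isOpenMap_subtype_val V hV

lemma image_val_univ : (Subtype.val '' (univ : Set (disc R)) : Set ℂ) = Metric.ball 0 R := by
  rw [image_univ]; exact Subtype.range_coe

lemma HolFunOn.of_eq {g : disc R → ℂ} {V : Set (disc R)} {φ : ℂ → ℂ}
    (hφ : DifferentiableOn ℂ φ (Subtype.val '' V)) (h : ∀ x ∈ V, g x = φ x) : HolFunOn g V := by
  refine hφ.congr ?_
  rintro _ ⟨x, hx, rfl⟩
  rw [ext_coe, h x hx]

lemma HolFunOn.mono {g : disc R → ℂ} {V W : Set (disc R)} (h : HolFunOn g V) (hW : W ⊆ V) :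
    HolFunOn g W :=
  DifferentiableOn.mono h (image_mono hW)

lemma HolFunOn.continuousOn {g : disc R → ℂ} {V : Set (disc R)} (h : HolFunOn g V) :
    ContinuousOn g V := by
  have h1 : ContinuousOn (fun x : disc R => ext g x) V :=
    (DifferentiableOn.continuousOn h).comp continuous_subtype_val.continuousOn
      (mapsTo_image _ _)
  exact h1.congr fun x _ => (ext_coe g x).symm

lemma HolFunOn.contMDiffOn {g : disc R → ℂ} {V : Set (disc R)} (hV : IsOpen V)
    (h : HolFunOn g V) : ContMDiffOn 𝓘(ℂ, ℂ) 𝓘(ℂ, ℂ) ω g V := fun x hx => by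
  have h1 : ContDiffAt ℂ ω (ext g) x :=
    (DifferentiableOn.analyticAt h ((isOpen_image_val hV).mem_nhds ⟨x, hx, rfl⟩)).contDiffAt
  have h2 : ContMDiffAt 𝓘(ℂ, ℂ) 𝓘(ℂ, ℂ) ω (ext g ∘ (Subtype.val : disc R → ℂ)) x :=
    h1.contMDiffAt.comp x contMDiff_subtype_val.contMDiffAt
  have e : ext g ∘ (Subtype.val : disc R → ℂ) = g := funext fun y => ext_coe g y
  rw [e] at h2
  exact h2.contMDiffWithinAt

lemma SmoothFunOn.smoothAtOn {g : disc R → ℂ} {V : Set (disc R)} (hV : IsOpen V)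
    (h : SmoothFunOn g V) : SmoothAtOn (ext g) (Subtype.val '' V) := fun _ hz =>
  ContDiffOn.contDiffAt h ((isOpen_image_val hV).mem_nhds hz)

end Functions

lemma HolBundle.HolOn.smul {R : ℝ} {E : HolBundle.{u} R} {s : ∀ x, E.fiber x} {V : Set (disc R)}
    (hs : E.HolOn s V) (hV : IsOpen V) {g : disc R → ℂ} (hg : HolFunOn g V) :
    E.HolOn (fun x => g x • s x) V :=
  ContMDiffOn.smul_section (hg.contMDiffOn hV) hs

lemma HolBundle.HolOn.mono {R : ℝ} {E : HolBundle.{u} R} {s : ∀ x, E.fiber x} {V W : Set (disc R)}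
    (hs : E.HolOn s V) (hW : W ⊆ V) : E.HolOn s W :=
  ContMDiffOn.mono hs hW

/-! ### Eigenframes -/

variable {R : ℝ} {E : HiggsBundle.{u} R}

/-- A holomorphic frame on an open set `V` whose members are sections of `E₁` and `E₋₁`. -/
structure IsEigenframe (D : Splitting E) (V : Set (disc R)) (v : Fin 2 → ∀ x, E.fiber x) :
    Prop where
  isOpen : IsOpen V
  hol : ∀ i, E.HolOn (v i) V
  mem_one : ∀ x ∈ V, v 0 x ∈ D.E₁ x
  mem_neg : ∀ x ∈ V, v 1 x ∈ D.Eneg x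
  ne_zero : ∀ x ∈ V, ∀ i, v i x ≠ 0

lemma Splitting.linearIndependent (D : Splitting E) {x : disc R} {u w : E.fiber x}
    (hu : u ∈ D.E₁ x) (hw : w ∈ D.Eneg x) (hu0 : u ≠ 0) (hw0 : w ≠ 0) :
    LinearIndependent ℂ ![u, w] := by
  rw [LinearIndependent.pair_iff]
  intro s t hst
  have h1 : s • u = -(t • w) := eq_neg_of_add_eq_zero_left hst
  have h2 : s • u ∈ D.Eneg x := by
    rw [h1]; exact neg_mem (Submodule.smul_mem _ _ hw)
  have h3 : s • u = 0 :=
    Submodule.disjoint_def.1 (D.isCompl x).disjoint _ (Submodule.smul_mem _ _ hu) h2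
  have h4 : t • w = 0 := by rw [h3] at h1; exact neg_eq_zero.1 h1.symm
  exact ⟨(smul_eq_zero.1 h3).resolve_right hu0, (smul_eq_zero.1 h4).resolve_right hw0⟩

lemma Splitting.exists_smul_one (D : Splitting E) {x : disc R} {u : E.fiber x} (hu : u ∈ D.E₁ x)
    (hu0 : u ≠ 0) (w : E.fiber x) (hw : w ∈ D.E₁ x) : ∃ s : ℂ, w = s • u := by
  obtain ⟨s, hs⟩ := (finrank_eq_one_iff_of_nonzero' (⟨u, hu⟩ : D.E₁ x)
    (fun h => hu0 (congrArg Subtype.val h))).1 (D.rank_one x) ⟨w, hw⟩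
  exact ⟨s, (congrArg Subtype.val hs).symm⟩

lemma Splitting.exists_smul_neg (D : Splitting E) {x : disc R} {u : E.fiber x} (hu : u ∈ D.Eneg x)
    (hu0 : u ≠ 0) (w : E.fiber x) (hw : w ∈ D.Eneg x) : ∃ s : ℂ, w = s • u := by
  obtain ⟨s, hs⟩ := (finrank_eq_one_iff_of_nonzero' (⟨u, hu⟩ : D.Eneg x)
    (fun h => hu0 (congrArg Subtype.val h))).1 (D.rank_neg x) ⟨w, hw⟩
  exact ⟨s, (congrArg Subtype.val hs).symm⟩

lemma Splitting.exists_add (D : Splitting E) {x : disc R} (u : E.fiber x) :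
    ∃ y ∈ D.E₁ x, ∃ z ∈ D.Eneg x, u = y + z := by
  have : u ∈ D.E₁ x ⊔ D.Eneg x := by rw [(D.isCompl x).sup_eq_top]; trivial
  obtain ⟨y, hy, z, hz, h⟩ := Submodule.mem_sup.1 this
  exact ⟨y, hy, z, hz, h.symm⟩

lemma Splitting.exists_eq_add (D : Splitting E) {x : disc R} {u u' : E.fiber x} (hu : u ∈ D.E₁ x)
    (hu' : u' ∈ D.Eneg x) (hu0 : u ≠ 0) (hu'0 : u' ≠ 0) (w : E.fiber x) :
    ∃ s t : ℂ, w = s • u + t • u' := by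
  obtain ⟨y, hy, z, hz, rfl⟩ := D.exists_add w
  obtain ⟨s, rfl⟩ := D.exists_smul_one hu hu0 y hy
  obtain ⟨t, rfl⟩ := D.exists_smul_neg hu' hu'0 z hz
  exact ⟨s, t, rfl⟩

lemma Splitting.det_ne_zero (D : Splitting E) (K : DetTriv E.toHolBundle) {x : disc R}
    {u u' : E.fiber x} (hu : u ∈ D.E₁ x) (hu' : u' ∈ D.Eneg x) (hu0 : u ≠ 0) (hu'0 : u' ≠ 0) :
    K.κ x ![u, u'] ≠ 0 := fun h => by
  refine K.ne_zero x (AlternatingMap.ext fun w => ?_)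
  obtain ⟨s, t, h0⟩ := D.exists_eq_add hu hu' hu0 hu'0 (w 0)
  obtain ⟨s', t', h1⟩ := D.exists_eq_add hu hu' hu0 hu'0 (w 1)
  have hw : w = ![s • u + t • u', s' • u + t' • u'] := by
    ext i; fin_cases i
    · exact h0
    · exact h1
  have hadd0 : ∀ p q r : E.fiber x, K.κ x ![p + q, r] = K.κ x ![p, r] + K.κ x ![q, r] :=
    fun p q r => by simpa using (K.κ x).map_vecCons_add ![r] p q
  have hsmul0 : ∀ (c : ℂ) (p r : E.fiber x), K.κ x ![c • p, r] = c * K.κ x ![p, r] :=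
    fun c p r => by simpa using (K.κ x).map_vecCons_smul ![r] c p
  have hswap : ∀ p q : E.fiber x, K.κ x ![p, q] = -K.κ x ![q, p] := fun p q => by
    have h2 := (K.κ x).map_swap ![q, p] (i := 0) (j := 1) (by decide)
    rw [← h2]
    congr 1
    ext i; fin_cases i <;> simp
  have hself : ∀ p : E.fiber x, K.κ x ![p, p] = 0 := fun p =>
    (K.κ x).map_eq_zero_of_eq ![p, p] (i := 0) (j := 1) rfl (by decide)
  have h' : K.κ x ![u', u] = 0 := by rw [hswap, h, neg_zero]
  have r0 : ∀ (c e : ℂ) (p : E.fiber x), K.κ x ![p, c • u + e • u'] =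
      c * K.κ x ![p, u] + e * K.κ x ![p, u'] := fun c e p => by
    rw [hswap, hadd0, hsmul0, hsmul0, hswap (u) p, hswap (u') p]; ring
  rw [hw, hadd0, hsmul0, hsmul0, r0, r0, hself, hself, h, h']
  simp

namespace IsEigenframe
variable {D : Splitting E} {V W : Set (disc R)} {v : Fin 2 → ∀ x, E.fiber x}

lemma mono (F : IsEigenframe D V v) (hW : IsOpen W) (hWV : W ⊆ V) : IsEigenframe D W v :=
  ⟨hW, fun i => (F.hol i).mono hWV, fun x hx => F.mem_one x (hWV hx),
    fun x hx => F.mem_neg x (hWV hx), fun x hx => F.ne_zero x (hWV hx)⟩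

lemma smul (F : IsEigenframe D V v) {g : Fin 2 → disc R → ℂ} (hg : ∀ i, HolFunOn (g i) V)
    (hg0 : ∀ x ∈ V, ∀ i, g i x ≠ 0) : IsEigenframe D V fun i x => g i x • v i x :=
  ⟨F.isOpen, fun i => (F.hol i).smul F.isOpen (hg i),
    fun x hx => Submodule.smul_mem _ _ (F.mem_one x hx),
    fun x hx => Submodule.smul_mem _ _ (F.mem_neg x hx),
    fun x hx i => smul_ne_zero (hg0 x hx i) (F.ne_zero x hx i)⟩

lemma linearIndependent (F : IsEigenframe D V v) {x : disc R} (hx : x ∈ V) :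
    LinearIndependent ℂ ![v 0 x, v 1 x] :=
  D.linearIndependent (F.mem_one x hx) (F.mem_neg x hx) (F.ne_zero x hx 0) (F.ne_zero x hx 1)

lemma exists_eq (F : IsEigenframe D V v) {x : disc R} (hx : x ∈ V) (u : E.fiber x) :
    ∃ s t : ℂ, u = s • v 0 x + t • v 1 x :=
  D.exists_eq_add (F.mem_one x hx) (F.mem_neg x hx) (F.ne_zero x hx 0) (F.ne_zero x hx 1) u

lemma eta (x : disc R) : (v · x) = ![v 0 x, v 1 x] := by
  ext i; fin_cases i <;> rfl

lemma isLocalFrameOn (F : IsEigenframe D V v) :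
    IsLocalFrameOn 𝓘(ℂ, ℂ) Fib ω v V where
  linearIndependent {x} hx := by rw [eta]; exact F.linearIndependent hx
  generating {x} hx := fun u _ => by
    obtain ⟨s, t, rfl⟩ := F.exists_eq hx u
    exact add_mem (Submodule.smul_mem _ _ (Submodule.subset_span ⟨0, rfl⟩))
      (Submodule.smul_mem _ _ (Submodule.subset_span ⟨1, rfl⟩))
  contMDiffOn i := F.hol i

lemma det_ne_zero (F : IsEigenframe D V v) (K : DetTriv E.toHolBundle) {x : disc R} (hx : x ∈ V) :
    K.κ x ![v 0 x, v 1 x] ≠ 0 :=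
  D.det_ne_zero K (F.mem_one x hx) (F.mem_neg x hx) (F.ne_zero x hx 0) (F.ne_zero x hx 1)

/-- The norm of `ρ` in an eigenframe of determinant one. -/
lemma rhoNorm_eq (F : IsEigenframe D V v) (h : HermMetric E.toHolBundle) {x : disc R} (hx : x ∈ V)
    (hdet : form (h.core x) (v 0 x) (v 0 x) * form (h.core x) (v 1 x) (v 1 x) -
      form (h.core x) (v 0 x) (v 1 x) * form (h.core x) (v 1 x) (v 0 x) = 1) :
    rhoNorm D h x = ‖h.pair (v 0) (v 1) x‖ := by
  rw [rhoNorm, endNorm_sub_orthProj (h.core x) (p := D.proj x) (F.linearIndependent hx) (F.exists_eq hx) hdet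
    (D.exists_smul_one (F.mem_one x hx) (F.ne_zero x hx 0)) (F.mem_one x hx)
    (Submodule.projection_apply_of_mem_left _ (F.mem_one x hx))
    ((Submodule.projection_apply_eq_zero_iff _).2 (F.mem_neg x hx)), HermMetric.pair, ext_coe]

/-- The Hitchin equation in an eigenframe of determinant one. -/
theorem hitchinOn (F : IsEigenframe D V v) {h : HermMetric E.toHolBundle} (hh : IsHarmonic E h)
    (hdet : ∀ x ∈ V, form (h.core x) (v 0 x) (v 0 x) * form (h.core x) (v 1 x) (v 1 x) -
      form (h.core x) (v 0 x) (v 1 x) * form (h.core x) (v 1 x) (v 0 x) = 1) :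
    HitchinOn (Subtype.val '' V) (h.pair (v 0) (v 0)) (h.pair (v 1) (v 1))
      (h.pair (v 0) (v 1)) := by
  have hΩ : IsOpen (Subtype.val '' V : Set ℂ) := isOpen_image_val F.isOpen
  have hs : ∀ i j, SmoothAtOn (h.pair (v i) (v j)) (Subtype.val '' V) := fun i j =>
    (h.smooth V (v i) (v j) F.isOpen (F.hol i) (F.hol j)).smoothAtOn F.isOpen
  have hpair : ∀ i j (x : disc R), h.pair (v i) (v j) x = form (h.core x) (v i x) (v j x) :=
    fun i j x => ext_coe _ x
  have hconj : ∀ i j, ∀ z ∈ (Subtype.val '' V : Set ℂ),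
      conj (h.pair (v i) (v j) z) = h.pair (v j) (v i) z := by
    rintro i j _ ⟨x, hx, rfl⟩
    rw [hpair, hpair, form_conj]
  have hdet' : ∀ z ∈ (Subtype.val '' V : Set ℂ), h.pair (v 0) (v 0) z * h.pair (v 1) (v 1) z -
      h.pair (v 0) (v 1) z * h.pair (v 1) (v 0) z = 1 := by
    rintro _ ⟨x, hx, rfl⟩
    simp only [hpair]; exact hdet x hx
  have hpos : ∀ i, ∀ z ∈ (Subtype.val '' V : Set ℂ), 0 < (h.pair (v i) (v i) z).re := by
    rintro i _ ⟨x, hx, rfl⟩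
    rw [hpair]; exact form_self_re_pos _ (F.ne_zero x hx i)
  refine ⟨hΩ, hs 0 0, hs 1 1, hs 0 1, hconj 0 0, hconj 1 1, hpos 0, hpos 1, fun z hz => ?_,
    fun z hz => ?_⟩
  · rw [hconj 0 1 z hz]; exact hdet' z hz
  set a := h.pair (v 0) (v 0)
  set b := h.pair (v 0) (v 1)
  set b' := h.pair (v 1) (v 0)
  set d := h.pair (v 1) (v 1)
  set T : ℂ → ℂ := fun w => d w * dz a w - b' w * dz b w with hT
  set q : ℂ → ℂ := fun w => a w * dz b w - b w * dz a w with hq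
  have sa : SmoothAtOn a (Subtype.val '' V) := hs 0 0
  have sd : SmoothAtOn d (Subtype.val '' V) := hs 1 1
  have sb : SmoothAtOn b (Subtype.val '' V) := hs 0 1
  have sb' : SmoothAtOn b' (Subtype.val '' V) := hs 1 0
  have sT : SmoothAtOn T (Subtype.val '' V) := fun w hw =>
    (sd.mul sa.dz w hw).sub (sb'.mul sb.dz w hw)
  have sq : SmoothAtOn q (Subtype.val '' V) := fun w hw =>
    (sa.mul sb.dz w hw).sub (sb.mul sa.dz w hw)
  have hinv : ∀ w ∈ (Subtype.val '' V : Set ℂ),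
      (h.gramT v w)⁻¹ = !![d w, -b' w; -b w, a w] := fun w hw => by
    have e : h.gramT v w = !![a w, b' w; b w, d w] := by
      ext i j; fin_cases i <;> fin_cases j <;> rfl
    have hd : (h.gramT v w).det = 1 := by
      rw [e, Matrix.det_fin_two_of, ← hdet' w hw]; ring
    rw [Matrix.inv_def, hd, Ring.inverse_one, one_smul, e, Matrix.adjugate_fin_two_of]
  have hc0 : ∀ w ∈ (Subtype.val '' V : Set ℂ), h.chernForm v w 0 0 = T w := fun w hw => by
    rw [HermMetric.chernForm, hinv w hw, Matrix.mul_apply, Fin.sum_univ_two]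
    change d w * dz a w + -b' w * dz b w = d w * dz a w - b' w * dz b w
    ring
  have hc1 : ∀ w ∈ (Subtype.val '' V : Set ℂ), h.chernForm v w 1 0 = q w := fun w hw => by
    rw [HermMetric.chernForm, hinv w hw, Matrix.mul_apply, Fin.sum_univ_two]
    change -b w * dz a w + a w * dz b w = a w * dz b w - b w * dz a w
    ring
  have hcurv0 : h.chernCurv v z 0 0 = dzbar T z :=
    dzbar_congr (eventually_of_mem (hΩ.mem_nhds hz) hc0)
  have hcurv1 : h.chernCurv v z 1 0 = dzbar q z :=
    dzbar_congr (eventually_of_mem (hΩ.mem_nhds hz) hc1)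
  have hharm : dzbar T z * b z + dzbar q z * d z = 4 * b z * (1 + b z * b' z) := by
    obtain ⟨x, hx, rfl⟩ := hz
    have h1 := hh V v F.isOpen F.isLocalFrameOn x hx 0
    have h2 := form_commutator_adjoint (h.core x) (f := E.f x) (F.exists_eq hx)
      (D.f_one x _ (F.mem_one x hx)) (D.f_neg x _ (F.mem_neg x hx)) (hdet x hx)
    rw [← h1, Fin.sum_univ_two, form_add_left, form_smul_left, form_smul_left, hcurv0, hcurv1,
      ← hpair, ← hpair, ← hpair] at h2
    exact h2
  have hdzb : dz b =ᶠ[𝓝 z] fun w => b w * T w + d w * q w :=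
    eventually_of_mem (hΩ.mem_nhds hz) fun w hw => by
      simp only [hT, hq]
      linear_combination (-dz b w) * hdet' w hw
  rw [dzbar_congr hdzb, (((sb.hasWirtAt hz).mul (sT.hasWirtAt hz)).add
    ((sd.hasWirtAt hz).mul (sq.hasWirtAt hz))).dzbar_eq, hconj 0 1 z hz]
  linear_combination hharm

end IsEigenframe

lemma eq_zero_of_add_self {V : Type*} [AddCommGroup V] [Module ℂ V] {u : V} (h : u + u = 0) :
    u = 0 := by
  rw [← two_smul ℂ u] at h
  exact (smul_eq_zero.1 h).resolve_left two_ne_zero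

/-- Local existence of eigenframes. -/
theorem Splitting.exists_eigenframe (D : Splitting E) (K : DetTriv E.toHolBundle) (x₀ : disc R) :
    ∃ (V : Set (disc R)) (v : Fin 2 → ∀ x, E.fiber x), x₀ ∈ V ∧ IsEigenframe D V v := by
  let e := trivializationAt Fib E.fiber x₀
  have hx₀ : x₀ ∈ e.baseSet := mem_baseSet_trivializationAt Fib E.fiber x₀
  let β : Module.Basis (Fin 2) ℂ Fib := (EuclideanSpace.basisFun (Fin 2) ℂ).toBasis
  let s : Fin 2 → ∀ x, E.fiber x := e.localFrame β
  have hs : ∀ i, E.HolOn (s i) e.baseSet := fun i =>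
    e.contMDiffOn_localFrame_baseSet (I := 𝓘(ℂ, ℂ)) ω β i
  have hgen : ⊤ ≤ Submodule.span ℂ (range (s · x₀)) :=
    (e.isLocalFrameOn_localFrame_baseSet 𝓘(ℂ, ℂ) ω β).generating hx₀
  have hex : ∀ σ : ℂ, (∃ u, E.f x₀ u ≠ σ • u) → ∃ i, E.f x₀ (s i x₀) ≠ σ • s i x₀ := by
    rintro σ ⟨u, hu⟩
    by_contra! hall
    refine hu ?_
    have hu' : u ∈ Submodule.span ℂ (range (s · x₀)) := hgen trivial
    clear hu
    induction hu' using Submodule.span_induction with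
    | mem u hu => obtain ⟨i, rfl⟩ := hu; exact hall i
    | zero => simp
    | add u w _ _ hu hw => rw [map_add, hu, hw, smul_add]
    | smul c u _ hu => rw [map_smul, hu, smul_comm]
  obtain ⟨i, hi⟩ := hex (-1) (by
    have : Nontrivial (D.E₁ x₀) := Module.nontrivial_of_finrank_pos (R := ℂ)
      (by rw [D.rank_one]; norm_num)
    obtain ⟨⟨u, hu⟩, hu0⟩ := exists_ne (0 : D.E₁ x₀)
    refine ⟨u, fun h => hu0 (Subtype.ext ?_)⟩
    rw [D.f_one x₀ u hu, neg_one_smul] at h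
    exact eq_zero_of_add_self (eq_neg_iff_add_eq_zero.1 h))
  obtain ⟨j, hj⟩ := hex 1 (by
    have : Nontrivial (D.Eneg x₀) := Module.nontrivial_of_finrank_pos (R := ℂ)
      (by rw [D.rank_neg]; norm_num)
    obtain ⟨⟨u, hu⟩, hu0⟩ := exists_ne (0 : D.Eneg x₀)
    refine ⟨u, fun h => hu0 (Subtype.ext ?_)⟩
    rw [D.f_neg x₀ u hu, one_smul] at h
    exact eq_zero_of_add_self (eq_neg_iff_add_eq_zero.1 h.symm))
  let v₀ : ∀ x, E.fiber x := fun x => E.f x (s i x) + s i x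
  let v₁ : ∀ x, E.fiber x := fun x => E.f x (s j x) - s j x
  have hv₀ : E.HolOn v₀ e.baseSet :=
    ContMDiffOn.add_section (E.f_hol _ _ e.open_baseSet (hs i)) (hs i)
  have hv₁ : E.HolOn v₁ e.baseSet :=
    ContMDiffOn.sub_section (E.f_hol _ _ e.open_baseSet (hs j)) (hs j)
  have m₀ : ∀ x, v₀ x ∈ D.E₁ x := fun x => by
    obtain ⟨y, hy, z, hz, h⟩ := D.exists_add (s i x)
    change E.f x (s i x) + s i x ∈ _
    rw [h, map_add, D.f_one x y hy, D.f_neg x z hz, show y + -z + (y + z) = y + y by abel]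
    exact add_mem hy hy
  have m₁ : ∀ x, v₁ x ∈ D.Eneg x := fun x => by
    obtain ⟨y, hy, z, hz, h⟩ := D.exists_add (s j x)
    change E.f x (s j x) - s j x ∈ _
    rw [h, map_add, D.f_one x y hy, D.f_neg x z hz, show y + -z - (y + z) = -(z + z) by abel]
    exact neg_mem (add_mem hz hz)
  have hκ := K.hol _ v₀ v₁ e.open_baseSet hv₀ hv₁
  have hopen : IsOpen (e.baseSet ∩ (fun x => K.κ x ![v₀ x, v₁ x]) ⁻¹' {0}ᶜ) :=
    hκ.continuousOn.isOpen_inter_preimage e.open_baseSet isOpen_compl_singleton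
  have hne : K.κ x₀ ![v₀ x₀, v₁ x₀] ≠ 0 := by
    refine D.det_ne_zero K (m₀ x₀) (m₁ x₀) (fun h => hi ?_) fun h => hj ?_
    · rw [neg_one_smul]; exact eq_neg_of_add_eq_zero_left h
    · rw [one_smul]; exact sub_eq_zero.1 h
  refine ⟨e.baseSet ∩ (fun x => K.κ x ![v₀ x, v₁ x]) ⁻¹' {0}ᶜ, ![v₀, v₁], ⟨hx₀, hne⟩, hopen,
    fun k => ?_, fun x _ => m₀ x, fun x _ => m₁ x, fun x hx k h0 => hx.2 ?_⟩
  · fin_cases k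
    · exact hv₀.mono inter_subset_left
    · exact hv₁.mono inter_subset_left
  · refine (K.κ x).map_coord_zero k ?_
    fin_cases k <;> exact h0

/-- Local existence of eigenframes of determinant one. -/
theorem Splitting.exists_eigenframe_det_one (D : Splitting E) (K : DetTriv E.toHolBundle)
    (x₀ : disc R) : ∃ (V : Set (disc R)) (v : Fin 2 → ∀ x, E.fiber x), x₀ ∈ V ∧
      IsEigenframe D V v ∧ ∀ x ∈ V, K.κ x ![v 0 x, v 1 x] = 1 := by
  obtain ⟨V, v, hx₀, F⟩ := D.exists_eigenframe K x₀
  have hκ : HolFunOn (fun x => K.κ x ![v 0 x, v 1 x]) V :=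
    K.hol V (v 0) (v 1) F.isOpen (F.hol 0) (F.hol 1)
  have hinv : HolFunOn (fun x => (K.κ x ![v 0 x, v 1 x])⁻¹) V := by
    refine HolFunOn.of_eq (φ := fun z => (ext (fun x => K.κ x ![v 0 x, v 1 x]) z)⁻¹) ?_
      fun x _ => by rw [ext_coe]
    refine DifferentiableOn.inv hκ ?_
    rintro _ ⟨x, hx, rfl⟩
    rw [ext_coe]; exact F.det_ne_zero K hx
  have hone : HolFunOn (fun _ : disc R => (1 : ℂ)) V :=
    HolFunOn.of_eq (φ := fun _ => 1) (differentiableOn_const _) fun _ _ => rfl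
  have F' := F.smul (g := ![fun x => (K.κ x ![v 0 x, v 1 x])⁻¹, fun _ => 1])
    (by intro i; fin_cases i; exacts [hinv, hone])
    (by intro x hx i; fin_cases i; exacts [inv_ne_zero (F.det_ne_zero K hx), one_ne_zero])
  refine ⟨V, _, hx₀, F', fun x hx => ?_⟩
  have h := (K.κ x).map_vecCons_smul ![v 1 x] (K.κ x ![v 0 x, v 1 x])⁻¹ (v 0 x)
  simp only [Matrix.cons_val_zero, Matrix.cons_val_one, one_smul]
  refine h.trans ?_
  rw [smul_eq_mul]
  exact inv_mul_cancel₀ (F.det_ne_zero K hx)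

section Pairing
variable (S : SymPairing E) {D : Splitting E} {V : Set (disc R)} {v : Fin 2 → ∀ x, E.fiber x}

lemma SymPairing.eq_zero (D : Splitting E) {x : disc R} {u w : E.fiber x} (hu : u ∈ D.E₁ x)
    (hw : w ∈ D.Eneg x) : S.C x u w = 0 := by
  have h := S.self_adjoint x u w
  rw [D.f_one x u hu, D.f_neg x w hw, map_neg] at h
  exact self_eq_neg.1 h

lemma IsEigenframe.pairing_ne_zero (F : IsEigenframe D V v) {x : disc R} (hx : x ∈ V) (i : Fin 2) :
    S.C x (v i x) (v i x) ≠ 0 := fun h => by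
  have h01 := S.eq_zero D (F.mem_one x hx) (F.mem_neg x hx)
  refine F.ne_zero x hx i ((S.nondegenerate x).1 _ fun w => ?_)
  obtain ⟨s, t, rfl⟩ := F.exists_eq hx w
  rw [map_add, map_smul, map_smul]
  fin_cases i
  · change s • S.C x (v 0 x) (v 0 x) + t • S.C x (v 0 x) (v 1 x) = 0
    rw [h01, show S.C x (v 0 x) (v 0 x) = 0 from h]; simp
  · change s • S.C x (v 1 x) (v 0 x) + t • S.C x (v 1 x) (v 1 x) = 0
    rw [S.symm, h01, show S.C x (v 1 x) (v 1 x) = 0 from h]; simp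

/-- Local existence of eigenframes that are orthonormal for a symmetric pairing. -/
theorem Splitting.exists_eigenframe_orthonormal (D : Splitting E) (K : DetTriv E.toHolBundle)
    (x₀ : disc R) : ∃ (V : Set (disc R)) (v : Fin 2 → ∀ x, E.fiber x), x₀ ∈ V ∧
      IsEigenframe D V v ∧ ∀ i, ∀ x ∈ V, S.C x (v i x) (v i x) = 1 := by
  obtain ⟨V, v, hx₀, F⟩ := D.exists_eigenframe K x₀
  let g : Fin 2 → disc R → ℂ := fun i x => S.C x (v i x) (v i x)
  have hg : ∀ i, HolFunOn (g i) V := fun i => S.hol V (v i) (v i) F.isOpen (F.hol i) (F.hol i)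
  have hg0 : ∀ i, g i x₀ ≠ 0 := fun i => F.pairing_ne_zero S hx₀ i
  have hopen : ∀ i, IsOpen (V ∩ (fun x => g i x / g i x₀) ⁻¹' Complex.slitPlane) := fun i =>
    ((hg i).continuousOn.div_const _).isOpen_inter_preimage F.isOpen Complex.isOpen_slitPlane
  set W := (V ∩ (fun x => g 0 x / g 0 x₀) ⁻¹' Complex.slitPlane) ∩
    (V ∩ (fun x => g 1 x / g 1 x₀) ⁻¹' Complex.slitPlane) with hW
  have hWV : W ⊆ V := fun x hx => hx.1.1
  have hslit : ∀ i, ∀ x ∈ W, g i x / g i x₀ ∈ Complex.slitPlane := fun i x hx => by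
    fin_cases i
    exacts [hx.1.2, hx.2.2]
  have FW := F.mono ((hopen 0).inter (hopen 1)) hWV
  let c : Fin 2 → disc R → ℂ := fun i x =>
    Complex.exp (-Complex.log (g i x₀) / 2 - Complex.log (g i x / g i x₀) / 2)
  have hc : ∀ i, HolFunOn (c i) W := fun i => by
    refine HolFunOn.of_eq (φ := fun z => Complex.exp (-Complex.log (g i x₀) / 2 -
      Complex.log (ext (g i) z / g i x₀) / 2)) ?_ fun x _ => by rw [ext_coe]
    have h1 : DifferentiableOn ℂ (ext (g i)) (Subtype.val '' W) := (hg i).mono hWV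
    refine ((((h1.div_const _).clog ?_).div_const 2).const_sub _).cexp
    rintro _ ⟨x, hx, rfl⟩
    rw [ext_coe]; exact hslit i x hx
  refine ⟨W, _, ?_, FW.smul hc fun x _ i => Complex.exp_ne_zero _, fun i x hx => ?_⟩
  · have h1 : ∀ i, x₀ ∈ V ∩ (fun x => g i x / g i x₀) ⁻¹' Complex.slitPlane := fun i =>
      ⟨hx₀, by simp [div_self (hg0 i)]⟩
    exact ⟨h1 0, h1 1⟩
  · have hgx : g i x ≠ 0 := F.pairing_ne_zero S (hWV hx) i
    have hcc : c i x * c i x = (g i x)⁻¹ := by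
      simp only [c]
      rw [← Complex.exp_add, show -Complex.log (g i x₀) / 2 - Complex.log (g i x / g i x₀) / 2 +
        (-Complex.log (g i x₀) / 2 - Complex.log (g i x / g i x₀) / 2) =
        -(Complex.log (g i x₀) + Complex.log (g i x / g i x₀)) by ring, Complex.exp_neg,
        Complex.exp_add, Complex.exp_log (hg0 i), Complex.exp_log (div_ne_zero hgx (hg0 i)),
        mul_div_cancel₀ _ (hg0 i)]
    rw [map_smul, map_smul, LinearMap.smul_apply, smul_smul, hcc, smul_eq_mul]
    exact inv_mul_cancel₀ hgx

variable {S} in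
lemma IsEigenframe.gram_of_compatible (F : IsEigenframe D V v) {h : HermMetric E.toHolBundle}
    (hC : Compatible S h) (h1 : ∀ i, ∀ x ∈ V, S.C x (v i x) (v i x) = 1) {x : disc R}
    (hx : x ∈ V) :
    form (h.core x) (v 1 x) (v 1 x) = form (h.core x) (v 0 x) (v 0 x) ∧
    (form (h.core x) (v 0 x) (v 1 x)).re = 0 ∧
    form (h.core x) (v 0 x) (v 0 x) * form (h.core x) (v 1 x) (v 1 x) -
      form (h.core x) (v 0 x) (v 1 x) * form (h.core x) (v 1 x) (v 0 x) = 1 := by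
  have h01 := S.eq_zero D (F.mem_one x hx) (F.mem_neg x hx)
  exact HiggsDisc.gram_of_compatible (h.core x) (F.linearIndependent hx) (F.exists_eq hx)
    (h1 0 x hx) (h1 1 x hx) h01 (by rw [S.symm, h01]) (hC x)

variable {S} in
theorem IsEigenframe.symHitchinOn (F : IsEigenframe D V v) {h : HermMetric E.toHolBundle}
    (hh : IsHarmonic E h) (hC : Compatible S h)
    (h1 : ∀ i, ∀ x ∈ V, S.C x (v i x) (v i x) = 1) :
    SymHitchinOn (Subtype.val '' V) (h.pair (v 0) (v 0)) (h.pair (v 1) (v 1))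
      (h.pair (v 0) (v 1)) where
  toHitchinOn := F.hitchinOn hh fun _ hx => (F.gram_of_compatible hC h1 hx).2.2
  d_eq_a := by
    rintro _ ⟨x, hx, rfl⟩
    rw [HermMetric.pair, HermMetric.pair, ext_coe, ext_coe]
    exact (F.gram_of_compatible hC h1 hx).1
  b_re := by
    rintro _ ⟨x, hx, rfl⟩
    rw [HermMetric.pair, ext_coe]
    exact (F.gram_of_compatible hC h1 hx).2.1

end Pairing

lemma HermMetric.DetOne.gram_det {K : DetTriv E.toHolBundle} {h : HermMetric E.toHolBundle}
    (hd : h.DetOne K) {x : disc R} {u w : E.fiber x} (hκ : K.κ x ![u, w] = 1) :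
    form (h.core x) u u * form (h.core x) w w - form (h.core x) u w * form (h.core x) w u = 1 := by
  rw [hd x u w, hκ]; simp

/-- The function `|ρ|_h`, extended by zero to `ℂ`. -/
def rhoExt (D : Splitting E) (h : HermMetric E.toHolBundle) : ℂ → ℝ :=
  Function.extend Subtype.val (rhoNorm D h) 0

lemma rhoExt_coe (D : Splitting E) (h : HermMetric E.toHolBundle) (x : disc R) :
    rhoExt D h x = rhoNorm D h x :=
  Subtype.val_injective.extend_apply (rhoNorm D h) 0 x

lemma locallyHitchin_rhoExt (D : Splitting E) {K : DetTriv E.toHolBundle}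
    {h : HermMetric E.toHolBundle} (hh : h ∈ harmonicDetOne E K) :
    LocallyHitchin (rhoExt D h) R := fun z hz => by
  obtain ⟨V, v, hx₀, F, hκ⟩ := D.exists_eigenframe_det_one K ⟨z, hz⟩
  refine ⟨Subtype.val '' V, _, _, _, ⟨_, hx₀, rfl⟩, F.hitchinOn hh.1 fun x hx => hh.2.gram_det (hκ x hx), ?_⟩
  rintro _ ⟨x, hx, rfl⟩
  rw [rhoExt_coe, F.rhoNorm_eq h hx (hh.2.gram_det (hκ x hx))]

lemma exists_symHitchinOn_rhoExt (D : Splitting E) (K : DetTriv E.toHolBundle) {S : SymPairing E}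
    {h : HermMetric E.toHolBundle} (hh : h ∈ harmonicSym E S) :
    ∀ z ∈ Metric.ball (0 : ℂ) R, ∃ (Ω : Set ℂ) (a d b : ℂ → ℂ), z ∈ Ω ∧ SymHitchinOn Ω a d b ∧
      ∀ w ∈ Ω, rhoExt D h w = ‖b w‖ := fun z hz => by
  obtain ⟨V, v, hx₀, F, h1⟩ := D.exists_eigenframe_orthonormal S K ⟨z, hz⟩
  refine ⟨Subtype.val '' V, _, _, _, ⟨_, hx₀, rfl⟩, F.symHitchinOn hh.1 hh.2 h1, ?_⟩
  rintro _ ⟨x, hx, rfl⟩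
  rw [rhoExt_coe, F.rhoNorm_eq h hx (F.gram_of_compatible hh.2 h1 hx).2.2]

lemma IsAdapted.isEigenframe {D : Splitting E} {v : Fin 2 → ∀ x, E.fiber x} (hv : IsAdapted D v)
    (h0 : ∀ x i, v i x ≠ 0) : IsEigenframe D univ v :=
  ⟨isOpen_univ, hv.1, fun x _ => hv.2.1 x, fun x _ => hv.2.2 x, fun x _ => h0 x⟩

lemma iterate_dz_dzbar_congr {Ω : Set ℂ} (hΩ : IsOpen Ω) {f g : ℂ → ℂ} (h : EqOn f g Ω) (j k : ℕ) :
    EqOn (dz^[j] (dzbar^[k] f)) (dz^[j] (dzbar^[k] g)) Ω := by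
  have step : ∀ {f g : ℂ → ℂ}, EqOn f g Ω → EqOn (dz f) (dz g) Ω ∧ EqOn (dzbar f) (dzbar g) Ω :=
    fun h => ⟨fun z hz => dz_congr (h.eventuallyEq_of_mem (hΩ.mem_nhds hz)),
      fun z hz => dzbar_congr (h.eventuallyEq_of_mem (hΩ.mem_nhds hz))⟩
  have hk : EqOn (dzbar^[k] f) (dzbar^[k] g) Ω := by
    induction k generalizing f g with
    | zero => exact h
    | succ k ih => exact ih (step h).2
  induction j with
  | zero => exact hk
  | succ j ih => rw [Function.iterate_succ_apply', Function.iterate_succ_apply']; exact (step ih).1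

end HiggsDisc

end

open HiggsDisc in
theorem proposition23p9p27p20 (R₀ : ℝ) (hR₀ : 0 < R₀) :
    -- general estimate
    (∀ γ : ℝ, 0 < γ → γ < 2 * √2 → ∃ C : ℝ, 0 < C ∧
      ∀ R : ℝ, 2 * R₀ < R →
      ∀ (E : HiggsBundle.{u} R) (D : Splitting E) (K : DetTriv E.toHolBundle),
      ∀ h ∈ harmonicDetOne E K,
      ∀ z : disc R, ‖(z : ℂ)‖ < R - R₀ →
        rhoNorm D h z ≤ C * Real.exp (-γ * (R - ‖(z : ℂ)‖))) ∧
    -- refinement under an a-priori decay assumption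
    (∀ γ : ℝ, 0 < γ → γ < 4 → ∀ γ₀ : ℝ, 2 < γ₀ → ∀ B : ℝ, 0 < B → ∃ C : ℝ, 0 < C ∧
      ∀ R : ℝ, 2 * R₀ < R →
      ∀ (E : HiggsBundle.{u} R) (D : Splitting E) (K : DetTriv E.toHolBundle)
        (v : Fin 2 → ∀ x, E.fiber x), IsAdapted D v → (∀ x, K.κ x ![v 0 x, v 1 x] = 1) →
      ∀ h ∈ harmonicDetOne E K,
      (∀ z : disc R,
        ‖h.pair (v 0) (v 0) z‖ + ‖h.pair (v 1) (v 1) z‖ ≤ B ∧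
        ‖dz (h.pair (v 0) (v 0)) z‖ + ‖dz (h.pair (v 1) (v 1)) z‖
          + ‖dz (h.pair (v 0) (v 1)) z‖ + ‖dzbar (h.pair (v 0) (v 1)) z‖
          ≤ B * Real.exp (-γ₀ * (R - ‖(z : ℂ)‖))) →
      ∀ z : disc R, ‖(z : ℂ)‖ < R - R₀ →
        rhoNorm D h z ≤ C * Real.exp (-γ * (R - ‖(z : ℂ)‖))) ∧
    -- refinement in the symmetric case
    (∀ γ : ℝ, 0 < γ → γ < 4 → ∃ C : ℝ, 0 < C ∧
      ∀ R : ℝ, 2 * R₀ < R →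
      ∀ (E : HiggsBundle.{u} R) (D : Splitting E) (K : DetTriv E.toHolBundle)
        (S : SymPairing E), S.DetOne K →
      ∀ h ∈ harmonicSym E S,
      ∀ z : disc R, ‖(z : ℂ)‖ < R - R₀ →
        rhoNorm D h z ≤ C * Real.exp (-γ * (R - ‖(z : ℂ)‖))) ∧
    -- derivative bounds in the symmetric case
    (∀ γ : ℝ, 0 < γ → γ < 4 → ∀ j k : ℕ, ∃ C : ℝ, 0 < C ∧
      ∀ R : ℝ, 2 * R₀ < R →
      ∀ (E : HiggsBundle.{u} R) (D : Splitting E) (K : DetTriv E.toHolBundle)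
        (S : SymPairing E), S.DetOne K →
      ∀ (v : Fin 2 → ∀ x, E.fiber x), IsAdapted D v → (∀ i x, S.C x (v i x) (v i x) = 1) →
      ∀ h ∈ harmonicSym E S,
      ∀ z : disc R, ‖(z : ℂ)‖ < R - R₀ →
        (∀ i, ‖dz^[j] (dzbar^[k] fun w => h.pair (v i) (v i) w - 1) z‖
          ≤ C * Real.exp (-(2 * γ) * (R - ‖(z : ℂ)‖))) ∧
        ‖dz^[j] (dzbar^[k] (h.pair (v 0) (v 1))) z‖
          ≤ C * Real.exp (-γ * (R - ‖(z : ℂ)‖))) := by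
  refine ⟨fun γ hγ hγ' => ?_, fun γ hγ hγ' γ₀ hγ₀ B hB => ?_, fun γ hγ hγ' => ?_,
    fun γ hγ hγ' j k => ?_⟩
  · obtain ⟨C, hC, H⟩ := exists_decay_general hR₀ hγ hγ'
    refine ⟨C, hC, fun R hR E D K h hh z hz => ?_⟩
    rw [← rhoExt_coe]
    exact H R (by linarith) _ (locallyHitchin_rhoExt D hh) z (by simpa using hz.le)
  · obtain ⟨C, hC, H⟩ := exists_decay_refined hR₀ hγ hγ' hγ₀ hB
    refine ⟨C, hC, fun R hR E D K v hv hκ h hh hbd z hz => ?_⟩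
    have F : IsEigenframe D univ v := hv.isEigenframe fun x i h0 => by
      have h1 := (K.κ x).map_coord_zero (m := ![v 0 x, v 1 x]) i (by fin_cases i <;> exact h0)
      rw [hκ] at h1
      exact one_ne_zero h1
    have hH := F.hitchinOn hh.1 fun x _ => hh.2.gram_det (hκ x)
    rw [image_val_univ] at hH
    rw [F.rhoNorm_eq h (mem_univ z) (hh.2.gram_det (hκ z))]
    exact H R (by linarith) _ _ _ hH (fun w hw => hbd ⟨w, hw⟩) z (by simpa using hz.le)
  · obtain ⟨C, hC, H⟩ := exists_decay_symmetric hR₀ hγ hγ'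
    refine ⟨C, hC, fun R hR E D K S _ h hh z hz => ?_⟩
    rw [← rhoExt_coe]
    exact H R (by linarith) _ (exists_symHitchinOn_rhoExt D K hh) z (by simpa using hz.le)
  · obtain ⟨C, hC, H⟩ := exists_decay_derivatives hR₀ hγ hγ' j k
    refine ⟨C, hC, fun R hR E D K S _ v hv h1 h hh z hz => ?_⟩
    have F : IsEigenframe D univ v := hv.isEigenframe fun x i h0 => by
      have h2 := h1 i x
      rw [h0, map_zero] at h2
      exact zero_ne_one h2
    have hH := F.symHitchinOn hh.1 hh.2 fun i x _ => h1 i x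
    rw [image_val_univ] at hH
    obtain ⟨k1, k2⟩ := H R (by linarith) _ _ _ hH z (by simpa using hz.le)
    refine ⟨fun i => ?_, k2⟩
    fin_cases i
    · exact k1
    · refine (le_of_eq (congrArg norm ?_)).trans k1
      exact iterate_dz_dzbar_congr Metric.isOpen_ball
        (fun w hw => congrArg (· - 1) (hH.d_eq_a w hw)) j k z.2
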